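/- Let $m\ge 3$. Let $\mathbb{C}_m$ be the complex Clifford algebra generated by $e_1,\dots,e_m$ with $e_i^2=-1$ and $e_ie_k=-e_ke_i$ for $i\neq k$. Let $\dagger$ be the Hermitian conjugation, that is, the conjugate-linear anti-automorphism with $e_i^\dagger=-e_i$, and let $[a]_0$ be the scalar part of $a\in\mathbb{C}_m$. For $z\in\mathbb{C}^m$ write $\underline z=\sum_i z_ie_i$ and $\langle z,w\rangle=\sum_i z_iw_i$. Let $LB(0,1)=\{x+iy\in\mathbb{C}^m : |x|^2+|y|^2+2\sqrt{|x|^2|y|^2-\langle x,y\rangle^2}<1\}$ be the Lie ball. Its Lie sphere consists of the points $e^{i\theta}\omega$ with $\omega\in\mathbb{S}^{m-1}$ and $\theta\in[0,\pi)$. Let $\mathcal{OL}^2(LB(0,1))$ be the right $\mathbb{C}_m$-module of holomorphic $f:LB(0,1)\to\mathbb{C}_m$ that have a boundary value $f(e^{i\theta}\underline\omega)=\lim_{r\to1^-}f(re^{i\theta}\underline\omega)$ in $L^2([0,\pi)\times\mathbb{S}^{m-1},d\theta\,dS(\underline\omega))$ (limit in the $L^2$ sense). Its inner product is $\langle f,g\rangle=\int_{\mathbb{S}^{m-1}}\int_0^\pi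 f(e^{i\theta}\underline\omega)^\dagger g(e^{i\theta}\underline\omega)\,d\theta\,dS(\underline\omega)$. Let $t,s\in\mathbb{S}^{m-1}$ be orthogonal. Put $\underline\tau=\underline t+i\underline s$, so that $\underline\tau^\dagger=-\underline t+i\underline s$, and for $s,k\in\mathbb{N}=\{0,1,2,\dots\}$ put $$\psi_{\underline\tau,2s,k}(\underline z)=\underline\tau\,\langle \underline z,\underline\tau\rangle^{s+k}\langle \underline z,\underline\tau^\dagger\rangle^{s},\qquad \psi_{\underline\tau,2s+1,k}(\underline z)=\underline\tau^\dagger\underline\tau\,\langle \underline z,\underline\tau\rangle^{s+k+1}\langle \underline z,\underline\tau^\dagger\rangle^{s}$$ (here the index $s$ is a natural number). For a $\mathbb{C}_m$-valued homogeneous polynomial $P$ of degree $n$, let $P=\sum_{i=0}^n\underline z^iM_{n-i}$ be its Fischer decomposition, where each $M_l$ is a homogeneous polynomial of degree $l$ that is monogenic, that is, $\sum_i e_i\partial_{z_i}M_l=0$. Put $M[P]=M_n$. For $j,\alpha\in\mathbb{N}$ let $\mathfrak M^{j,\alpha}(\underline\tau)$ be the right $\mathbb{C}_m$-module generated by the functions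 $\underline z^jM[\psi_{\underline\tau,\alpha,k}](\underline z)$, $k\in\mathbb{N}$. Let $\bigoplus_\alpha\mathfrak M^{j,\alpha}(\underline\tau)$ be their orthogonal direct sum in $\mathcal{OL}^2(LB(0,1))$, i.e. the closure of their algebraic sum for the norm $[\langle f,f\rangle]_0^{1/2}$. **Theorem.** For every $j\in\mathbb{N}$ the orthogonal projection $\mathcal M_{\underline\tau,j}$ of $\mathcal{OL}^2(LB(0,1))$ onto $\bigoplus_{\alpha}\mathfrak M^{j,\alpha}(\underline\tau)$ (the monogenic Hua-Radon transform) exists and is the integral transform $$\mathcal M_{\underline\tau,j}[f](\underline z)=\int_0^\pi\int_{\mathbb{S}^{m-1}}K^j(\underline z,e^{-i\theta}\underline\omega)\,f(e^{i\theta}\underline\omega)\,dS(\underline\omega)\,d\theta,\qquad f\in\mathcal{OL}^2(LB(0,1)),\ \underline z\in LB(0,1),$$ where the integrand is integrable and the kernel is $$K^j(\underline z,e^{-i\theta}\underline\omega)=\sum_{\alpha\in\mathbb{N}}\underline z^j\,L^\alpha(\underline z,e^{-i\theta}\underline\omega)\,(e^{i\theta}\underline\omega)^{-j},$$ $$L^\alpha(\underline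 z,e^{-i\theta}\underline\omega)=\sum_{k=0}^\infty\lambda_k^\alpha\,M[\psi_{\underline\tau,\alpha,k}](\underline z)\,\big(M[\psi_{\underline\tau,\alpha,k}](e^{i\theta}\underline\omega)\big)^\dagger .$$ The double series $\sum_{\alpha,k}$ of the terms of the $L^\alpha$ is summable for $\underline z\in LB(0,1)$. The coefficients, with $A_m=2\pi^{m/2}/\Gamma(\tfrac m2)$ the area of $\mathbb{S}^{m-1}$, are $$\lambda_k^{2s}=\frac{1}{\pi A_m(\frac m2-1)}\cdot\frac{\Gamma(\frac m2+2s+k)^2}{4\,s!\,(s+k)!\,\Gamma(s-1+\frac m2)\,\Gamma(\frac m2+s+k)},$$ $$\lambda_k^{2s+1}=\frac{1}{\pi A_m(\frac m2-1)}\cdot\frac{\Gamma(\frac m2+2s+k+1)^2}{16\,s!\,(s+k+1)!\,\Gamma(s+\frac m2)\,\Gamma(\frac m2+s+k)} .$$ -/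

import Mathlib

open MeasureTheory Filter Topology
open scoped Matrix

namespace HuaRadon

noncomputable section

/-! ### The complex Clifford algebra `ℂ_m`

An element is given by its coordinates `a_A`, `A ⊆ {1,…,m}`, with respect to the elements
`e_A = e_{i₁} ⋯ e_{i_l}`, `i₁ < … < i_l`; the generators satisfy `e_i² = -1` and
`e_i e_j = - e_j e_i` for `i ≠ j`. Its norm is `(∑ |a_A|²)^{1/2}`. It is identified with Mathlib's
`CliffordAlgebra` in `cliffordEquiv` below. -/

/-- The complex Clifford algebra `ℂ_m`, as a vector space with coordinates indexed by `A`. -/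
def Cl (m : ℕ) : Type := EuclideanSpace ℂ (Finset (Fin m))

namespace Cl

variable {m : ℕ}

instance : NormedAddCommGroup (Cl m) :=
  inferInstanceAs (NormedAddCommGroup (EuclideanSpace ℂ (Finset (Fin m))))

instance : InnerProductSpace ℂ (Cl m) :=
  inferInstanceAs (InnerProductSpace ℂ (EuclideanSpace ℂ (Finset (Fin m))))

instance : FiniteDimensional ℂ (Cl m) :=
  inferInstanceAs (FiniteDimensional ℂ (EuclideanSpace ℂ (Finset (Fin m))))

instance : CompleteSpace (Cl m) :=
  inferInstanceAs (CompleteSpace (EuclideanSpace ℂ (Finset (Fin m))))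

/-- The coordinate `a_A` of a Clifford number. -/
def coord (a : Cl m) (A : Finset (Fin m)) : ℂ := (show EuclideanSpace ℂ (Finset (Fin m)) from a) A

/-- The Clifford number with given coordinates. -/
def ofCoord (c : Finset (Fin m) → ℂ) : Cl m :=
  (WithLp.toLp 2 c : EuclideanSpace ℂ (Finset (Fin m)))

@[simp] theorem coord_ofCoord (c : Finset (Fin m) → ℂ) (A : Finset (Fin m)) :
    (ofCoord c).coord A = c A := rfl

@[ext] theorem ext {a b : Cl m} (h : ∀ A, a.coord A = b.coord A) : a = b :=
  PiLp.ext h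

@[simp] theorem coord_add (a b : Cl m) (A : Finset (Fin m)) :
    (a + b).coord A = a.coord A + b.coord A := rfl

@[simp] theorem coord_zero (A : Finset (Fin m)) : (0 : Cl m).coord A = 0 := rfl

@[simp] theorem coord_neg (a : Cl m) (A : Finset (Fin m)) : (-a).coord A = -a.coord A := rfl

@[simp] theorem coord_smul (c : ℂ) (a : Cl m) (A : Finset (Fin m)) :
    (c • a).coord A = c * a.coord A := rfl

/-- The coordinate as a linear functional. -/
def coordLM (A : Finset (Fin m)) : Cl m →ₗ[ℂ] ℂ where
  toFun a := a.coord A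
  map_add' _ _ := rfl
  map_smul' _ _ := rfl

@[simp] theorem coord_sum {ι : Type*} (s : Finset ι) (f : ι → Cl m) (A : Finset (Fin m)) :
    (∑ i ∈ s, f i).coord A = ∑ i ∈ s, (f i).coord A :=
  map_sum (coordLM A) f s

/-- The sign in `e_A e_B = sgn A B e_{A ∆ B}`: every pair `(a, b) ∈ A × B` with `b ≤ a`
contributes a factor `-1` (an interchange if `b < a`, a square if `b = a`). -/
def sgn (A B : Finset (Fin m)) : ℂ := ∏ a ∈ A, ∏ b ∈ B, if b ≤ a then -1 else 1

theorem prod_symmDiff {f : Fin m → ℂ} (hf : ∀ i, f i * f i = 1) (A B : Finset (Fin m)) :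
    ∏ i ∈ symmDiff A B, f i = (∏ i ∈ A, f i) * ∏ i ∈ B, f i := by
  have hA := Finset.prod_sdiff (f := f) (Finset.inter_subset_left (s₁ := A) (s₂ := B))
  have hB := Finset.prod_sdiff (f := f) (Finset.inter_subset_right (s₁ := A) (s₂ := B))
  rw [Finset.sdiff_inter_self_left] at hA
  rw [Finset.sdiff_inter_self_right] at hB
  have hI : (∏ i ∈ A ∩ B, f i) * (∏ i ∈ A ∩ B, f i) = 1 := by
    rw [← Finset.prod_mul_distrib]; exact Finset.prod_eq_one fun i _ => hf i
  have hd : Disjoint (A \ B) (B \ A) := disjoint_sdiff_sdiff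
  have hu : symmDiff A B = (A \ B).disjUnion (B \ A) hd := by
    rw [Finset.disjUnion_eq_union]; rfl
  rw [hu, Finset.prod_disjUnion, ← hA, ← hB]
  linear_combination (-(∏ i ∈ A \ B, f i) * (∏ i ∈ B \ A, f i)) * hI

theorem sgn_symmDiff_left (A A' B : Finset (Fin m)) :
    sgn (symmDiff A A') B = sgn A B * sgn A' B := by
  refine prod_symmDiff (fun i => ?_) A A'
  rw [← Finset.prod_mul_distrib]
  exact Finset.prod_eq_one fun j _ => by split_ifs <;> norm_num

theorem sgn_symmDiff_right (A B B' : Finset (Fin m)) :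
    sgn A (symmDiff B B') = sgn A B * sgn A B' := by
  unfold sgn
  rw [← Finset.prod_mul_distrib]
  exact Finset.prod_congr rfl fun i _ =>
    prod_symmDiff (fun j => by split_ifs <;> norm_num) B B'

@[simp] theorem sgn_empty_left (B : Finset (Fin m)) : sgn ∅ B = 1 := rfl

@[simp] theorem sgn_empty_right (A : Finset (Fin m)) : sgn A ∅ = 1 := by simp [sgn]

theorem sgn_mul_self (A B : Finset (Fin m)) : sgn A B * sgn A B = 1 := by
  rw [← sgn_symmDiff_left, symmDiff_self]; rfl

/-- The product with `e_A e_B = sgn A B e_{A ∆ B}`; the coordinate at `C` collects `B = A ∆ C`. -/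
instance : Mul (Cl m) :=
  ⟨fun a b => ofCoord fun C =>
    ∑ A, sgn A (symmDiff A C) * (a.coord A * b.coord (symmDiff A C))⟩

instance : One (Cl m) := ⟨ofCoord fun A => if A = ∅ then 1 else 0⟩

theorem coord_mul (a b : Cl m) (C : Finset (Fin m)) :
    (a * b).coord C =
      ∑ A, sgn A (symmDiff A C) * (a.coord A * b.coord (symmDiff A C)) := rfl

theorem coord_one (A : Finset (Fin m)) : (1 : Cl m).coord A = if A = ∅ then 1 else 0 := rfl

/-- Translation by a set for the symmetric difference. -/
def symmEquiv (C : Finset (Fin m)) : Finset (Fin m) ≃ Finset (Fin m) :=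
  Equiv.mk (fun A => symmDiff A C) (fun A => symmDiff A C)
    (fun A => symmDiff_symmDiff_cancel_right C A) (fun A => symmDiff_symmDiff_cancel_right C A)

theorem mul_assoc' (a b c : Cl m) : a * b * c = a * (b * c) := by
  ext D
  simp only [coord_mul, Finset.sum_mul, Finset.mul_sum]
  rw [Finset.sum_comm]
  refine Finset.sum_congr rfl fun A _ => ?_
  refine Fintype.sum_equiv (symmEquiv A) _ _ fun C => ?_
  have e0 : symmEquiv A C = symmDiff A C := symmDiff_comm C A
  have e1 : symmDiff (symmDiff A C) (symmDiff A D) = symmDiff C D := by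
    rw [symmDiff_comm A C, symmDiff_assoc, symmDiff_symmDiff_cancel_left]
  have e2 : symmDiff (symmDiff A D) (symmDiff C D) = symmDiff A C := by
    rw [symmDiff_assoc, symmDiff_comm C D, symmDiff_symmDiff_cancel_left]
  rw [e0, e1, sgn_symmDiff_left A C (symmDiff C D), ← e2, sgn_symmDiff_right A (symmDiff A D)]
  rw [e2]
  ring

instance : Ring (Cl m) :=
  { (inferInstance : AddCommGroup (Cl m)) with
    mul := (· * ·)
    one := 1
    left_distrib := fun a b c => by
      ext C; simp [coord_mul, mul_add, Finset.sum_add_distrib]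
    right_distrib := fun a b c => by
      ext C; simp [coord_mul, mul_add, add_mul, Finset.sum_add_distrib]
    zero_mul := fun a => by ext C; simp [coord_mul]
    mul_zero := fun a => by ext C; simp [coord_mul]
    mul_assoc := mul_assoc'
    one_mul := fun a => by
      ext C
      simp only [coord_mul, coord_one]
      rw [Finset.sum_eq_single ∅]
      · simp [← Finset.bot_eq_empty]
        simp [Finset.bot_eq_empty]
      · intro A _ hA; simp [hA]
      · simp
    mul_one := fun a => by
      ext C
      simp only [coord_mul, coord_one]
      rw [Finset.sum_eq_single C]
      · simp [← Finset.bot_eq_empty]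
        simp [Finset.bot_eq_empty]
      · intro A _ hA
        have : symmDiff A C ≠ ∅ := fun h => hA (symmDiff_eq_bot.mp h)
        simp [this]
      · simp }

instance : Algebra ℂ (Cl m) :=
  Algebra.ofModule
    (fun r a b => by
      ext C; simp only [coord_mul, coord_smul, Finset.mul_sum]
      exact Finset.sum_congr rfl fun A _ => by ring)
    (fun r a b => by
      ext C; simp only [coord_mul, coord_smul, Finset.mul_sum]
      exact Finset.sum_congr rfl fun A _ => by ring)

/-- The basis element `e_A`. -/
def e (A : Finset (Fin m)) : Cl m := ofCoord fun B => if B = A then 1 else 0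

theorem coord_e (A B : Finset (Fin m)) : (e A).coord B = if B = A then 1 else 0 := rfl

theorem e_mul_e (A B : Finset (Fin m)) : e A * e B = sgn A B • e (symmDiff A B) := by
  ext C
  simp only [coord_mul, coord_smul, coord_e]
  rw [Finset.sum_eq_single A]
  · by_cases h : C = symmDiff A B
    · subst h; simp
    · have : symmDiff A C ≠ B := fun h' => h (by rw [← h', symmDiff_symmDiff_cancel_left])
      simp [h, this]
  · intro A' _ h; simp [h]
  · simp

theorem e_empty : e (∅ : Finset (Fin m)) = 1 := rfl

theorem e_sq (i : Fin m) : (e {i} : Cl m) * e {i} = -1 := by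
  rw [e_mul_e, symmDiff_self, Finset.bot_eq_empty, e_empty]; simp [sgn]

theorem e_anticomm {i j : Fin m} (h : i ≠ j) :
    (e {i} : Cl m) * e {j} + e {j} * e {i} = 0 := by
  rw [e_mul_e, e_mul_e, symmDiff_comm ({j} : Finset (Fin m)) {i}, ← add_smul]
  rcases lt_or_gt_of_ne h with h | h <;> simp [sgn, h.le, not_le.mpr h]

theorem eq_sum (a : Cl m) : a = ∑ A, a.coord A • e A := by
  ext B; simp [coord_e]

/-- The Hermitian conjugation: `(∑ a_A e_A)† = ∑ conj a_A e_A†`, where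
`e_A† = (-1)^{|A|(|A|+1)/2} e_A = sgn A A • e_A` is the inverse of `e_A`. -/
def dagger (a : Cl m) : Cl m := ofCoord fun A => sgn A A * starRingEnd ℂ (a.coord A)

theorem coord_dagger (a : Cl m) (A : Finset (Fin m)) :
    (dagger a).coord A = sgn A A * starRingEnd ℂ (a.coord A) := rfl

theorem conj_sgn (A B : Finset (Fin m)) : starRingEnd ℂ (sgn A B) = sgn A B := by
  simp only [sgn, map_prod]
  exact Finset.prod_congr rfl fun i _ => Finset.prod_congr rfl fun j _ => by split_ifs <;> simp

theorem dagger_mul (a b : Cl m) : dagger (a * b) = dagger b * dagger a := by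
  ext C
  simp only [coord_mul, coord_dagger, map_sum, map_mul, conj_sgn, Finset.mul_sum]
  refine Fintype.sum_equiv (symmEquiv C) _ _ fun A => ?_
  have e0 : symmEquiv C A = symmDiff A C := rfl
  have e1 : symmDiff (symmDiff A C) C = A := symmDiff_symmDiff_cancel_right C A
  have e2 : sgn C C = sgn A A * sgn A (symmDiff A C) * sgn (symmDiff A C) A
      * sgn (symmDiff A C) (symmDiff A C) := by
    conv_lhs => rw [← symmDiff_symmDiff_cancel_left A C]
    rw [sgn_symmDiff_left, sgn_symmDiff_right A A, sgn_symmDiff_right (symmDiff A C) A]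
    ring
  rw [e0, e1, e2]
  have h := sgn_mul_self A (symmDiff A C)
  linear_combination (sgn A A * sgn (symmDiff A C) A * sgn (symmDiff A C) (symmDiff A C)
    * starRingEnd ℂ (a.coord A) * starRingEnd ℂ (b.coord (symmDiff A C))) * h

theorem dagger_e (i : Fin m) : dagger (e {i} : Cl m) = -e {i} := by
  ext A
  by_cases h : A = {i}
  · subst h; simp [coord_dagger, coord_e, sgn]
  · simp [coord_dagger, coord_e, h]

/-- The `1`-vector `∑ z_i e_i`. -/
def vec : (Fin m → ℂ) →ₗ[ℂ] Cl m where
  toFun z := ∑ i, z i • e {i}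
  map_add' z w := by simp [add_smul, Finset.sum_add_distrib]
  map_smul' c z := by simp [mul_smul, Finset.smul_sum]

theorem vec_apply (z : Fin m → ℂ) : vec z = ∑ i, z i • e {i} := rfl

/-- The Hermitian conjugate of a `1`-vector with coordinates `τ_i` is the `1`-vector with
coordinates `- conj τ_i`. -/
theorem dagger_vec (z : Fin m → ℂ) : dagger (vec z) = vec (-star z) := by
  ext A
  simp only [vec_apply, coord_dagger, coord_sum, coord_smul, coord_e, map_sum, Finset.mul_sum]
  refine Finset.sum_congr rfl fun i _ => ?_
  by_cases h : A = {i}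
  · subst h; simp [sgn]
  · simp [h]

theorem vec_mul_vec (z w : Fin m → ℂ) :
    (vec z : Cl m) * vec w + vec w * vec z = (-2 * (z ⬝ᵥ w)) • 1 := by
  have key : ∀ i j : Fin m, (e {i} : Cl m) * e {j} + e {j} * e {i} =
      (if i = j then (-2 : ℂ) else 0) • 1 := by
    intro i j
    split_ifs with h
    · subst h; rw [e_sq]; module
    · rw [e_anticomm h]; simp
  have h1 : (vec w : Cl m) * vec z = ∑ i, ∑ j, (z i * w j) • (e {j} * e {i} : Cl m) := by
    rw [vec_apply, vec_apply, Finset.sum_mul_sum, Finset.sum_comm]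
    refine Finset.sum_congr rfl fun i _ => Finset.sum_congr rfl fun j _ => ?_
    rw [smul_mul_smul_comm, mul_comm]
  have h2 : (vec z : Cl m) * vec w = ∑ i, ∑ j, (z i * w j) • (e {i} * e {j} : Cl m) := by
    rw [vec_apply, vec_apply, Finset.sum_mul_sum]
    refine Finset.sum_congr rfl fun i _ => Finset.sum_congr rfl fun j _ => ?_
    rw [smul_mul_smul_comm]
  rw [h1, h2, ← Finset.sum_add_distrib]
  simp_rw [← Finset.sum_add_distrib, ← smul_add, key, smul_smul, ← Finset.sum_smul]
  congr 1
  simp [dotProduct, Finset.mul_sum, mul_comm]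

/-- The quadratic form `z ↦ -∑ z_i²` on `ℂ^m`. -/
def Q (m : ℕ) : QuadraticForm ℂ (Fin m → ℂ) := QuadraticMap.weightedSumSquares ℂ fun _ => (-1 : ℂ)

theorem vec_sq (z : Fin m → ℂ) : (vec z : Cl m) * vec z = algebraMap ℂ (Cl m) (Q m z) := by
  have h := vec_mul_vec z z
  have h' : Q m z = -(z ⬝ᵥ z) := by
    simp [Q, QuadraticMap.weightedSumSquares_apply, dotProduct]
  rw [Algebra.algebraMap_eq_smul_one, h']
  have h2 : (2 : ℂ) • ((vec z : Cl m) * vec z) = (2 : ℂ) • ((-(z ⬝ᵥ z)) • (1 : Cl m)) := by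
    rw [two_smul, h, smul_smul]; ring_nf
  exact smul_right_injective _ (two_ne_zero' ℂ) h2

/-- The homomorphism from Mathlib's Clifford algebra of the form `z ↦ -∑ z_i²`. -/
def ofClifford (m : ℕ) : CliffordAlgebra (Q m) →ₐ[ℂ] Cl m :=
  CliffordAlgebra.lift (Q m) ⟨vec, vec_sq⟩

theorem vec_single (i : Fin m) : (vec (Pi.single i 1) : Cl m) = e {i} := by
  rw [vec_apply, Finset.sum_eq_single i]
  · simp
  · intro j _ h; simp [h]
  · simp

theorem ofClifford_surjective (m : ℕ) : Function.Surjective (ofClifford m) := by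
  rw [← AlgHom.range_eq_top, eq_top_iff]
  have hv : ∀ i : Fin m, (e {i} : Cl m) ∈ (ofClifford m).range := fun i =>
    ⟨CliffordAlgebra.ι (Q m) (Pi.single i 1), by
      rw [← vec_single]; exact CliffordAlgebra.lift_ι_apply _ _ _⟩
  have he : ∀ A : Finset (Fin m), (e A : Cl m) ∈ (ofClifford m).range := by
    intro A
    induction A using Finset.induction_on with
    | empty => rw [e_empty]; exact one_mem _
    | insert i A hi ih =>
      have h1 := (ofClifford m).range.mul_mem (hv i) ih
      have hs : symmDiff {i} A = insert i A := by
        rw [Disjoint.symmDiff_eq_sup (Finset.disjoint_singleton_left.mpr hi)]; rfl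
      rw [e_mul_e, hs] at h1
      have h2 := (ofClifford m).range.smul_mem h1 (sgn {i} A)
      rwa [smul_smul, sgn_mul_self, one_smul] at h2
  intro a _
  rw [eq_sum a]
  exact sum_mem fun A _ => (ofClifford m).range.smul_mem (he A) _

theorem ofClifford_injective (m : ℕ) : Function.Injective (ofClifford m) := by
  let b := ((Pi.basisFun ℂ (Fin m)).ExteriorAlgebra).map (CliffordAlgebra.equivExterior (Q m)).symm
  have : FiniteDimensional ℂ (CliffordAlgebra (Q m)) := b.finiteDimensional_of_finite
  have h1 : Module.finrank ℂ (CliffordAlgebra (Q m)) = Module.finrank ℂ (Cl m) := by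
    rw [Module.finrank_eq_card_basis b]
    exact (finrank_euclideanSpace (𝕜 := ℂ) (ι := Finset (Fin m))).symm
  exact (LinearMap.injective_iff_surjective_of_finrank_eq_finrank
    (f := (ofClifford m).toLinearMap) h1).mpr (ofClifford_surjective m)

/-- `Cl m` is Mathlib's Clifford algebra of the form `z ↦ -∑ z_i²` on `ℂ^m`. -/
def cliffordEquiv (m : ℕ) : CliffordAlgebra (Q m) ≃ₐ[ℂ] Cl m :=
  AlgEquiv.ofBijective (ofClifford m) ⟨ofClifford_injective m, ofClifford_surjective m⟩

end Cl

open Cl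

/-! ### Clifford analysis -/

/-- The complexified Dirac operator `∂_z f = ∑ e_i ∂_{z_i} f`. -/
def dirac {m : ℕ} (f : (Fin m → ℂ) → Cl m) (z : Fin m → ℂ) : Cl m :=
  ∑ i, e {i} * fderiv ℂ f z (Pi.single i 1)

/-- (Left) monogenic functions on `ℂ^m`: holomorphic functions in the kernel of `∂_z`. -/
def IsMonogenic {m : ℕ} (f : (Fin m → ℂ) → Cl m) : Prop :=
  Differentiable ℂ f ∧ ∀ z, dirac f z = 0

/-- `ℂ_m`-valued homogeneous polynomials of degree `k` in `z_1, …, z_m`. -/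
def IsHomogeneousPoly {m : ℕ} (k : ℕ) (f : (Fin m → ℂ) → Cl m) : Prop :=
  ∀ A, ∃ p : MvPolynomial (Fin m) ℂ, p.IsHomogeneous k ∧ ∀ z, (f z).coord A = MvPolynomial.eval z p

/-- The Fischer decomposition `P(z) = ∑_{i=0}^k z^i M_{k-i}(z)` of a homogeneous polynomial of
degree `k`, with `M_i` a monogenic homogeneous polynomial of degree `i`. -/
def IsFischerDecomposition {m : ℕ} (k : ℕ) (P : (Fin m → ℂ) → Cl m)
    (M : ℕ → (Fin m → ℂ) → Cl m) : Prop :=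
  (∀ i ≤ k, IsHomogeneousPoly i (M i) ∧ IsMonogenic (M i)) ∧
    ∀ z, P z = ∑ i ∈ Finset.range (k + 1), vec z ^ i * M (k - i) z

open Classical in
/-- The monogenic projection `M[P] = M_k` of a homogeneous polynomial `P` of degree `k`, the
component of degree `k` in the Fischer decomposition of `P`. -/
def monogenicProj {m : ℕ} (k : ℕ) (P : (Fin m → ℂ) → Cl m) : (Fin m → ℂ) → Cl m :=
  if h : ∃ M, IsFischerDecomposition k P M then h.choose k else 0

/-! ### The Lie ball, the Lie sphere and the space `OL²(LB(0,1))` -/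

/-- The square of the Lie norm, `L(x+iy)² = |x|² + |y|² + 2|x ∧ y|`, where
`|x ∧ y|² = |x|²|y|² - ⟨x,y⟩²`. -/
def lieNormSq {m : ℕ} (z : Fin m → ℂ) : ℝ :=
  (∑ i, (z i).re ^ 2) + (∑ i, (z i).im ^ 2) +
    2 * √((∑ i, (z i).re ^ 2) * (∑ i, (z i).im ^ 2) - (∑ i, (z i).re * (z i).im) ^ 2)

/-- The Lie ball `LB(0,1) = {z ∈ ℂ^m : L(z) < 1}`. -/
def lieBall (m : ℕ) : Set (Fin m → ℂ) := {z | lieNormSq z < 1}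

/-- The unit sphere `S^{m-1}` of `ℝ^m`. -/
abbrev UnitSphere (m : ℕ) : Type := Metric.sphere (0 : EuclideanSpace ℝ (Fin m)) 1

/-- The point `e^{iθ} ω` of the Lie sphere, for `θ ∈ [0,π)` and `ω ∈ S^{m-1}`. -/
def liePoint {m : ℕ} (p : ℝ × UnitSphere m) : Fin m → ℂ :=
  fun i => Complex.exp (p.1 * Complex.I) * (((p.2 : EuclideanSpace ℝ (Fin m)) i : ℝ) : ℂ)

/-- The measure `dθ dS(ω)` on `[0,π) × S^{m-1}`, with `dS` the surface measure. -/
def lieMeasure (m : ℕ) : Measure (ℝ × UnitSphere m) :=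
  (volume.restrict (Set.Ico 0 Real.pi)).prod
    (volume : Measure (EuclideanSpace ℝ (Fin m))).toSphere

/-- `g` is the `L²` boundary value of `f` on the Lie sphere: `g ∈ L²(LS^{m-1})` and
`f(r e^{iθ} ω) → g(θ, ω)` in `L²(LS^{m-1})` as `r → 1⁻`. -/
def IsBoundaryValue {m : ℕ} (f : (Fin m → ℂ) → Cl m) (g : ℝ × UnitSphere m → Cl m) : Prop :=
  MemLp g 2 (lieMeasure m) ∧
    Tendsto (fun r : ℝ => eLpNorm (fun p => f ((r : ℂ) • liePoint p) - g p) 2 (lieMeasure m))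
      (𝓝[<] 1) (𝓝 0)

/-- `f ∈ OL²(LB(0,1))`: `f` is holomorphic in the Lie ball and has a boundary value in
`L²(LS^{m-1})`. Only the values of `f` in the Lie ball matter. -/
def MemOL2 {m : ℕ} (f : (Fin m → ℂ) → Cl m) : Prop :=
  DifferentiableOn ℂ f (lieBall m) ∧ ∃ g, IsBoundaryValue f g

open Classical in
/-- The boundary value `f(e^{iθ} ω)` (unique up to null sets) of a function in `OL²(LB(0,1))`. -/
def bdry {m : ℕ} (f : (Fin m → ℂ) → Cl m) : ℝ × UnitSphere m → Cl m :=
  if h : ∃ g, IsBoundaryValue f g then h.choose else 0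

/-- The `ℂ_m`-valued inner product `⟨f,g⟩ = ∫∫ f†(e^{iθ} ω) g(e^{iθ} ω) dθ dS(ω)`. -/
def innerOL2 {m : ℕ} (f g : (Fin m → ℂ) → Cl m) : Cl m :=
  ∫ p, dagger (bdry f p) * bdry g p ∂lieMeasure m

/-! ### The monogenic Hua-Radon transform -/

/-- The vector `τ = t + i s`. -/
def tau {m : ℕ} (t s : EuclideanSpace ℝ (Fin m)) : Fin m → ℂ :=
  fun i => (t i : ℂ) + Complex.I * (s i : ℂ)

/-- `ψ_{τ,2s,k}(z) = τ ⟨z,τ⟩^{s+k} ⟨z,τ†⟩^s` and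
`ψ_{τ,2s+1,k}(z) = τ† τ ⟨z,τ⟩^{s+k+1} ⟨z,τ†⟩^s`, where `⟨·,·⟩` is the bilinear product and the
`1`-vector `τ†` has coordinates `- conj τ_i`. -/
def psi {m : ℕ} (τ : Fin m → ℂ) (α k : ℕ) (z : Fin m → ℂ) : Cl m :=
  if Even α then ((z ⬝ᵥ τ) ^ (α / 2 + k) * (z ⬝ᵥ (-star τ)) ^ (α / 2)) • vec τ
  else ((z ⬝ᵥ τ) ^ (α / 2 + k + 1) * (z ⬝ᵥ (-star τ)) ^ (α / 2)) • (dagger (vec τ) * vec τ)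

/-- `M[ψ_{τ,α,k}]`, where `ψ_{τ,α,k}` is homogeneous of degree `α + k`. -/
def Mpsi {m : ℕ} (τ : Fin m → ℂ) (α k : ℕ) : (Fin m → ℂ) → Cl m :=
  monogenicProj (α + k) (psi τ α k)

/-- `ψ^j_{τ,α,k}(z) = z^j M[ψ_{τ,α,k}](z)`. -/
def psij {m : ℕ} (τ : Fin m → ℂ) (j α k : ℕ) (z : Fin m → ℂ) : Cl m :=
  vec z ^ j * Mpsi τ α k z

/-- The right `ℂ_m`-module `𝔐^{j,α}(τ)` generated by `ψ^j_{τ,α,k}`, `k ∈ ℕ`. -/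
def modM {m : ℕ} (τ : Fin m → ℂ) (j α : ℕ) : Submodule (Cl m)ᵐᵒᵖ ((Fin m → ℂ) → Cl m) :=
  Submodule.span (Cl m)ᵐᵒᵖ (Set.range fun k => psij τ j α k)

/-- The orthogonal direct sum of the modules `𝔐^{j,α}(τ)`, `α ∈ ℕ`, in `OL²(LB(0,1))`: the closure
of their algebraic sum for the norm `[⟨f,f⟩]_0^{1/2}`. -/
def huaSpace {m : ℕ} (τ : Fin m → ℂ) (j : ℕ) : Set ((Fin m → ℂ) → Cl m) :=
  {g | MemOL2 g ∧ ∀ ε > 0, ∃ q ∈ ⨆ α, modM τ j α, ((innerOL2 (g - q) (g - q)).coord ∅).re < ε}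

/-- `g = 𝓜_{τ,j}[f]`: `g` is the orthogonal projection of `f ∈ OL²(LB(0,1))` onto the orthogonal
direct sum of the modules `𝔐^{j,α}(τ)`. -/
def IsHuaRadonTransform {m : ℕ} (τ : Fin m → ℂ) (j : ℕ) (f g : (Fin m → ℂ) → Cl m) : Prop :=
  g ∈ huaSpace τ j ∧ ∀ h ∈ huaSpace τ j, innerOL2 h (f - g) = 0

/-! ### The kernel -/

/-- The area `A_m = 2 π^{m/2} / Γ(m/2)` of `S^{m-1}`. -/
def sphereArea (m : ℕ) : ℝ := 2 * Real.pi ^ ((m : ℝ) / 2) / Real.Gamma ((m : ℝ) / 2)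

/-- The coefficients `λ_k^α`, with `s = ⌊α/2⌋`. -/
def lam (m α k : ℕ) : ℝ :=
  if Even α then
    1 / (Real.pi * sphereArea m * ((m : ℝ) / 2 - 1)) *
      (Real.Gamma ((m : ℝ) / 2 + 2 * (α / 2 : ℕ) + k) ^ 2 /
        (4 * (α / 2).factorial * (α / 2 + k).factorial *
          Real.Gamma ((α / 2 : ℕ) - 1 + (m : ℝ) / 2) * Real.Gamma ((m : ℝ) / 2 + (α / 2 : ℕ) + k)))
  else
    1 / (Real.pi * sphereArea m * ((m : ℝ) / 2 - 1)) *
      (Real.Gamma ((m : ℝ) / 2 + 2 * (α / 2 : ℕ) + k + 1) ^ 2 /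
        (16 * (α / 2).factorial * (α / 2 + k + 1).factorial *
          Real.Gamma ((α / 2 : ℕ) + (m : ℝ) / 2) * Real.Gamma ((m : ℝ) / 2 + (α / 2 : ℕ) + k)))

/-- The terms of the series `L^α(z,u)`, where `u = e^{-iθ} ω` and hence `conj u = e^{iθ} ω`. -/
def kernelTerm {m : ℕ} (τ : Fin m → ℂ) (α k : ℕ) (z u : Fin m → ℂ) : Cl m :=
  ((lam m α k : ℝ) : ℂ) • (Mpsi τ α k z * dagger (Mpsi τ α k (star u)))

/-- `L^α(z,u) = ∑_k λ_k^α M[ψ_{τ,α,k}](z) (M[ψ_{τ,α,k}](conj u))†`. -/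
def kernelL {m : ℕ} (τ : Fin m → ℂ) (α : ℕ) (z u : Fin m → ℂ) : Cl m :=
  ∑' k, kernelTerm τ α k z u

/-- `K^{j,α}(z,u) = z^j L^α(z,u) (conj u)^{-j}`. -/
def kernelKα {m : ℕ} (τ : Fin m → ℂ) (j α : ℕ) (z u : Fin m → ℂ) : Cl m :=
  vec z ^ j * kernelL τ α z u * Ring.inverse (vec (star u)) ^ j

/-- `K^j(z,u) = ∑_α K^{j,α}(z,u)`. -/
def kernelK {m : ℕ} (τ : Fin m → ℂ) (j : ℕ) (z u : Fin m → ℂ) : Cl m :=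
  ∑' α, kernelKα τ j α z u

end

end HuaRadon

/-!
The boundary value map embeds `OL²(LB(0,1))` into the Hilbert space `L²` of the Lie sphere, so the
transform is an orthogonal projection, and it is an integral operator as soon as the modules
`𝔐^{j,α}(τ)` have an orthogonal system of generators for which the series of the kernel converges.

*Generators.* `M[ψ_{τ,α,k}]` has the explicit form `∑ C_i z^i ψ_{τ,α-i,k}` (`Mpsi_eq`): the Dirac
operator maps `ψ_{τ,α,k}` to a multiple of `ψ_{τ,α-1,k}`, the `C_i` make the sum monogenic, and on
the real sphere functions `z R` are orthogonal to the monogenic polynomials of their degree, which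
makes the top component of a Fischer decomposition unique (`monogenicProj_eq`). That orthogonality
comes from integration by parts on the sphere (`integral_sphere_inner_smul`).

*Gram matrix.* In an inner product with a monogenic polynomial, `M[ψ]` may be replaced by `ψ`, and
the linear factors of `ψ` can be traded one by one for derivatives of the other function. As `∂_τ`
maps `M[ψ_{τ,α+2,k}]` to a multiple of `M[ψ_{τ,α,k+1}]` (`dirD_neg_monoPsi`), this gives recursions
which the coefficients `λ` satisfy as well (`smul_pairJ_monoPsi`). On the Lie sphere `z^j` is
unitary and the integral over `θ` separates the degrees, two degrees of different parity being
separated by `ω ↦ -ω`. Hence `∫ g† g'` vanishes for two different generators, and equals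
`τ† τ / (4 λ)` for `g = g'` (`integral_dagger_gen_mul_gen`). Since `g τ† τ = 4 g`, the maps
`f ↦ λ g ∫ g† f` are mutually orthogonal projections.

*Convergence.* A homogeneous polynomial of degree `n` is bounded on the sphere by its `L²` norm
times a power of `n + 1` (`exists_norm_sq_le_integral_sphere`, from the Schwarz lemma on complex
lines), and inside the Lie ball by the `n`-th power of the Lie norm (`IsHom.norm_le_lieNorm`). The
latter is a maximum principle on the Lie ball, whose points lie on analytic discs
`ζ ↦ w + ζ conj w` of constant Lie norm with boundary in a multiple of the Lie sphere. So the kernel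
series converges normally, and the transform is a holomorphic function, equal to the integral of the
kernel (`hua_eq_integral`), with the expected `L²` boundary value (`isBoundaryValue_hua`).

*Projection.* The sum of the components lies in the closure of the modules, and the remainder is
orthogonal to it (`isHuaRadonTransform_hua`). Two projections of `f` have the same boundary value;
by Cauchy's formula on the circles `ζ ω` and the maximum principle, a function whose boundary value
vanishes is zero in the Lie ball (`eq_zero_of_bdry_ae_eq_zero`).
-/

namespace HuaRadon

noncomputable section

open Cl

section

/-! ### The Clifford algebra as a normed algebra with involution -/

namespace Cl

variable {m : ℕ}

/-- The Clifford product as a continuous bilinear map. -/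
def mulL (m : ℕ) : Cl m →L[ℂ] Cl m →L[ℂ] Cl m :=
  LinearMap.toContinuousLinearMap
    ((LinearMap.toContinuousLinearMap (𝕜 := ℂ) (E := Cl m) (F' := Cl m)).toLinearMap ∘ₗ
      LinearMap.mul ℂ (Cl m))

@[simp] theorem mulL_apply (a b : Cl m) : mulL m a b = a * b := rfl

instance : ContinuousMul (Cl m) :=
  ⟨(mulL m).continuous₂⟩

theorem norm_mul_le_mulL (a b : Cl m) : ‖a * b‖ ≤ ‖mulL m‖ * ‖a‖ * ‖b‖ :=
  (mulL m).le_opNorm₂ a b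

theorem dagger_add (a b : Cl m) : dagger (a + b) = dagger a + dagger b := by
  ext A; simp [coord_dagger, mul_add]

theorem dagger_smul (c : ℂ) (a : Cl m) : dagger (c • a) = starRingEnd ℂ c • dagger a := by
  ext A; simp [coord_dagger]; ring

theorem dagger_dagger (a : Cl m) : dagger (dagger a) = a := by
  ext A
  rw [coord_dagger, coord_dagger, map_mul, conj_sgn, ← mul_assoc, sgn_mul_self, one_mul,
    Complex.conj_conj]

@[simp] theorem dagger_one : dagger (1 : Cl m) = 1 := by
  ext A
  by_cases h : A = ∅ <;> simp [coord_dagger, coord_one, h]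

@[simp] theorem dagger_zero : dagger (0 : Cl m) = 0 := by
  ext A; simp [coord_dagger]

theorem dagger_pow (a : Cl m) (n : ℕ) : dagger (a ^ n) = dagger a ^ n := by
  induction n with
  | zero => simp
  | succ n ih => rw [pow_succ, dagger_mul, ih, pow_succ']

theorem norm_sq_eq (a : Cl m) : ‖a‖ ^ 2 = ∑ A, ‖a.coord A‖ ^ 2 :=
  EuclideanSpace.norm_sq_eq (𝕜 := ℂ) (n := Finset (Fin m)) a

theorem norm_sgn (A B : Finset (Fin m)) : ‖sgn A B‖ = 1 := by
  have h := congrArg norm (sgn_mul_self A B)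
  rw [norm_mul, norm_one] at h
  nlinarith [norm_nonneg (sgn A B)]

theorem norm_dagger (a : Cl m) : ‖dagger a‖ = ‖a‖ := by
  have : ‖dagger a‖ ^ 2 = ‖a‖ ^ 2 := by
    rw [norm_sq_eq, norm_sq_eq]
    exact Finset.sum_congr rfl fun A _ => by
      rw [coord_dagger, norm_mul, norm_sgn, one_mul, RCLike.norm_conj]
  exact (sq_eq_sq₀ (norm_nonneg _) (norm_nonneg _)).mp this

/-- The Hermitian conjugation as a real-linear map. -/
def daggerR (m : ℕ) : Cl m →L[ℝ] Cl m :=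
  LinearMap.mkContinuous
    { toFun := dagger
      map_add' := dagger_add
      map_smul' := fun c a => by
        rw [← Complex.coe_smul, dagger_smul, Complex.conj_ofReal, Complex.coe_smul]; rfl } 1
    fun a => by simp [norm_dagger]

@[fun_prop]
theorem continuous_dagger : Continuous (dagger : Cl m → Cl m) := (daggerR m).continuous

/-- The scalar part of `a† b` is the Hermitian inner product of the coordinates. -/
theorem coord_dagger_mul (a b : Cl m) : (dagger a * b).coord ∅ = inner ℂ a b := by
  rw [coord_mul]
  have : inner ℂ a b = ∑ A, b.coord A * starRingEnd ℂ (a.coord A) :=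
    PiLp.inner_apply (𝕜 := ℂ) (ι := Finset (Fin m)) (f := fun _ => ℂ) a b
  rw [this]
  refine Finset.sum_congr rfl fun A _ => ?_
  have h : symmDiff A ∅ = A := symmDiff_bot A
  rw [h, coord_dagger, ← mul_assoc, ← mul_assoc, sgn_mul_self]
  ring

/-- The coordinate as a continuous linear functional. -/
def coordL (A : Finset (Fin m)) : Cl m →L[ℂ] ℂ := LinearMap.toContinuousLinearMap (coordLM A)

@[simp] theorem coordL_apply (a : Cl m) (A : Finset (Fin m)) : coordL A a = a.coord A := rfl

/-- The `1`-vectors, as a continuous linear map. -/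
def vecL (m : ℕ) : (Fin m → ℂ) →L[ℂ] Cl m := LinearMap.toContinuousLinearMap vec

theorem vec_mul_self (z : Fin m → ℂ) : (vec z : Cl m) * vec z = (-(z ⬝ᵥ z)) • 1 := by
  have h : (2 : ℂ) • ((vec z : Cl m) * vec z) = (2 : ℂ) • ((-(z ⬝ᵥ z)) • (1 : Cl m)) := by
    rw [two_smul, vec_mul_vec, smul_smul]; ring_nf
  exact smul_right_injective _ (two_ne_zero' ℂ) h

theorem vec_mul_comm (z w : Fin m → ℂ) :
    (vec z : Cl m) * vec w = (-2 * (z ⬝ᵥ w)) • 1 - vec w * vec z := by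
  rw [← vec_mul_vec z w]; abel

end Cl

end

section

/-! ### Integration of homogeneous functions over the sphere -/

section Derivative

variable {𝕜 E G : Type*} [NontriviallyNormedField 𝕜] [NormedAddCommGroup E] [NormedSpace 𝕜 E]
  [NormedAddCommGroup G] [NormedSpace 𝕜 G]

theorem fderiv_homogeneous {F : E → G} {d : ℕ} (hd : ContDiff 𝕜 1 F)
    (hF : ∀ (c : 𝕜) x, F (c • x) = c ^ (d + 1) • F x) (v : E) (c : 𝕜) (x : E) :
    fderiv 𝕜 F (c • x) v = c ^ d • fderiv 𝕜 F x v := by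
  have hc : Continuous (fderiv 𝕜 F) := hd.continuous_fderiv one_ne_zero
  have key : Set.EqOn (fun c : 𝕜 => fderiv 𝕜 F (c • x) v) (fun c => c ^ d • fderiv 𝕜 F x v)
      {0}ᶜ := by
    intro c hc0
    have h1 : fderiv 𝕜 (fun y => F (c • y)) x = fderiv 𝕜 (fun y => c ^ (d + 1) • F y) x := by
      congr 1; funext y; exact hF c y
    rw [fderiv_comp_smul, fderiv_fun_const_smul (hd.differentiable one_ne_zero x)] at h1
    have h2 := congrArg (fun L => c⁻¹ • L v) h1
    simpa [pow_succ', smul_smul, inv_mul_cancel₀ (show c ≠ 0 from hc0),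
      inv_mul_cancel_left₀ (show c ≠ 0 from hc0)] using h2
  have h := Continuous.ext_on (dense_compl_singleton (0 : 𝕜)) (by fun_prop) (by fun_prop) key
  exact congrFun h c

theorem fderiv_homogeneous_zero {F : E → G} (hF : ∀ (c : 𝕜) x, F (c • x) = c ^ 0 • F x) (x : E) :
    fderiv 𝕜 F x = 0 := by
  have : F = fun _ => F 0 := by
    funext y
    have := hF 0 y
    simpa using this.symm
  rw [this]
  simp

end Derivative

section Homogeneous

variable {E G : Type*} [NormedAddCommGroup E] [NormedSpace ℝ E] [NormedAddCommGroup G]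
  [NormedSpace ℝ G]

theorem norm_le_of_homogeneous [ProperSpace E] {F : E → G} {d : ℕ} (hc : Continuous F)
    (hF : ∀ (c : ℝ) x, F (c • x) = c ^ d • F x) : ∃ C, ∀ x, ‖F x‖ ≤ C * ‖x‖ ^ d := by
  obtain ⟨C, hC⟩ := (isCompact_closedBall (0 : E) 1).exists_bound_of_continuousOn hc.continuousOn
  refine ⟨C, fun x => ?_⟩
  have h : F x = ‖x‖ ^ d • F (‖x‖⁻¹ • x) := by
    rcases eq_or_ne x 0 with rfl | hx
    · rw [smul_zero, ← hF, smul_zero]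
    · rw [← hF, smul_inv_smul₀ (norm_ne_zero_iff.mpr hx)]
  rw [h, norm_smul, norm_pow, norm_norm, mul_comm]
  gcongr
  refine hC _ ?_
  rw [mem_closedBall_zero_iff, norm_smul, norm_inv, norm_norm]
  exact inv_mul_le_one

end Homogeneous

theorem integrableOn_pow_mul_gaussian (n : ℕ) :
    IntegrableOn (fun r : ℝ => r ^ n * Real.exp (-r ^ 2)) (Set.Ioi 0) := by
  have h := integrableOn_rpow_mul_exp_neg_mul_sq (b := 1) one_pos (s := n) (by
    have : (0 : ℝ) ≤ n := n.cast_nonneg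
    linarith)
  simpa [Real.rpow_natCast] using h

theorem integral_pow_mul_gaussian (n : ℕ) :
    ∫ r in Set.Ioi (0 : ℝ), r ^ n * Real.exp (-r ^ 2) = 1 / 2 * Real.Gamma ((n + 1) / 2) := by
  have h := integral_rpow_mul_exp_neg_rpow (p := 2) (q := n) two_pos (by
    have : (0 : ℝ) ≤ n := n.cast_nonneg
    linarith)
  rw [← h]
  simp

section Polar

variable {E G : Type*} [NormedAddCommGroup E] [InnerProductSpace ℝ E] [FiniteDimensional ℝ E]
  [Nontrivial E] [MeasurableSpace E] [BorelSpace E] [NormedAddCommGroup G] [NormedSpace ℝ G]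

open Module in
/-- Polar coordinates for a homogeneous function times a radial weight. -/
theorem integral_radial_smul_homogeneous {F : E → G} {d : ℕ}
    (hF : ∀ (c : ℝ) x, F (c • x) = c ^ d • F x) (w : ℝ → ℝ) :
    ∫ x, w ‖x‖ • F x =
      (∫ r in Set.Ioi (0 : ℝ), r ^ (d + (finrank ℝ E - 1)) * w r) •
        ∫ ω, F ω ∂(volume : Measure E).toSphere := by
  calc
    ∫ x, w ‖x‖ • F x
      = ∫ x : ({(0)}ᶜ : Set E), w ‖x.1‖ • F x.1 ∂((volume : Measure E).comap (↑)) := by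
      rw [integral_subtype_comap (measurableSet_singleton _).compl fun x ↦ w ‖x‖ • F x,
        restrict_compl_singleton]
    _ = ∫ z, (z.2.1 ^ d * w z.2) • F z.1
          ∂(volume : Measure E).toSphere.prod (.volumeIoiPow (finrank ℝ E - 1)) := by
      rw [← (volume : Measure E).measurePreserving_homeomorphUnitSphereProd.integral_comp
        (Homeomorph.measurableEmbedding _)]
      refine integral_congr_ae (Eventually.of_forall fun x => ?_)
      have hx : ‖x.1‖ ≠ 0 := norm_ne_zero_iff.mpr x.2
      have h : F x.1 = ‖x.1‖ ^ d • F (‖x.1‖⁻¹ • x.1) := by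
        rw [← hF, smul_inv_smul₀ hx]
      simp only [homeomorphUnitSphereProd_apply_snd_coe, homeomorphUnitSphereProd_apply_fst_coe]
      rw [h, smul_smul, mul_comm]
    _ = (∫ r : Set.Ioi (0 : ℝ), r.1 ^ d * w r ∂.volumeIoiPow (finrank ℝ E - 1)) •
          ∫ ω, F ω ∂(volume : Measure E).toSphere := by
      rw [← integral_prod_swap]
      exact integral_prod_smul (fun r : Set.Ioi (0 : ℝ) => r.1 ^ d * w r)
        (fun ω : Metric.sphere (0 : E) 1 => F ω)
    _ = _ := by
      congr 1
      simp only [Measure.volumeIoiPow, ENNReal.ofReal]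
      rw [integral_withDensity_eq_integral_smul,
        integral_subtype_comap measurableSet_Ioi
          fun a ↦ Real.toNNReal (a ^ (finrank ℝ E - 1)) • (a ^ d * w a),
        setIntegral_congr_fun measurableSet_Ioi fun x hx ↦ ?_]
      · have hx' : (0 : ℝ) < x := hx
        simp only [NNReal.smul_def, smul_eq_mul]
        rw [Real.coe_toNNReal _ (pow_nonneg hx'.le _), pow_add]
        ring
      · exact (measurable_subtype_coe.pow_const _).real_toNNReal

theorem integrable_gaussian_smul {F : E → G} {d : ℕ} (hc : Continuous F)
    (hF : ∀ (c : ℝ) x, F (c • x) = c ^ d • F x) :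
    Integrable fun x => Real.exp (-‖x‖ ^ 2) • F x := by
  obtain ⟨C, hC⟩ := norm_le_of_homogeneous hc hF
  have h : Integrable fun x : E => ‖x‖ ^ d * Real.exp (-‖x‖ ^ 2) := by
    refine (integrable_fun_norm_addHaar (volume : Measure E)
      (f := fun r => r ^ d * Real.exp (-r ^ 2))).mpr ?_
    refine (integrableOn_pow_mul_gaussian (Module.finrank ℝ E - 1 + d)).congr_fun
      (fun r _ => ?_) measurableSet_Ioi
    simp only [smul_eq_mul, pow_add]; ring
  refine (h.const_mul C).mono' (by fun_prop) (Eventually.of_forall fun x => ?_)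
  rw [norm_smul, Real.norm_of_nonneg (Real.exp_pos _).le]
  calc _ ≤ Real.exp (-‖x‖ ^ 2) * (C * ‖x‖ ^ d) := by gcongr; exact hC x
    _ = _ := by ring

open Module in
/-- Integration by parts on the sphere for a homogeneous function, obtained from integration by
parts against the Gaussian `exp (-|x|²)` in polar coordinates. -/
theorem integral_sphere_inner_smul [CompleteSpace G] {F : E → G} {d : ℕ} (hd : ContDiff ℝ 1 F)
    (hF : ∀ (c : ℝ) x, F (c • x) = c ^ d • F x) (v : E) (hE : 2 ≤ finrank ℝ E) :
    ((d : ℝ) + finrank ℝ E - 1) • ∫ ω, inner ℝ v (ω : E) • F ω ∂(volume : Measure E).toSphere =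
      ∫ ω, fderiv ℝ F ω v ∂(volume : Measure E).toSphere := by
  have hF1 : ∀ (c : ℝ) x, inner ℝ v (c • x) • F (c • x) = c ^ (d + 1) • (inner ℝ v x • F x) := by
    intro c x
    rw [hF, inner_smul_right, smul_smul, smul_smul]; ring_nf
  -- the derivative is homogeneous of degree `d - 1`, and vanishes if `d = 0`
  have hF2 : ∀ (c : ℝ) x, fderiv ℝ F (c • x) v = c ^ (d - 1) • fderiv ℝ F x v := by
    intro c x
    rcases d with _ | d
    · simp [fderiv_homogeneous_zero hF]
    · exact fderiv_homogeneous hd hF v c x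
  have hc2 : Continuous fun x => fderiv ℝ F x v :=
    (hd.continuous_fderiv one_ne_zero).clm_apply continuous_const
  have hg : ∀ x : E, HasFDerivAt (fun x : E => Real.exp (-‖x‖ ^ 2))
      (Real.exp (-‖x‖ ^ 2) • -((2 : ℕ) • innerSL ℝ x : E →L[ℝ] ℝ)) x :=
    fun x => ((hasStrictFDerivAt_norm_sq x).hasFDerivAt.neg).exp
  have hg' : ∀ x : E, fderiv ℝ (fun x : E => Real.exp (-‖x‖ ^ 2)) x v =
      -2 * (Real.exp (-‖x‖ ^ 2) * inner ℝ v x) := fun x => by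
    rw [(hg x).fderiv]
    simp [real_inner_comm]; ring
  have hFc := hd.continuous
  have i1 := integrable_gaussian_smul (F := fun x => inner ℝ v x • F x) (by fun_prop) hF1
  have hfun : (fun x : E => (-2 : ℝ) • (Real.exp (-‖x‖ ^ 2) • inner ℝ v x • F x)) =
      fun x : E => fderiv ℝ (fun x : E => Real.exp (-‖x‖ ^ 2)) x v • F x := by
    funext x; rw [hg', smul_smul, smul_smul]; ring_nf
  have ibp := integral_smul_fderiv_eq_neg_fderiv_smul_of_integrable (μ := (volume : Measure E))
    (𝕜 := ℝ) (f := fun x : E => Real.exp (-‖x‖ ^ 2)) (g := F) (v := v)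
    (hfun ▸ i1.smul (-2 : ℝ))
    (integrable_gaussian_smul hc2 hF2) (integrable_gaussian_smul hd.continuous hF)
    (fun x _ => (hg x).differentiableAt) (fun x _ => hd.differentiable one_ne_zero x)
  rw [← hfun, integral_smul, integral_radial_smul_homogeneous hF2 (fun r => Real.exp (-r ^ 2)),
    integral_radial_smul_homogeneous hF1 (fun r => Real.exp (-r ^ 2)),
    integral_pow_mul_gaussian, integral_pow_mul_gaussian, neg_smul, neg_neg, smul_smul] at ibp
  rcases d with _ | d
  · have h0 : ∀ x, fderiv ℝ F x v = 0 := fun x => by simp [fderiv_homogeneous_zero hF]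
    have hpos : (0 : ℝ) < 2 * (1 / 2 * Real.Gamma (((0 + 1 + (finrank ℝ E - 1) : ℕ) + 1) / 2)) := by
      have := Real.Gamma_pos_of_pos (s := ((0 + 1 + (finrank ℝ E - 1) : ℕ) + 1) / 2) (by positivity)
      positivity
    simp only [h0, integral_zero, smul_zero] at ibp ⊢
    rw [(smul_eq_zero.mp ibp.symm).resolve_left hpos.ne', smul_zero]
  · have e1 : (((d + 1 - 1 + (finrank ℝ E - 1) : ℕ) : ℝ) + 1) / 2 = (d + finrank ℝ E) / 2 := by
      rw [Nat.add_sub_cancel]; push_cast [Nat.cast_sub (by omega : 1 ≤ finrank ℝ E)]; ring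
    have e2 : (((d + 1 + 1 + (finrank ℝ E - 1) : ℕ) : ℝ) + 1) / 2 = (d + finrank ℝ E) / 2 + 1 := by
      push_cast [Nat.cast_sub (by omega : 1 ≤ finrank ℝ E)]; ring
    have hp : (0 : ℝ) < (d + finrank ℝ E) / 2 := by positivity
    have hG := Real.Gamma_pos_of_pos hp
    rw [e1, e2, Real.Gamma_add_one hp.ne'] at ibp
    have hc : (1 / 2 * Real.Gamma ((d + finrank ℝ E : ℝ) / 2)) ≠ 0 := by positivity
    apply smul_right_injective _ hc
    simp only
    rw [ibp, smul_smul]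
    congr 1
    push_cast
    ring

end Polar

end

open scoped ContDiff

section

/-! ### Homogeneous, harmonic and monogenic functions -/

variable {m : ℕ}

/-- The directional derivative `∂_v F`. -/
def dirD {E : Type*} [NormedAddCommGroup E] [NormedSpace ℂ E] (v : Fin m → ℂ)
    (F : (Fin m → ℂ) → E) (z : Fin m → ℂ) : E := fderiv ℂ F z v

/-- Entire functions on `ℂ^m` that are homogeneous of degree `d` (that is, homogeneous
polynomials, in a form suited to differentiation). -/
structure IsHom {E : Type*} [NormedAddCommGroup E] [NormedSpace ℂ E] (d : ℕ)
    (F : (Fin m → ℂ) → E) : Prop where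
  contDiff : ContDiff ℂ ∞ F
  homog : ∀ (c : ℂ) z, F (c • z) = c ^ d • F z

/-- Harmonic functions: `∑ ∂_i² F = 0`. -/
def IsHarm {E : Type*} [NormedAddCommGroup E] [NormedSpace ℂ E]
    (F : (Fin m → ℂ) → E) : Prop :=
  ∀ z, ∑ i, dirD (Pi.single i 1) (dirD (Pi.single i 1) F) z = 0

section General

variable {E : Type*} [NormedAddCommGroup E] [NormedSpace ℂ E]
  {F F' : (Fin m → ℂ) → E} {d : ℕ} {v w : Fin m → ℂ}

theorem contDiff_dirD (h : ContDiff ℂ ∞ F) (v : Fin m → ℂ) : ContDiff ℂ ∞ (dirD v F) :=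
  (h.fderiv_right (m := ∞) (by simp)).clm_apply contDiff_const

theorem dirD_comm (h : ContDiff ℂ ∞ F) (v w : Fin m → ℂ) :
    dirD v (dirD w F) = dirD w (dirD v F) := by
  have hd : Differentiable ℂ (fderiv ℂ F) :=
    (h.fderiv_right (m := ∞) (by simp)).differentiable (by simp)
  have key : ∀ v w z, dirD v (dirD w F) z = fderiv ℂ (fderiv ℂ F) z v w := by
    intro v w z
    change fderiv ℂ (fun y => fderiv ℂ F y w) z v = _
    rw [fderiv_clm_apply (hd z) (differentiableAt_const _)]
    simp
  funext z
  rw [key, key]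
  exact (h.contDiffAt.isSymmSndFDerivAt (by simpa using WithTop.coe_le_coe.mpr (le_top (a := (2 : ℕ∞))))).eq v w

theorem dirD_add (h : ContDiff ℂ ∞ F) (h' : ContDiff ℂ ∞ F') (v : Fin m → ℂ) :
    dirD v (fun z => F z + F' z) = fun z => dirD v F z + dirD v F' z := by
  funext z
  simp only [dirD]
  rw [fderiv_fun_add (h.differentiable (by simp) z) (h'.differentiable (by simp) z)]
  rfl

theorem dirD_const_smul (h : ContDiff ℂ ∞ F) (c : ℂ) (v : Fin m → ℂ) :
    dirD v (fun z => c • F z) = fun z => c • dirD v F z := by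
  funext z
  simp only [dirD]
  rw [fderiv_fun_const_smul (h.differentiable (by simp) z)]
  rfl

theorem dirD_sum {ι : Type*} (s : Finset ι) {f : ι → (Fin m → ℂ) → E}
    (h : ∀ i, ContDiff ℂ ∞ (f i)) (v : Fin m → ℂ) :
    dirD v (fun z => ∑ i ∈ s, f i z) = fun z => ∑ i ∈ s, dirD v (f i) z := by
  funext z
  simp only [dirD]
  rw [fderiv_fun_sum fun i _ => (h i).differentiable (by simp) z]
  simp

theorem dirD_eq_sum (F : (Fin m → ℂ) → E) (v : Fin m → ℂ) (z : Fin m → ℂ) :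
    dirD v F z = ∑ i, v i • dirD (Pi.single i 1) F z := by
  simp only [dirD]
  conv_lhs => rw [pi_eq_sum_univ' v]
  simp [map_sum, Pi.single, Pi.zero_def]

namespace IsHom

theorem differentiable (h : IsHom d F) : Differentiable ℂ F := h.contDiff.differentiable (by simp)

theorem dirD_succ (h : IsHom (d + 1) F) (v : Fin m → ℂ) : IsHom d (dirD v F) :=
  ⟨contDiff_dirD h.contDiff v, fun c z =>
    fderiv_homogeneous (h.contDiff.of_le (by simp)) h.homog v c z⟩

theorem dirD_zero (h : IsHom 0 F) (v : Fin m → ℂ) : dirD v F = 0 := by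
  funext z; simp [dirD, fderiv_homogeneous_zero h.homog]

protected theorem zero (d : ℕ) : IsHom d (0 : (Fin m → ℂ) → E) :=
  ⟨contDiff_const, fun c z => by simp⟩

/-- For `d = 0` the derivative vanishes, so that the truncated `d - 1` does no harm. -/
protected theorem dirD (h : IsHom d F) (v : Fin m → ℂ) : IsHom (d - 1) (dirD v F) := by
  rcases d with _ | d
  · rw [h.dirD_zero]; exact .zero _
  · exact h.dirD_succ v

theorem euler (h : IsHom d F) (z : Fin m → ℂ) : dirD z F z = (d : ℂ) • F z := by
  have h1 : HasDerivAt (fun c : ℂ => F (c • z)) (fderiv ℂ F ((1 : ℂ) • z) ((1 : ℂ) • z)) 1 :=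
    (h.differentiable _).hasFDerivAt.comp_hasDerivAt (1 : ℂ) ((hasDerivAt_id (1 : ℂ)).smul_const z)
  have h2 : HasDerivAt (fun c : ℂ => F (c • z)) (((d : ℂ) * 1 ^ (d - 1)) • F z) 1 := by
    have : (fun c : ℂ => F (c • z)) = fun c => c ^ d • F z := funext fun c => h.homog c z
    rw [this]
    exact (hasDerivAt_pow d (1 : ℂ)).smul_const (F z)
  have h3 := h1.unique h2
  simpa [dirD] using h3

theorem euler_sum (h : IsHom d F) (z : Fin m → ℂ) :
    ∑ i, z i • dirD (Pi.single i 1) F z = (d : ℂ) • F z := by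
  rw [← dirD_eq_sum, h.euler]

protected theorem add (h : IsHom d F) (h' : IsHom d F') : IsHom d (fun z => F z + F' z) :=
  ⟨h.contDiff.add h'.contDiff, fun c z => by rw [h.homog, h'.homog, smul_add]⟩

protected theorem const_smul (h : IsHom d F) (a : ℂ) : IsHom d (fun z => a • F z) :=
  ⟨contDiff_const.smul h.contDiff, fun c z => by rw [h.homog, smul_comm]⟩

protected theorem sum {ι : Type*} {s : Finset ι} {f : ι → (Fin m → ℂ) → E}
    (h : ∀ i ∈ s, IsHom d (f i)) : IsHom d (fun z => ∑ i ∈ s, f i z) :=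
  ⟨ContDiff.sum fun i hi => (h i hi).contDiff, fun c z => by
    rw [Finset.smul_sum]; exact Finset.sum_congr rfl fun i hi => (h i hi).homog c z⟩

protected theorem smul {f : (Fin m → ℂ) → ℂ} {d' : ℕ} (hf : IsHom d' f) (h : IsHom d F) :
    IsHom (d' + d) (fun z => f z • F z) :=
  ⟨hf.contDiff.smul h.contDiff, fun c z => by
    rw [h.homog, hf.homog, smul_smul, smul_smul, smul_eq_mul, pow_add]; ring_nf⟩

protected theorem pow {f : (Fin m → ℂ) → ℂ} (hf : IsHom d f) (n : ℕ) :
    IsHom (d * n) (fun z => f z ^ n) :=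
  ⟨hf.contDiff.pow n, fun c z => by
    rw [hf.homog, smul_eq_mul, smul_eq_mul, mul_pow, pow_mul]⟩

theorem dotProduct (v : Fin m → ℂ) : IsHom 1 (fun z : Fin m → ℂ => z ⬝ᵥ v) :=
  ⟨by unfold _root_.dotProduct; fun_prop, fun c z => by simp⟩

end IsHom

theorem dirD_dotProduct (v w z : Fin m → ℂ) : dirD v (fun z : Fin m → ℂ => z ⬝ᵥ w) z = v ⬝ᵥ w := by
  let L : (Fin m → ℂ) →L[ℂ] ℂ := LinearMap.toContinuousLinearMap
    { toFun := fun z => z ⬝ᵥ w, map_add' := fun a b => add_dotProduct a b w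
      map_smul' := fun c a => smul_dotProduct c a w }
  have : (fun z : Fin m → ℂ => z ⬝ᵥ w) = L := rfl
  rw [dirD, this, L.fderiv]
  rfl

end General

section Clifford

variable {F G : (Fin m → ℂ) → Cl m} {d d' : ℕ}

theorem contDiff_mul (h : ContDiff ℂ ∞ F) (h' : ContDiff ℂ ∞ G) :
    ContDiff ℂ ∞ (fun z => F z * G z) :=
  ((mulL m).contDiff.comp h).clm_apply h'

theorem contDiff_vec : ContDiff ℂ ∞ (fun z : Fin m → ℂ => vec z) := (vecL m).contDiff

theorem contDiff_vec_pow (i : ℕ) : ContDiff ℂ ∞ (fun z : Fin m → ℂ => vec z ^ i) := by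
  induction i with
  | zero => simpa using contDiff_const
  | succ i ih => simpa [pow_succ] using contDiff_mul ih contDiff_vec

theorem dirD_mul (h : ContDiff ℂ ∞ F) (h' : ContDiff ℂ ∞ G) (v : Fin m → ℂ) :
    dirD v (fun z => F z * G z) = fun z => dirD v F z * G z + F z * dirD v G z := by
  funext z
  have : fderiv ℂ (fun z => F z * G z) z = _ :=
    (mulL m).fderiv_of_bilinear ((h.differentiable (by simp)) z) ((h'.differentiable (by simp)) z)
  simp only [dirD]
  rw [this]
  simp [add_comm]

theorem dirD_vec (v z : Fin m → ℂ) : dirD v (fun z : Fin m → ℂ => vec z) z = vec v := by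
  have : (fun z : Fin m → ℂ => (vec z : Cl m)) = vecL m := rfl
  rw [dirD, this, (vecL m).fderiv]
  rfl

theorem dirD_const_mul (h : ContDiff ℂ ∞ F) (a : Cl m) (v : Fin m → ℂ) :
    dirD v (fun z => a * F z) = fun z => a * dirD v F z := by
  funext z
  rw [dirD_mul contDiff_const h]
  simp [dirD]

protected theorem IsHom.mul (h : IsHom d F) (h' : IsHom d' G) :
    IsHom (d + d') (fun z => F z * G z) :=
  ⟨contDiff_mul h.contDiff h'.contDiff, fun c z => by
    rw [h.homog, h'.homog, smul_mul_smul_comm, pow_add]⟩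

theorem IsHom.mul_const (h : IsHom d F) (a : Cl m) : IsHom d (fun z => F z * a) :=
  ⟨contDiff_mul h.contDiff contDiff_const, fun c z => by rw [h.homog, smul_mul_assoc]⟩

theorem IsHom.vec_pow (i : ℕ) : IsHom i (fun z : Fin m → ℂ => (vec z : Cl m) ^ i) :=
  ⟨contDiff_vec_pow i, fun c z => by rw [map_smul, smul_pow]⟩

theorem IsHom.vec : IsHom 1 (fun z : Fin m → ℂ => (vec z : Cl m)) :=
  ⟨contDiff_vec, fun c z => by rw [map_smul, pow_one]⟩

theorem dirac_eq (f : (Fin m → ℂ) → Cl m) (z : Fin m → ℂ) :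
    dirac f z = ∑ i, e {i} * dirD (Pi.single i 1) f z := rfl

/-- The Dirac operator factorizes the Laplace operator, so that monogenic functions are
harmonic. -/
theorem isHarm_of_dirac_eq_zero (h : ContDiff ℂ ∞ F) (hF : ∀ z, dirac F z = 0) : IsHarm F := by
  intro z
  have h1 : ∀ i, ∑ j, e {j} * dirD (Pi.single i 1) (dirD (Pi.single j 1) F) z = 0 := by
    intro i
    have h0 : (fun z => ∑ j, e {j} * dirD (Pi.single j 1) F z) = fun _ => 0 := funext hF
    have h2 := congrArg (fun f => dirD (Pi.single i 1) f z) h0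
    rw [dirD_sum _ fun j => contDiff_mul contDiff_const (contDiff_dirD h _)] at h2
    simp only [dirD_const_mul (contDiff_dirD h _)] at h2
    rw [h2]
    simp [dirD]
  set T : Fin m → Fin m → Cl m := fun i j => dirD (Pi.single i 1) (dirD (Pi.single j 1) F) z
  have hT : ∀ i j, T i j = T j i := fun i j => congrFun (dirD_comm h _ _) z
  have h2 : ∑ i, ∑ j, (e {i} * e {j} : Cl m) * T i j = 0 := by
    refine Finset.sum_eq_zero fun i _ => ?_
    simp only [mul_assoc]
    rw [← Finset.mul_sum, h1, mul_zero]
  have h3 : ∑ i, ∑ j, (e {j} * e {i} : Cl m) * T i j = 0 := by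
    rw [Finset.sum_comm, ← h2]
    exact Finset.sum_congr rfl fun i _ => Finset.sum_congr rfl fun j _ => by rw [hT]
  have h4 : ∑ i, ∑ j, (e {i} * e {j} + e {j} * e {i} : Cl m) * T i j = 0 := by
    simp only [add_mul, Finset.sum_add_distrib, h2, h3, add_zero]
  have h5 : ∀ i, ∑ j, (e {i} * e {j} + e {j} * e {i} : Cl m) * T i j = (-2 : ℂ) • T i i := by
    intro i
    rw [Finset.sum_eq_single i]
    · rw [e_sq, add_mul, neg_one_mul]; module
    · intro j _ hj; rw [e_anticomm hj.symm, zero_mul]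
    · simp
  simp only [h5, ← Finset.smul_sum] at h4
  exact (smul_eq_zero.mp h4).resolve_left (by norm_num)

/-- Directional derivatives commute with the Laplace operator. -/
theorem IsHarm.dirD {E : Type*} [NormedAddCommGroup E] [NormedSpace ℂ E]
    {F : (Fin m → ℂ) → E} (h : ContDiff ℂ ∞ F) (hF : IsHarm F) (v : Fin m → ℂ) :
    IsHarm (dirD v F) := by
  intro z
  have h1 : ∀ i : Fin m, HuaRadon.dirD (Pi.single i 1) (HuaRadon.dirD (Pi.single i 1)
      (HuaRadon.dirD v F)) = HuaRadon.dirD v (HuaRadon.dirD (Pi.single i 1)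
      (HuaRadon.dirD (Pi.single i 1) F)) := fun i => by
    rw [dirD_comm h _ v, dirD_comm (contDiff_dirD h _) _ v]
  simp only [h1]
  rw [← congrFun (dirD_sum _ (fun i => contDiff_dirD (contDiff_dirD h _) _) v) z]
  rw [funext hF]
  simp [HuaRadon.dirD]

end Clifford

end

section

variable {m : ℕ}

/-! ### Integration by parts and orthogonality on the real sphere -/

/-- The inclusion `ℝ^m → ℂ^m`. -/
def toC (x : EuclideanSpace ℝ (Fin m)) : Fin m → ℂ := fun i => (x i : ℂ)

/-- The inclusion `ℝ^m → ℂ^m` as a continuous linear map. -/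
def toCL (m : ℕ) : EuclideanSpace ℝ (Fin m) →L[ℝ] (Fin m → ℂ) :=
  ContinuousLinearMap.pi fun i => Complex.ofRealCLM ∘L EuclideanSpace.proj i

@[simp] theorem toCL_apply (x : EuclideanSpace ℝ (Fin m)) : toCL m x = toC x := rfl

@[fun_prop]
theorem continuous_toC : Continuous (toC : EuclideanSpace ℝ (Fin m) → Fin m → ℂ) :=
  (toCL m).continuous

theorem star_toC (x : EuclideanSpace ℝ (Fin m)) : star (toC x) = toC x := by
  funext i; simp [toC]

theorem toC_dotProduct_self (x : EuclideanSpace ℝ (Fin m)) :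
    toC x ⬝ᵥ toC x = ((‖x‖ ^ 2 : ℝ) : ℂ) := by
  rw [EuclideanSpace.real_norm_sq_eq]
  simp [toC, dotProduct, sq]

/-- The integral over the unit sphere of a function on `ℂ^m`. -/
def sphI {E : Type*} [NormedAddCommGroup E] [NormedSpace ℂ E] (F : (Fin m → ℂ) → E) : E :=
  ∫ u : UnitSphere m, F (toC u) ∂(volume : Measure (EuclideanSpace ℝ (Fin m))).toSphere

section

variable {E : Type*} [NormedAddCommGroup E] [NormedSpace ℂ E] {F G : (Fin m → ℂ) → E} {d : ℕ}

theorem integrable_sphere {E : Type*} [NormedAddCommGroup E] {F : (Fin m → ℂ) → E}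
    (h : Continuous F) :
    Integrable (fun u : UnitSphere m => F (toC u))
      (volume : Measure (EuclideanSpace ℝ (Fin m))).toSphere := by
  have hc : Continuous fun u : UnitSphere m => F (toC u) := by fun_prop
  exact hc.integrable_of_hasCompactSupport (HasCompactSupport.of_compactSpace _)

theorem sphI_add (hF : Continuous F) (hG : Continuous G) :
    sphI (fun z => F z + G z) = sphI F + sphI G :=
  integral_add (integrable_sphere hF) (integrable_sphere hG)

theorem sphI_const_smul (c : ℂ) (F : (Fin m → ℂ) → E) : sphI (fun z => c • F z) = c • sphI F :=
  integral_smul c _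

theorem sphI_sum {ι : Type*} (s : Finset ι) {f : ι → (Fin m → ℂ) → E}
    (h : ∀ i, Continuous (f i)) : sphI (fun z => ∑ i ∈ s, f i z) = ∑ i ∈ s, sphI (f i) :=
  integral_finsetSum s fun i _ => integrable_sphere (h i)

@[simp] theorem sphI_zero : sphI (fun _ : Fin m → ℂ => (0 : E)) = 0 := integral_zero _ _

theorem sphI_congr (h : ∀ x : EuclideanSpace ℝ (Fin m), ‖x‖ = 1 → F (toC x) = G (toC x)) :
    sphI F = sphI G :=
  integral_congr_ae (Eventually.of_forall fun u => h u (by simp))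

theorem sphI_const_mul {F : (Fin m → ℂ) → Cl m} (hF : Continuous F) (a : Cl m) :
    sphI (fun z => a * F z) = a * sphI F :=
  (mulL m a).integral_comp_comm (integrable_sphere hF)

/-- Integration by parts on the sphere:
`(d + m - 1) ∫ u_i F(u) dS = ∫ ∂_i F(u) dS` if `F` is homogeneous of degree `d`. -/
theorem sphI_coord_smul [CompleteSpace E] (hm : 2 ≤ m) (h : IsHom d F) (i : Fin m) :
    ((d : ℂ) + m - 1) • sphI (fun z => z i • F z) = sphI (dirD (Pi.single i 1) F) := by
  have hfr : Module.finrank ℝ (EuclideanSpace ℝ (Fin m)) = m := by simp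
  have : Nontrivial (EuclideanSpace ℝ (Fin m)) :=
    Module.nontrivial_of_finrank_pos (R := ℝ) (by rw [hfr]; omega)
  have hF1 : ContDiff ℝ 1 fun x : EuclideanSpace ℝ (Fin m) => F (toC x) :=
    ((h.contDiff.restrict_scalars ℝ).of_le (by simp)).comp (toCL m).contDiff
  have key := integral_sphere_inner_smul (E := EuclideanSpace ℝ (Fin m)) (d := d) hF1
    (fun c x => by
      have : toC (c • x) = (c : ℂ) • toC x := by funext i; simp [toC]
      rw [this, h.homog, ← Complex.ofReal_pow, Complex.coe_smul])
    (EuclideanSpace.single i 1) (by rw [hfr]; exact hm)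
  have h1 : ∀ x : EuclideanSpace ℝ (Fin m),
      inner ℝ (EuclideanSpace.single i 1) x • F (toC x) = toC x i • F (toC x) := fun x => by
    rw [EuclideanSpace.inner_single_left]
    simp [toC, Complex.coe_smul]
  have h2 : ∀ x : EuclideanSpace ℝ (Fin m),
      fderiv ℝ (fun x => F (toC x)) x (EuclideanSpace.single i 1) =
        dirD (Pi.single i 1) F (toC x) := fun x => by
    have := ((h.differentiable (toC x)).hasFDerivAt.restrictScalars ℝ).comp x
      (toCL m).hasFDerivAt
    have h3 := this.fderiv
    change fderiv ℝ (fun x => F (toC x)) x = _ at h3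
    rw [h3]
    have : toC (EuclideanSpace.single i (1 : ℝ)) = Pi.single i (1 : ℂ) := by
      funext j; by_cases hj : j = i
      · subst hj; simp [toC]
      · simp [toC, hj]
    simp [dirD, this]
  simp only [h1, h2, hfr] at key
  rw [sphI, sphI, ← key, ← Complex.coe_smul]
  push_cast
  rfl

theorem sphI_dotProduct_smul [CompleteSpace E] (hm : 2 ≤ m) (h : IsHom d F) (v : Fin m → ℂ) :
    ((d : ℂ) + m - 1) • sphI (fun z => (z ⬝ᵥ v) • F z) = sphI (dirD v F) := by
  have h1 : sphI (fun z => (z ⬝ᵥ v) • F z) = ∑ i, v i • sphI (fun z => z i • F z) := by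
    have hc := h.contDiff.continuous
    simp only [← sphI_const_smul]
    rw [← sphI_sum _ fun i => by fun_prop]
    congr 1; funext z
    simp [dotProduct, Finset.sum_smul, smul_smul, mul_comm]
  have h2 : sphI (dirD v F) = ∑ i, v i • sphI (dirD (Pi.single i 1) F) := by
    simp only [← sphI_const_smul]
    rw [← sphI_sum _ (f := fun i z => v i • dirD (Pi.single i 1) F z)
      fun i => ((contDiff_dirD h.contDiff _).continuous).const_smul _]
    congr 1; funext z
    rw [dirD_eq_sum]
  rw [h1, h2, Finset.smul_sum]
  refine Finset.sum_congr rfl fun i _ => ?_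
  rw [smul_comm, sphI_coord_smul hm h]

end

section Orthogonality

variable {P M : (Fin m → ℂ) → Cl m} {n p : ℕ}

/-- By Euler's relation and integration by parts, the mean of a homogeneous polynomial of positive
degree is a multiple of the mean of its Laplacian. -/
theorem sphI_eq_zero_of_isHarm (hm : 2 ≤ m) (hM : IsHom (n + 1) M) (hh : IsHarm M) :
    sphI M = 0 := by
  have hc := fun v => (contDiff_dirD hM.contDiff v).continuous
  have hcc := fun v w => (contDiff_dirD (contDiff_dirD hM.contDiff v) w).continuous
  have h1 : ((n + 1 : ℕ) : ℂ) • sphI M = ∑ i, sphI (fun z => z i • dirD (Pi.single i 1) M z) := by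
    rw [← sphI_const_smul, ← sphI_sum]
    · congr 1; funext z; rw [hM.euler_sum]
    · exact fun i => (continuous_apply i).smul (hc (Pi.single i 1))
  have h2 : ((n : ℂ) + m - 1) • ∑ i, sphI (fun z => z i • dirD (Pi.single i 1) M z) = 0 := by
    rw [Finset.smul_sum]
    simp only [sphI_coord_smul hm (hM.dirD_succ _)]
    rw [← sphI_sum _ fun i => hcc _ _, funext hh]
    simp
  have hne : ((n : ℂ) + m - 1) ≠ 0 := by
    have : ((n + m - 1 : ℕ) : ℂ) ≠ 0 := by exact_mod_cast (by omega : n + m - 1 ≠ 0)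
    rwa [Nat.cast_sub (by omega), Nat.cast_add, Nat.cast_one] at this
  have h3 := (smul_eq_zero.mp h2).resolve_left hne
  rw [h3] at h1
  exact (smul_eq_zero.mp h1).resolve_left (by exact_mod_cast n.succ_ne_zero)

/-- A homogeneous harmonic polynomial is orthogonal on the sphere to all polynomials of lower
degree. -/
theorem sphI_mul_eq_zero (hm : 2 ≤ m) (hP : IsHom p P) (hM : IsHom n M) (hh : IsHarm M)
    (hpn : p < n) : sphI (fun z => P z * M z) = 0 := by
  induction p using Nat.strong_induction_on generalizing n P M with
  | _ p ih =>
  rcases Nat.eq_zero_or_pos p with rfl | hp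
  · have h0 : ∀ z, P z = P 0 := fun z => by simpa using (hP.homog 0 z).symm
    obtain ⟨n, rfl⟩ : ∃ k, n = k + 1 := ⟨n - 1, by omega⟩
    simp only [h0]
    rw [sphI_const_mul hM.contDiff.continuous, sphI_eq_zero_of_isHarm hm hM hh, mul_zero]
  have hc := hM.contDiff.continuous
  have hcP := fun v => (contDiff_dirD hP.contDiff v).continuous
  have h1 : (p : ℂ) • sphI (fun z => P z * M z) =
      ∑ i, sphI (fun z => z i • (dirD (Pi.single i 1) P z * M z)) := by
    rw [← sphI_const_smul, ← sphI_sum]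
    · congr 1; funext z
      rw [← smul_mul_assoc, ← hP.euler_sum, Finset.sum_mul]
      simp only [smul_mul_assoc]
    · intro i
      exact (continuous_apply i).smul ((hcP (Pi.single i 1)).mul hc)
  have h2 : ∀ i : Fin m, (((p - 1 + n : ℕ) : ℂ) + m - 1) •
      sphI (fun z => z i • (dirD (Pi.single i 1) P z * M z)) = 0 := by
    intro i
    have hPi := hP.dirD (Pi.single i 1)
    rw [sphI_coord_smul hm (hPi.mul hM), dirD_mul hPi.contDiff hM.contDiff, sphI_add]
    · rw [ih (p - 1 - 1) (by omega) (hPi.dirD _) hM hh (by omega),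
        ih (p - 1) (by omega) hPi (hM.dirD _) (hh.dirD hM.contDiff _) (by omega), add_zero]
    · exact ((contDiff_mul (hPi.dirD _).contDiff hM.contDiff)).continuous
    · exact ((contDiff_mul hPi.contDiff (hM.dirD _).contDiff)).continuous
  have hne : (((p - 1 + n : ℕ) : ℂ) + m - 1) ≠ 0 := by
    have : ((p - 1 + n + m - 1 : ℕ) : ℂ) ≠ 0 := by
      exact_mod_cast (by omega : p - 1 + n + m - 1 ≠ 0)
    rwa [Nat.cast_sub (by omega), Nat.cast_add, Nat.cast_one] at this
  rw [Finset.sum_eq_zero fun i _ => (smul_eq_zero.mp (h2 i)).resolve_left hne] at h1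
  exact (smul_eq_zero.mp h1).resolve_left (by exact_mod_cast hp.ne')

/-- Moving a linear factor onto the harmonic polynomial as a derivative. -/
theorem sphI_dotProduct_mul (hm : 2 ≤ m) (hP : IsHom n P) (hM : IsHom (n + 1) M)
    (hh : IsHarm M) (v : Fin m → ℂ) :
    (2 * n + m : ℂ) • sphI (fun z => ((z ⬝ᵥ v) • P z) * M z) =
      sphI (fun z => P z * dirD v M z) := by
  have h := sphI_dotProduct_smul hm (hP.mul hM) v
  rw [dirD_mul hP.contDiff hM.contDiff, sphI_add,
    sphI_mul_eq_zero hm (hP.dirD v) hM hh (by omega), zero_add] at h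
  · rw [← h]
    congr 1
    · push_cast; ring
    · simp only [smul_mul_assoc]
  · exact ((contDiff_mul (hP.dirD _).contDiff hM.contDiff)).continuous
  · exact ((contDiff_mul hP.contDiff (hM.dirD _).contDiff)).continuous

/-- A homogeneous monogenic polynomial is orthogonal on the sphere to `x R`, for `R` of lower
degree. -/
theorem sphI_mul_vec_mul (hm : 2 ≤ m) (hP : IsHom p P) (hM : IsHom n M)
    (hmon : ∀ z, dirac M z = 0) (hpn : p ≤ n) : sphI (fun z => P z * vec z * M z) = 0 := by
  have h1 : sphI (fun z => P z * vec z * M z) =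
      ∑ i, sphI (fun z => z i • (P z * e {i} * M z)) := by
    rw [← sphI_sum]
    · congr 1; funext z
      rw [vec_apply, Finset.mul_sum, Finset.sum_mul]
      simp only [mul_smul_comm, smul_mul_assoc]
    · intro i
      exact (continuous_apply i).smul
        (contDiff_mul (hP.mul_const (e {i})).contDiff hM.contDiff).continuous
  have h2 : (((p + n : ℕ) : ℂ) + m - 1) •
      ∑ i, sphI (fun z => z i • (P z * e {i} * M z)) =
      ∑ i, sphI (fun z => P z * e {i} * dirD (Pi.single i 1) M z) := by
    rw [Finset.smul_sum]
    refine Finset.sum_congr rfl fun i _ => ?_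
    have hPi := hP.mul_const (e {i})
    rw [sphI_coord_smul hm (hPi.mul hM), dirD_mul hPi.contDiff hM.contDiff, sphI_add]
    · rcases Nat.eq_zero_or_pos p with rfl | hp
      · rw [hPi.dirD_zero]; simp
      · rw [sphI_mul_eq_zero hm (hPi.dirD _) hM (isHarm_of_dirac_eq_zero hM.contDiff hmon)
          (by omega), zero_add]
    · exact ((contDiff_mul (hPi.dirD _).contDiff hM.contDiff)).continuous
    · exact ((contDiff_mul hPi.contDiff (hM.dirD _).contDiff)).continuous
  rw [← sphI_sum _ fun i => (contDiff_mul (hP.mul_const (e {i})).contDiff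
    (hM.dirD (Pi.single i 1)).contDiff).continuous] at h2
  have h3 : (fun z => ∑ i, P z * e {i} * dirD (Pi.single i 1) M z) = fun _ => 0 := by
    funext z
    simp only [mul_assoc]
    rw [← Finset.mul_sum, ← dirac_eq, hmon, mul_zero]
  rw [h3, sphI_zero] at h2
  have hne : (((p + n : ℕ) : ℂ) + m - 1) ≠ 0 := by
    have : ((p + n + m - 1 : ℕ) : ℂ) ≠ 0 := by exact_mod_cast (by omega : p + n + m - 1 ≠ 0)
    rwa [Nat.cast_sub (by omega), Nat.cast_add, Nat.cast_one] at this
  rw [h1]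
  exact (smul_eq_zero.mp h2).resolve_left hne

end Orthogonality

end

section

/-! ### Homogeneous polynomials and uniqueness of the Fischer decomposition -/

variable {m : ℕ}

section Poly

variable {F G : (Fin m → ℂ) → Cl m} {d n p : ℕ}

theorem contDiff_of_coord (h : ∀ A, ContDiff ℂ ∞ fun z => (F z).coord A) : ContDiff ℂ ∞ F := by
  have : F = fun z => ∑ A, (F z).coord A • (e A : Cl m) := funext fun z => eq_sum (F z)
  rw [this]
  exact ContDiff.sum fun A _ => (h A).smul contDiff_const

theorem contDiff_eval (p : MvPolynomial (Fin m) ℂ) :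
    ContDiff ℂ ∞ fun z : Fin m → ℂ => MvPolynomial.eval z p := by
  induction p using MvPolynomial.induction_on with
  | C a => simpa using contDiff_const
  | add p q hp hq => simpa using hp.add hq
  | mul_X p i hp => simpa using hp.mul (contDiff_apply ℂ ℂ i)

theorem IsHomogeneousPoly.isHom (h : IsHomogeneousPoly d F) : IsHom d F := by
  refine ⟨contDiff_of_coord fun A => ?_, fun c z => ?_⟩
  · obtain ⟨p, -, hp⟩ := h A
    simp only [hp]
    exact contDiff_eval p
  · ext A
    obtain ⟨p, hd, hp⟩ := h A
    rw [coord_smul, hp, hp]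
    rw [MvPolynomial.eval_eq', MvPolynomial.eval_eq', Finset.mul_sum]
    refine Finset.sum_congr rfl fun s hs => ?_
    have hs' : ∑ i, s i = d := by
      rw [← Finsupp.degree_eq_sum]
      by_contra hne
      exact MvPolynomial.mem_support_iff.mp hs (hd.coeff_eq_zero hne)
    simp only [Pi.smul_apply, smul_eq_mul, mul_pow, Finset.prod_mul_distrib,
      Finset.prod_pow_eq_pow_sum, hs']
    ring

/-- An entire homogeneous function is a homogeneous polynomial, by Euler's relation. -/
theorem IsHom.isHomogeneousPoly (h : IsHom d F) : IsHomogeneousPoly d F := by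
  induction d generalizing F with
  | zero =>
    intro A
    refine ⟨MvPolynomial.C ((F 0).coord A), MvPolynomial.isHomogeneous_C _ _, fun z => ?_⟩
    have : F z = F 0 := by simpa using (h.homog 0 z).symm
    rw [this, MvPolynomial.eval_C]
  | succ d ih =>
    intro A
    choose p hp hpz using fun i => ih (h.dirD_succ (Pi.single i 1)) A
    refine ⟨MvPolynomial.C ((d + 1 : ℂ)⁻¹) * ∑ i, MvPolynomial.X i * p i, ?_, fun z => ?_⟩
    · have := (MvPolynomial.isHomogeneous_C (Fin m) ((d + 1 : ℂ)⁻¹)).mul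
        (MvPolynomial.IsHomogeneous.sum Finset.univ (fun i => MvPolynomial.X i * p i) (1 + d)
          fun i _ => (MvPolynomial.isHomogeneous_X ℂ i).mul (hp i))
      rwa [zero_add, add_comm 1 d] at this
    · have h1 := congrArg (fun a => coordLM A a) (h.euler_sum z)
      simp only [map_sum, map_smul] at h1
      have hne : (d + 1 : ℂ) ≠ 0 := by exact_mod_cast d.succ_ne_zero
      rw [MvPolynomial.eval_mul, MvPolynomial.eval_C, map_sum, eq_inv_mul_iff_mul_eq₀ hne]
      simp only [map_mul, MvPolynomial.eval_X, ← hpz]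
      have h2 : ((d + 1 : ℕ) : ℂ) = d + 1 := by push_cast; rfl
      rw [h2] at h1
      exact h1.symm

/-- The holomorphic function `z ↦ F(conj z)†`, which agrees with `F†` on `ℝ^m`. -/
def sharp (F : (Fin m → ℂ) → Cl m) (z : Fin m → ℂ) : Cl m := dagger (F (star z))

theorem sharp_toC (F : (Fin m → ℂ) → Cl m) (x : EuclideanSpace ℝ (Fin m)) :
    sharp F (toC x) = dagger (F (toC x)) := by rw [sharp, star_toC]

theorem IsHom.sharp (h : IsHom d F) : IsHom d (sharp F) := by
  refine IsHomogeneousPoly.isHom fun A => ?_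
  obtain ⟨p, hp, hpz⟩ := h.isHomogeneousPoly A
  refine ⟨MvPolynomial.C (sgn A A) * MvPolynomial.map (starRingEnd ℂ) p, ?_, fun z => ?_⟩
  · simpa using (MvPolynomial.isHomogeneous_C (Fin m) (sgn A A)).mul (hp.map (starRingEnd ℂ))
  · rw [HuaRadon.sharp, coord_dagger, hpz, MvPolynomial.eval_mul, MvPolynomial.eval_C,
      MvPolynomial.eval_map]
    congr 1
    rw [MvPolynomial.eval, MvPolynomial.coe_eval₂Hom, MvPolynomial.eval₂_comp_left]
    congr 1
    funext i
    simp

theorem IsHom.eq_zero_of_real {F : (Fin m → ℂ) → Cl m} (h : IsHom d F)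
    (h0 : ∀ x, F (toC x) = 0) : F = 0 := by
  induction d generalizing F with
  | zero =>
    funext z
    have h1 : F z = F 0 := by simpa using (h.homog 0 z).symm
    have h2 : toC (0 : EuclideanSpace ℝ (Fin m)) = 0 := by funext i; simp [toC]
    rw [h1, ← h2, h0]; rfl
  | succ d ih =>
    have h1 : ∀ i, dirD (Pi.single i 1) F = 0 := by
      intro i
      refine ih (h.dirD_succ _) fun x => ?_
      have hd := ((h.differentiable (toC x)).hasFDerivAt.restrictScalars ℝ).comp x
        (toCL m).hasFDerivAt
      have hz : F ∘ (toC : EuclideanSpace ℝ (Fin m) → Fin m → ℂ) = fun _ => 0 := funext h0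
      change HasFDerivAt (F ∘ toC) _ x at hd
      rw [hz] at hd
      have h3 := hd.unique (hasFDerivAt_const (𝕜 := ℝ) (0 : Cl m) x)
      have h4 := congrArg (fun L => L (EuclideanSpace.single i (1 : ℝ))) h3
      have : toC (EuclideanSpace.single i (1 : ℝ)) = Pi.single i (1 : ℂ) := by
        funext j; by_cases hj : j = i
        · subst hj; simp [toC]
        · simp [toC, hj]
      simpa [dirD, this] using h4
    funext z
    have h2 := h.euler_sum z
    simp only [h1, Pi.zero_apply, smul_zero, Finset.sum_const_zero] at h2
    exact (smul_eq_zero.mp h2.symm).resolve_left (by exact_mod_cast d.succ_ne_zero)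

theorem coord_sphI (hF : Continuous F) (A : Finset (Fin m)) :
    (sphI F).coord A = sphI fun z => (F z).coord A :=
  ((coordL A).integral_comp_comm (integrable_sphere hF)).symm

/-- The scalar part of `∫ F† F` over the sphere is the square of the `L²` norm. -/
theorem sphI_sharp_mul_self (hF : Continuous F) :
    ((sphI fun z => dagger (F z) * F z).coord ∅) =
      ((∫ u : UnitSphere m, ‖F (toC u)‖ ^ 2
        ∂(volume : Measure (EuclideanSpace ℝ (Fin m))).toSphere : ℝ) : ℂ) := by
  rw [coord_sphI (by fun_prop), ← integral_complex_ofReal]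
  simp only [sphI, coord_dagger_mul, inner_self_eq_norm_sq_to_K]
  norm_cast

theorem IsHom.eq_zero_of_sphI (hm : 1 ≤ m) (h : IsHom d F)
    (h0 : sphI (fun z => dagger (F z) * F z) = 0) : F = 0 := by
  have hc := h.contDiff.continuous
  have h1 := sphI_sharp_mul_self hc
  rw [h0, coord_zero] at h1
  have h2 : ∫ u : UnitSphere m, ‖F (toC u)‖ ^ 2
      ∂(volume : Measure (EuclideanSpace ℝ (Fin m))).toSphere = 0 := by exact_mod_cast h1.symm
  have hcs : Continuous fun u : UnitSphere m => ‖F (toC u)‖ ^ 2 := by fun_prop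
  rw [integral_eq_zero_iff_of_nonneg (fun u => by positivity)
    (hcs.integrable_of_hasCompactSupport (HasCompactSupport.of_compactSpace _)),
    hcs.ae_eq_iff_eq _ continuous_zero] at h2
  have h3 : ∀ x : EuclideanSpace ℝ (Fin m), ‖x‖ = 1 → F (toC x) = 0 := fun x hx => by
    simpa using congrFun h2 ⟨x, by simpa using hx⟩
  have hsc : ∀ (c : ℝ) x, F (toC (c • x)) = (c : ℂ) ^ d • F (toC x) := fun c x => by
    have : toC (c • x) = (c : ℂ) • toC x := by funext i; simp [toC]
    rw [this, h.homog]
  refine h.eq_zero_of_real fun x => ?_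
  rcases eq_or_ne x 0 with rfl | hx
  · have h4 := hsc 0 (EuclideanSpace.single ⟨0, hm⟩ 1)
    rwa [zero_smul, h3 (EuclideanSpace.single ⟨0, hm⟩ 1) (by simp), smul_zero] at h4
  · have h4 := hsc ‖x‖ (‖x‖⁻¹ • x)
    rw [smul_inv_smul₀ (norm_ne_zero_iff.mpr hx), h3 (‖x‖⁻¹ • x) (by
      rw [norm_smul, norm_inv, norm_norm, inv_mul_cancel₀ (norm_ne_zero_iff.mpr hx)]),
      smul_zero] at h4
    exact h4

/-- `F` is orthogonal on the sphere to all homogeneous monogenic polynomials of degree `n`. -/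
def PerpMono (n : ℕ) (F : (Fin m → ℂ) → Cl m) : Prop :=
  ∀ M : (Fin m → ℂ) → Cl m, IsHom n M → (∀ z, dirac M z = 0) →
    sphI (fun z => dagger (F z) * M z) = 0

/-- For polynomials of degree at most `n`, multiplication by `z` produces functions orthogonal to
the monogenic polynomials of degree `n`. -/
theorem PerpMono.vec_mul (hm : 2 ≤ m) (hF : IsHom p F) (hp : p ≤ n) :
    PerpMono n fun z => vec z * F z := by
  intro M hM hmon
  have h := sphI_mul_vec_mul hm hF.sharp hM hmon hp
  have h2 : sphI (fun z => (-1 : ℂ) • (sharp F z * vec z * M z)) = 0 := by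
    rw [sphI_const_smul, h, smul_zero]
  rw [← h2]
  refine sphI_congr fun x _ => ?_
  have hv : (vec (-toC x) : Cl m) = (-1 : ℂ) • vec (toC x) := by
    rw [neg_one_smul]; exact map_neg vec (toC x)
  rw [sharp_toC, dagger_mul, dagger_vec, star_toC, hv, mul_smul_comm, smul_mul_assoc]

theorem PerpMono.add (hF : PerpMono n F) (hG : PerpMono n G) (hFc : Continuous F)
    (hGc : Continuous G) : PerpMono n fun z => F z + G z := by
  intro M hM hmon
  have hc := hM.contDiff.continuous
  simp only [dagger_add, add_mul]
  rw [sphI_add (by fun_prop) (by fun_prop), hF M hM hmon, hG M hM hmon, add_zero]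

theorem PerpMono.const_smul (hF : PerpMono n F) (c : ℂ) : PerpMono n fun z => c • F z := by
  intro M hM hmon
  simp only [dagger_smul, smul_mul_assoc]
  rw [sphI_const_smul, hF M hM hmon, smul_zero]

theorem PerpMono.zero : PerpMono n (fun _ : Fin m → ℂ => (0 : Cl m)) := by
  intro M _ _; simp

theorem PerpMono.sum {ι : Type*} {s : Finset ι} {f : ι → (Fin m → ℂ) → Cl m}
    (h : ∀ i ∈ s, PerpMono n (f i)) (hc : ∀ i ∈ s, Continuous (f i)) :
    PerpMono n fun z => ∑ i ∈ s, f i z := by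
  classical
  induction s using Finset.induction_on with
  | empty => simpa using PerpMono.zero
  | insert i s hi ih =>
    simp only [Finset.sum_insert hi]
    exact (h i (by simp)).add (ih (fun j hj => h j (by simp [hj])) fun j hj => hc j (by simp [hj]))
      (hc i (by simp)) (continuous_finsetSum _ fun j hj => hc j (by simp [hj]))

theorem PerpMono.eq_zero (hm : 1 ≤ m) (h : PerpMono n F) (hF : IsHom n F)
    (hmon : ∀ z, dirac F z = 0) : F = 0 :=
  hF.eq_zero_of_sphI hm (h F hF hmon)

theorem dirac_sub (hF : ContDiff ℂ ∞ F) (hG : ContDiff ℂ ∞ G) (z : Fin m → ℂ) :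
    dirac (fun z => F z - G z) z = dirac F z - dirac G z := by
  simp only [dirac_eq, dirD]
  rw [fderiv_fun_sub (hF.differentiable (by simp) z) (hG.differentiable (by simp) z)]
  simp [mul_sub, Finset.sum_sub_distrib]

theorem dirac_add (hF : ContDiff ℂ ∞ F) (hG : ContDiff ℂ ∞ G) (z : Fin m → ℂ) :
    dirac (fun z => F z + G z) z = dirac F z + dirac G z := by
  simp only [dirac_eq, dirD_add hF hG, mul_add, Finset.sum_add_distrib]

theorem dirac_const_smul (hF : ContDiff ℂ ∞ F) (c : ℂ) (z : Fin m → ℂ) :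
    dirac (fun z => c • F z) z = c • dirac F z := by
  simp only [dirac_eq, dirD_const_smul hF, mul_smul_comm, Finset.smul_sum]

theorem dirac_sum {ι : Type*} (s : Finset ι) {f : ι → (Fin m → ℂ) → Cl m}
    (h : ∀ i, ContDiff ℂ ∞ (f i)) (z : Fin m → ℂ) :
    dirac (fun z => ∑ i ∈ s, f i z) z = ∑ i ∈ s, dirac (f i) z := by
  simp only [dirac_eq, dirD_sum s h, Finset.mul_sum]
  exact Finset.sum_comm

/-- A monogenic polynomial is determined by its class modulo the functions orthogonal to the
monogenic polynomials of the same degree. -/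
theorem monogenic_eq_of_perp (hm : 1 ≤ m) (hF : IsHom n F) (hG : IsHom n G)
    (hmF : ∀ z, dirac F z = 0) (hmG : ∀ z, dirac G z = 0)
    (h : PerpMono n fun z => F z - G z) : F = G := by
  have hs : IsHom n fun z => F z - G z := by
    have := hF.add (hG.const_smul (-1))
    simpa [sub_eq_add_neg] using this
  have h1 := h.eq_zero hm hs fun z => by
    rw [dirac_sub hF.contDiff hG.contDiff, hmF, hmG, sub_zero]
  funext z
  exact sub_eq_zero.mp (congrFun h1 z)

/-- All components but the top one have a factor `z`, and are orthogonal to the monogenic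
polynomials. -/
theorem IsFischerDecomposition.perp (hm : 2 ≤ m) {M : ℕ → (Fin m → ℂ) → Cl m}
    (h : IsFischerDecomposition n F M) : PerpMono n fun z => F z - M n z := by
  have h1 : (fun z => F z - M n z) =
      fun z => ∑ i ∈ Finset.range n, vec z * (vec z ^ i * M (n - (i + 1)) z) := by
    funext z
    rw [h.2 z, Finset.sum_range_succ']
    simp [pow_succ', mul_assoc]
  have hh : ∀ i ∈ Finset.range n,
      IsHom (n - 1) fun z => (vec z : Cl m) ^ i * M (n - (i + 1)) z := by
    intro i hi
    have hi' := Finset.mem_range.mp hi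
    have := (IsHom.vec_pow i).mul (h.1 (n - (i + 1)) (by omega)).1.isHom
    rwa [show i + (n - (i + 1)) = n - 1 by omega] at this
  rw [h1]
  exact PerpMono.sum (fun i hi => PerpMono.vec_mul hm (hh i hi) (by omega)) fun i hi =>
    contDiff_vec.continuous.mul (hh i hi).contDiff.continuous

/-- The top component of a Fischer decomposition is unique. -/
theorem monogenicProj_eq (hm : 2 ≤ m) {M : ℕ → (Fin m → ℂ) → Cl m} (hF : Continuous F)
    (h : IsFischerDecomposition n F M) : monogenicProj n F = M n := by
  have hex : ∃ M, IsFischerDecomposition n F M := ⟨M, h⟩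
  rw [monogenicProj, dif_pos hex]
  have h' := hex.choose_spec
  set M' := hex.choose
  have hn := h.1 n le_rfl
  have hn' := h'.1 n le_rfl
  refine monogenic_eq_of_perp (by omega) hn'.1.isHom hn.1.isHom hn'.2.2 hn.2.2 ?_
  have hc := hn.1.isHom.contDiff.continuous
  have hc' := hn'.1.isHom.contDiff.continuous
  have := (h.perp hm).add ((h'.perp hm).const_smul (-1)) (by fun_prop) (by fun_prop)
  convert! this using 2
  module

end Poly

end

section

/-! ### The monogenic projections of the functions `ψ_{τ,α,k}` -/

variable {m : ℕ}

theorem dirD_pow_mul_pow (x y v : Fin m → ℂ) (p q : ℕ) (c : Cl m) (z : Fin m → ℂ) :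
    dirD v (fun z : Fin m → ℂ => ((z ⬝ᵥ x) ^ p * (z ⬝ᵥ y) ^ q) • c) z =
      (p * (z ⬝ᵥ x) ^ (p - 1) * (z ⬝ᵥ y) ^ q * (v ⬝ᵥ x) +
        q * (z ⬝ᵥ x) ^ p * (z ⬝ᵥ y) ^ (q - 1) * (v ⬝ᵥ y)) • c := by
  have hL : ∀ w : Fin m → ℂ, HasFDerivAt (fun z : Fin m → ℂ => z ⬝ᵥ w)
      (fderiv ℂ (fun z : Fin m → ℂ => z ⬝ᵥ w) z) z := fun w =>
    ((IsHom.dotProduct w).differentiable z).hasFDerivAt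
  have hv : ∀ w : Fin m → ℂ, fderiv ℂ (fun z : Fin m → ℂ => z ⬝ᵥ w) z v = v ⬝ᵥ w := fun w =>
    dirD_dotProduct v w z
  have h := (((hL x).pow p).mul ((hL y).pow q)).smul_const c
  rw [dirD]
  have h2 := h.fderiv
  change fderiv ℂ (fun z : Fin m → ℂ => ((z ⬝ᵥ x) ^ p * (z ⬝ᵥ y) ^ q) • c) z = _ at h2
  rw [h2]
  simp [hv]
  congr 1
  ring

theorem isHom_pow_mul_pow (x y : Fin m → ℂ) (p q : ℕ) (c : Cl m) :
    IsHom (p + q) (fun z : Fin m → ℂ => ((z ⬝ᵥ x) ^ p * (z ⬝ᵥ y) ^ q) • c) := by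
  have h := ((IsHom.dotProduct x).pow p).smul (((IsHom.dotProduct y).pow q).smul
    (⟨contDiff_const, fun _ _ => by simp⟩ : IsHom 0 fun _ : Fin m → ℂ => c))
  simpa [smul_smul] using h

theorem dirac_pow_mul_pow (x y : Fin m → ℂ) (p q : ℕ) (c : Cl m) (z : Fin m → ℂ) :
    dirac (fun z : Fin m → ℂ => ((z ⬝ᵥ x) ^ p * (z ⬝ᵥ y) ^ q) • c) z =
      (p * (z ⬝ᵥ x) ^ (p - 1) * (z ⬝ᵥ y) ^ q) • (vec x * c) +
        (q * (z ⬝ᵥ x) ^ p * (z ⬝ᵥ y) ^ (q - 1)) • (vec y * c) := by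
  rw [dirac_eq]
  simp only [dirD_pow_mul_pow, single_one_dotProduct, add_smul, mul_add, mul_smul_comm,
    Finset.sum_add_distrib]
  rw [vec_apply, vec_apply, Finset.sum_mul, Finset.sum_mul, Finset.smul_sum, Finset.smul_sum]
  simp only [smul_mul_assoc, smul_smul]

theorem psi_even (τ : Fin m → ℂ) (s k : ℕ) : psi τ (2 * s) k =
    fun z => ((z ⬝ᵥ τ) ^ (s + k) * (z ⬝ᵥ (-star τ)) ^ s) • vec τ := by
  funext z; simp [psi]

theorem psi_odd (τ : Fin m → ℂ) (s k : ℕ) : psi τ (2 * s + 1) k =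
    fun z => ((z ⬝ᵥ τ) ^ (s + k + 1) * (z ⬝ᵥ (-star τ)) ^ s) • (dagger (vec τ) * vec τ) := by
  funext z
  have h2 : (2 * s + 1) / 2 = s := by omega
  simp [psi, h2]

theorem isHom_psi (τ : Fin m → ℂ) (α k : ℕ) : IsHom (α + k) (psi τ α k) := by
  obtain ⟨s, rfl | rfl⟩ := Nat.even_or_odd' α
  · rw [psi_even, show 2 * s + k = s + k + s by ring]
    exact isHom_pow_mul_pow _ _ _ _ _
  · rw [psi_odd, show 2 * s + 1 + k = s + k + 1 + s by ring]
    exact isHom_pow_mul_pow _ _ _ _ _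

section Isotropic

/-- The isotropic vectors `τ = t + i s`, normalized by `⟨τ, conj τ⟩ = 2`. -/
structure IsIso (τ : Fin m → ℂ) : Prop where
  self : τ ⬝ᵥ τ = 0
  conj : τ ⬝ᵥ star τ = 2

variable {τ : Fin m → ℂ}

theorem IsIso.conj_self (hτ : IsIso τ) : star τ ⬝ᵥ τ = 2 := by
  rw [dotProduct_comm, hτ.conj]

theorem IsIso.vec_sq (hτ : IsIso τ) : (vec τ : Cl m) * vec τ = 0 := by
  rw [vec_mul_self, hτ.self]; simp

theorem IsIso.dagger_sq (hτ : IsIso τ) : dagger (vec τ : Cl m) * dagger (vec τ) = 0 := by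
  rw [← dagger_mul, hτ.vec_sq, dagger_zero]

theorem IsIso.vec_mul_dagger (hτ : IsIso τ) :
    (vec τ : Cl m) * dagger (vec τ) = (4 : ℂ) • 1 - dagger (vec τ) * vec τ := by
  rw [dagger_vec, vec_mul_comm]
  congr 2
  rw [dotProduct_neg, hτ.conj]; norm_num

theorem IsIso.vec_mul_dagger_mul_vec (hτ : IsIso τ) :
    (vec τ : Cl m) * (dagger (vec τ) * vec τ) = (4 : ℂ) • vec τ := by
  rw [← mul_assoc, hτ.vec_mul_dagger, sub_mul, mul_assoc, hτ.vec_sq]; simp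

/-- The factor in `∂ψ_{τ,α,k} = μ ψ_{τ,α-1,k}`. -/
def mu (α k : ℕ) : ℂ := if Even α then (α / 2 : ℕ) else 4 * ((α / 2 : ℕ) + k + 1)

@[simp] theorem mu_zero (k : ℕ) : mu 0 k = 0 := by simp [mu]

theorem dirac_psi (hτ : IsIso τ) (α k : ℕ) (z : Fin m → ℂ) :
    dirac (psi τ α k) z = mu α k • psi τ (α - 1) k z := by
  obtain ⟨s, rfl | rfl⟩ := Nat.even_or_odd' α
  · rw [psi_even, dirac_pow_mul_pow, hτ.vec_sq, smul_zero, zero_add]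
    rcases s with _ | s
    · simp
    · rw [show 2 * (s + 1) - 1 = 2 * s + 1 by omega, psi_odd, dagger_vec, smul_smul]
      have h2 : 2 * (s + 1) / 2 = s + 1 := by omega
      simp only [mu, even_two_mul, if_true, h2]
      congr 1
      rw [Nat.add_sub_cancel, show s + 1 + k = s + k + 1 by ring]
      ring
  · rw [psi_odd, dirac_pow_mul_pow, hτ.vec_mul_dagger_mul_vec, ← dagger_vec, ← mul_assoc,
      hτ.dagger_sq, zero_mul, smul_zero, add_zero, show 2 * s + 1 - 1 = 2 * s by omega, psi_even,
      smul_smul, smul_smul]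
    have h2 : (2 * s + 1) / 2 = s := by omega
    have h3 : ¬ Even (2 * s + 1) := by simp
    simp only [mu, h3, if_false, h2]
    congr 1
    rw [Nat.add_sub_cancel]
    push_cast
    ring

/-- The factor in `∂(z^i f) = -κ z^{i-1} f + (-1)^i z^i ∂f`, for `f` of degree `d`. -/
def kap (m i d : ℕ) : ℂ := if Even i then i else i - 1 + m + 2 * d

theorem kap_succ (m i d : ℕ) : kap m (i + 1) d = m + 2 * (i + d) - kap m i d := by
  rcases Nat.even_or_odd i with h | h
  · have h1 : ¬ Even (i + 1) := by simpa [Nat.even_add_one] using h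
    simp only [kap, h, h1, if_true, if_false]; push_cast; ring
  · have h0 : ¬ Even i := Nat.not_even_iff_odd.mpr h
    have h1 : Even (i + 1) := by simpa [Nat.even_add_one] using h
    simp only [kap, h0, h1, if_true, if_false]; push_cast; ring

theorem kap_succ_ne_zero (hm : 1 ≤ m) (i d : ℕ) : kap m (i + 1) d ≠ 0 := by
  unfold kap
  split_ifs
  · exact_mod_cast i.succ_ne_zero
  · push_cast
    have : ((i + m + 2 * d : ℕ) : ℂ) ≠ 0 := by exact_mod_cast (by omega)
    convert! this using 1
    push_cast; ring

theorem dirac_vec_mul {F : (Fin m → ℂ) → Cl m} {d : ℕ} (hF : IsHom d F) (z : Fin m → ℂ) :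
    dirac (fun z => vec z * F z) z = -((m + 2 * d : ℂ) • F z) - vec z * dirac F z := by
  have h1 : ∀ i : Fin m, (e {i} : Cl m) * vec z = (-2 * z i) • 1 - vec z * e {i} := by
    intro i
    rw [← vec_single i, vec_mul_comm, single_one_dotProduct]
  have h2 : ∀ i : Fin m, (e {i} : Cl m) * dirD (Pi.single i 1) (fun z => vec z * F z) z =
      -F z + (-2 : ℂ) • (z i • dirD (Pi.single i 1) F z) -
        vec z * (e {i} * dirD (Pi.single i 1) F z) := by
    intro i
    rw [dirD_mul contDiff_vec hF.contDiff]
    simp only [dirD_vec]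
    rw [vec_single, mul_add, ← mul_assoc, e_sq, ← mul_assoc, h1, sub_mul, smul_mul_assoc,
      one_mul, neg_one_mul, mul_smul, mul_assoc]
    abel
  rw [dirac_eq, dirac_eq, Finset.sum_congr rfl fun i _ => h2 i, Finset.sum_sub_distrib,
    Finset.sum_add_distrib, ← Finset.smul_sum, hF.euler_sum, Finset.mul_sum, Finset.sum_const,
    Finset.card_univ, Fintype.card_fin]
  module

theorem dirac_vec_pow_mul {F : (Fin m → ℂ) → Cl m} {d : ℕ} (hF : IsHom d F) (i : ℕ)
    (z : Fin m → ℂ) :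
    dirac (fun z => vec z ^ i * F z) z =
      -(kap m i d • (vec z ^ (i - 1) * F z)) + (-1 : ℂ) ^ i • (vec z ^ i * dirac F z) := by
  induction i with
  | zero => simp [kap]
  | succ i ih =>
    have h1 : (fun z : Fin m → ℂ => vec z ^ (i + 1) * F z) =
        fun z => vec z * (vec z ^ i * F z) := by
      funext z; rw [pow_succ', mul_assoc]
    have h2 : kap m i d • (vec z * (vec z ^ (i - 1) * F z)) = kap m i d • (vec z ^ i * F z) := by
      rcases i with _ | i
      · simp [kap]
      · rw [← mul_assoc, ← pow_succ', Nat.add_sub_cancel]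
    rw [h1, dirac_vec_mul ((IsHom.vec_pow i).mul hF), ih, Nat.add_sub_cancel, kap_succ, mul_add,
      mul_neg, mul_smul_comm, mul_smul_comm, h2, pow_succ' (vec z), mul_assoc, pow_succ (-1 : ℂ)]
    push_cast
    module

/-- The coefficients of `z^i ψ_{τ,α-i,k}` in `M[ψ_{τ,α,k}]`. -/
def fcoef (m α k : ℕ) : ℕ → ℂ
  | 0 => 1
  | i + 1 => (-1) ^ i * fcoef m α k i * mu (α - i) k / kap m (i + 1) (α - (i + 1) + k)

/-- The explicit form `∑ C_i z^i ψ_{τ,α-i,k}` of the monogenic projection of `ψ_{τ,α,k}`. -/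
def monoPsi (τ : Fin m → ℂ) (α k : ℕ) (z : Fin m → ℂ) : Cl m :=
  ∑ i ∈ Finset.range (α + 1), fcoef m α k i • (vec z ^ i * psi τ (α - i) k z)

theorem isHom_vec_pow_mul_psi (τ : Fin m → ℂ) {α i : ℕ} (k : ℕ) (h : i ≤ α) :
    IsHom (α + k) fun z => vec z ^ i * psi τ (α - i) k z := by
  have := (IsHom.vec_pow i).mul (isHom_psi τ (α - i) k)
  rwa [show i + (α - i + k) = α + k by omega] at this

theorem contDiff_vec_pow_mul_psi (τ : Fin m → ℂ) (α k i : ℕ) :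
    ContDiff ℂ ∞ fun z => vec z ^ i * psi τ α k z :=
  contDiff_mul (contDiff_vec_pow i) (isHom_psi τ α k).contDiff

theorem isHom_monoPsi (τ : Fin m → ℂ) (α k : ℕ) : IsHom (α + k) (monoPsi τ α k) :=
  IsHom.sum fun _ hi => (isHom_vec_pow_mul_psi τ k
    (Nat.lt_succ_iff.mp (Finset.mem_range.mp hi))).const_smul _

/-- The coefficients `C_i` are chosen to make this hold: `∂` maps the terms `i` and `i + 1` to
multiples of `z^i ψ_{τ,α-i-1,k}`, and these cancel. -/
theorem dirac_monoPsi (hm : 1 ≤ m) (hτ : IsIso τ) (α k : ℕ) (z : Fin m → ℂ) :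
    dirac (monoPsi τ α k) z = 0 := by
  -- `T i` collects the multiples of `z^{i-1} ψ_{α-i}`; the sum telescopes
  let T : ℕ → Cl m := fun i =>
    (fcoef m α k i * kap m i (α - i + k)) • (vec z ^ (i - 1) * psi τ (α - i) k z)
  have h1 : dirac (monoPsi τ α k) z = ∑ i ∈ Finset.range (α + 1), (T (i + 1) - T i) := by
    have : monoPsi τ α k = fun z => ∑ i ∈ Finset.range (α + 1),
      (fun i z => fcoef m α k i • (vec z ^ i * psi τ (α - i) k z)) i z := rfl
    rw [this, dirac_sum _ (f := fun i z => fcoef m α k i • (vec z ^ i * psi τ (α - i) k z))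
      fun i => (contDiff_vec_pow_mul_psi τ (α - i) k i).const_smul _]
    refine Finset.sum_congr rfl fun i _ => ?_
    rw [dirac_const_smul (contDiff_vec_pow_mul_psi τ (α - i) k i),
      dirac_vec_pow_mul (isHom_psi τ (α - i) k), dirac_psi hτ]
    have h2 : fcoef m α k (i + 1) * kap m (i + 1) (α - (i + 1) + k) =
        (-1) ^ i * fcoef m α k i * mu (α - i) k := by
      rw [fcoef, div_mul_cancel₀ _ (kap_succ_ne_zero hm _ _)]
    simp only [T]
    rw [h2, Nat.add_sub_cancel, show α - i - 1 = α - (i + 1) by omega, mul_smul_comm]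
    module
  rw [h1, Finset.sum_range_sub]
  simp [T, fcoef, kap]

theorem isMonogenic_monoPsi (hm : 1 ≤ m) (hτ : IsIso τ) (α k : ℕ) :
    IsMonogenic (monoPsi τ α k) :=
  ⟨(isHom_monoPsi τ α k).differentiable, dirac_monoPsi hm hτ α k⟩

theorem psi_sub_monoPsi (τ : Fin m → ℂ) (α k : ℕ) (z : Fin m → ℂ) :
    psi τ α k z - monoPsi τ α k z = ∑ i ∈ Finset.range α,
      (-fcoef m α k (i + 1)) • (vec z ^ (i + 1) * psi τ (α - (i + 1)) k z) := by
  rw [monoPsi, Finset.sum_range_succ']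
  simp [fcoef]

theorem perp_psi_sub_monoPsi (hm : 2 ≤ m) (τ : Fin m → ℂ) (α k : ℕ) :
    PerpMono (α + k) fun z => psi τ α k z - monoPsi τ α k z := by
  simp only [psi_sub_monoPsi, pow_succ', mul_assoc]
  refine PerpMono.sum (fun i hi => ?_) fun i _ => ?_
  · have hi' := Finset.mem_range.mp hi
    exact (PerpMono.vec_mul hm ((IsHom.vec_pow i).mul (isHom_psi τ _ k)) (by omega)).const_smul _
  · exact (contDiff_vec.continuous.mul
      (contDiff_vec_pow_mul_psi τ (α - (i + 1)) k i).continuous).const_smul (-fcoef m α k (i + 1))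

end Isotropic

/-! ### Existence of the Fischer decomposition -/

section Existence

variable {P Q : (Fin m → ℂ) → Cl m} {n : ℕ}

/-- `P` has a Fischer decomposition of degree `n`. -/
def HasFischer (n : ℕ) (P : (Fin m → ℂ) → Cl m) : Prop := ∃ M, IsFischerDecomposition n P M

theorem isMonogenic_zero : IsMonogenic (0 : (Fin m → ℂ) → Cl m) :=
  ⟨differentiable_const 0, fun z => by simp [dirac]⟩

theorem HasFischer.of_isMonogenic (h : IsHom n P) (hmon : IsMonogenic P) : HasFischer n P := by
  refine ⟨fun l => if l = n then P else 0, fun i _ => ?_, fun z => ?_⟩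
  · beta_reduce
    split_ifs with hi
    · exact ⟨hi ▸ h.isHomogeneousPoly, hmon⟩
    · exact ⟨(IsHom.zero i).isHomogeneousPoly, isMonogenic_zero⟩
  · rw [Finset.sum_range_succ', Finset.sum_eq_zero]
    · simp
    · intro i hi
      have := Finset.mem_range.mp hi
      simp [show n - (i + 1) ≠ n by omega]

theorem HasFischer.add (hP : HasFischer n P) (hQ : HasFischer n Q) :
    HasFischer n fun z => P z + Q z := by
  obtain ⟨M, hM, hMs⟩ := hP
  obtain ⟨N, hN, hNs⟩ := hQ
  refine ⟨fun l z => M l z + N l z, fun i hi => ⟨?_, ?_, fun z => ?_⟩, fun z => ?_⟩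
  · exact ((hM i hi).1.isHom.add (hN i hi).1.isHom).isHomogeneousPoly
  · exact ((hM i hi).1.isHom.add (hN i hi).1.isHom).differentiable
  · rw [dirac_add (hM i hi).1.isHom.contDiff (hN i hi).1.isHom.contDiff, (hM i hi).2.2,
      (hN i hi).2.2, add_zero]
  · beta_reduce
    rw [hMs, hNs, ← Finset.sum_add_distrib]
    simp only [mul_add]

theorem HasFischer.const_smul (hP : HasFischer n P) (c : ℂ) : HasFischer n fun z => c • P z := by
  obtain ⟨M, hM, hMs⟩ := hP
  refine ⟨fun l z => c • M l z, fun i hi => ⟨?_, ?_, fun z => ?_⟩, fun z => ?_⟩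
  · exact ((hM i hi).1.isHom.const_smul c).isHomogeneousPoly
  · exact ((hM i hi).1.isHom.const_smul c).differentiable
  · rw [dirac_const_smul (hM i hi).1.isHom.contDiff, (hM i hi).2.2, smul_zero]
  · beta_reduce
    rw [hMs, Finset.smul_sum]
    simp only [mul_smul_comm]

theorem HasFischer.sum {ι : Type*} {s : Finset ι} {f : ι → (Fin m → ℂ) → Cl m}
    (h : ∀ i ∈ s, HasFischer n (f i)) : HasFischer n fun z => ∑ i ∈ s, f i z := by
  classical
  induction s using Finset.induction_on with
  | empty =>
    simp only [Finset.sum_empty]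
    exact .of_isMonogenic (IsHom.zero n) isMonogenic_zero
  | insert i s hi ih =>
    simp only [Finset.sum_insert hi]
    exact (h i (by simp)).add (ih fun j hj => h j (by simp [hj]))

theorem HasFischer.vec_mul (hP : HasFischer n P) : HasFischer (n + 1) fun z => vec z * P z := by
  obtain ⟨M, hM, hMs⟩ := hP
  refine ⟨fun l => if l = n + 1 then 0 else M l, fun i hi => ?_, fun z => ?_⟩
  · beta_reduce
    split_ifs with h
    · exact ⟨(IsHom.zero i).isHomogeneousPoly, isMonogenic_zero⟩
    · exact hM i (by omega)
  · beta_reduce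
    rw [Finset.sum_range_succ', hMs, Finset.mul_sum]
    simp only [Nat.sub_zero, if_true, Pi.zero_apply, mul_zero, add_zero]
    refine Finset.sum_congr rfl fun i _ => ?_
    rw [if_neg (by omega), pow_succ', mul_assoc, show n + 1 - (i + 1) = n - i by omega]

theorem HasFischer.vec_pow_mul (hP : HasFischer n P) (i : ℕ) :
    HasFischer (n + i) fun z => vec z ^ i * P z := by
  induction i with
  | zero => simpa using hP
  | succ i ih => simpa only [pow_succ', mul_assoc] using! ih.vec_mul

/-- By induction on `α`, as `ψ_{τ,α,k} - M[ψ_{τ,α,k}]` is a combination of the `z^i ψ_{τ,α-i,k}`,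
`i > 0`. -/
theorem hasFischer_psi (hm : 1 ≤ m) {τ : Fin m → ℂ} (hτ : IsIso τ) (α k : ℕ) :
    HasFischer (α + k) (psi τ α k) := by
  induction α using Nat.strong_induction_on with
  | _ α ih =>
  have h1 : psi τ α k = fun z => (∑ i ∈ Finset.range α,
      (-fcoef m α k (i + 1)) • (vec z ^ (i + 1) * psi τ (α - (i + 1)) k z)) +
        monoPsi τ α k z := by
    funext z; rw [← psi_sub_monoPsi]; abel
  rw [h1]
  refine HasFischer.add (HasFischer.sum fun i hi => ?_)
    (.of_isMonogenic (isHom_monoPsi τ α k) (isMonogenic_monoPsi hm hτ α k))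
  have hi' := Finset.mem_range.mp hi
  have h2 := ((ih (α - (i + 1)) (by omega)).vec_pow_mul (i + 1)).const_smul (-fcoef m α k (i + 1))
  rwa [show α - (i + 1) + k + (i + 1) = α + k by omega] at h2

/-- `M[ψ_{τ,α,k}]` in explicit form. -/
theorem Mpsi_eq (hm : 2 ≤ m) {τ : Fin m → ℂ} (hτ : IsIso τ) (α k : ℕ) :
    Mpsi τ α k = monoPsi τ α k := by
  obtain ⟨M, hM⟩ := hasFischer_psi (by omega) hτ α k
  have hc := (isHom_psi τ α k).contDiff.continuous
  have hc1 := (isHom_monoPsi τ α k).contDiff.continuous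
  have hn := hM.1 (α + k) le_rfl
  have hc2 := hn.1.isHom.contDiff.continuous
  rw [Mpsi, monogenicProj_eq hm hc hM]
  refine monogenic_eq_of_perp (by omega) hn.1.isHom (isHom_monoPsi τ α k) hn.2.2
    (dirac_monoPsi (by omega) hτ α k) ?_
  have := (perp_psi_sub_monoPsi hm τ α k).add ((hM.perp hm).const_smul (-1)) (by fun_prop)
    (by fun_prop)
  convert! this using 2
  module

end Existence

end

section

/-! ### Derivatives of `M[ψ_{τ,α,k}]` in the direction of `τ` -/

variable {m : ℕ} {τ : Fin m → ℂ}

theorem dotProduct_smul_psi (τ : Fin m → ℂ) (α k : ℕ) (z : Fin m → ℂ) :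
    (z ⬝ᵥ τ) • psi τ α k z = psi τ α (k + 1) z := by
  obtain ⟨s, rfl | rfl⟩ := Nat.even_or_odd' α
  · rw [psi_even, psi_even, smul_smul, show s + (k + 1) = s + k + 1 by ring]
    beta_reduce
    congr 1; ring
  · rw [psi_odd, psi_odd, smul_smul, show s + (k + 1) + 1 = s + k + 1 + 1 by ring]
    beta_reduce
    congr 1; ring

theorem vec_mul_psi_succ (hτ : IsIso τ) (α k : ℕ) (z : Fin m → ℂ) :
    vec τ * psi τ (α + 1) k z = (if Even α then 4 else 0 : ℂ) • psi τ α (k + 1) z := by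
  obtain ⟨s, rfl | rfl⟩ := Nat.even_or_odd' α
  · rw [psi_odd, psi_even, mul_smul_comm, hτ.vec_mul_dagger_mul_vec, smul_smul, if_pos (by simp),
      smul_smul, show s + (k + 1) = s + k + 1 by ring]
    congr 1; ring
  · rw [show 2 * s + 1 + 1 = 2 * (s + 1) by ring, psi_even, mul_smul_comm, hτ.vec_sq,
      if_neg (by simp)]
    simp

theorem dirD_neg_psi (hτ : IsIso τ) (α k : ℕ) (z : Fin m → ℂ) :
    dirD (-τ) (psi τ (α + 2) k) z = (2 * ((α + 2) / 2 : ℕ) : ℂ) • psi τ α (k + 1) z := by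
  have h1 : -τ ⬝ᵥ τ = 0 := by rw [neg_dotProduct, hτ.self, neg_zero]
  have h2 : -τ ⬝ᵥ -star τ = 2 := by rw [neg_dotProduct_neg, hτ.conj]
  obtain ⟨s, rfl | rfl⟩ := Nat.even_or_odd' α
  · rw [show 2 * s + 2 = 2 * (s + 1) by ring, psi_even, psi_even, dirD_pow_mul_pow, h1, h2,
      smul_smul, show 2 * (s + 1) / 2 = s + 1 by omega, show s + 1 + k = s + (k + 1) by ring,
      Nat.add_sub_cancel]
    congr 1; ring
  · rw [show 2 * s + 1 + 2 = 2 * (s + 1) + 1 by ring, psi_odd, psi_odd, dirD_pow_mul_pow, h1, h2,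
      smul_smul, show (2 * (s + 1) + 1) / 2 = s + 1 by omega,
      show s + 1 + k + 1 = s + (k + 1) + 1 by ring]
    simp only [Nat.add_sub_cancel]
    congr 1; ring

theorem dirD_neg_psi_of_le_one (hτ : IsIso τ) {α : ℕ} (hα : α ≤ 1) (k : ℕ) (z : Fin m → ℂ) :
    dirD (-τ) (psi τ α k) z = 0 := by
  have h1 : -τ ⬝ᵥ τ = 0 := by rw [neg_dotProduct, hτ.self, neg_zero]
  interval_cases α
  · rw [show 0 = 2 * 0 by rfl, psi_even, dirD_pow_mul_pow, h1]; simp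
  · rw [show 1 = 2 * 0 + 1 by rfl, psi_odd, dirD_pow_mul_pow, h1]; simp

theorem dirD_vec_sq_mul {W : (Fin m → ℂ) → Cl m} (hW : ContDiff ℂ ∞ W) (v z : Fin m → ℂ) :
    dirD v (fun z => vec z * (vec z * W z)) z =
      (-2 * (z ⬝ᵥ v)) • W z + vec z * (vec z * dirD v W z) := by
  rw [dirD_mul contDiff_vec (contDiff_mul contDiff_vec hW), dirD_mul contDiff_vec hW]
  simp only [dirD_vec]
  rw [mul_add, ← mul_assoc, ← mul_assoc, ← add_assoc, ← add_mul, add_comm (vec v * vec z),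
    vec_mul_vec, smul_mul_assoc, one_mul]

/-- The factor in `-∂_τ M[ψ_{τ,α+2,k}] = g M[ψ_{τ,α,k+1}]`. -/
def lower (m α k : ℕ) : ℂ :=
  2 * ((α + 2) / 2 : ℕ) - (if Even α then 4 else 0) * fcoef m (α + 2) k 1 +
    2 * fcoef m (α + 2) k 2

theorem dirD_vec_mul_psi (hτ : IsIso τ) (α k : ℕ) (z : Fin m → ℂ) :
    dirD (-τ) (fun z => vec z * psi τ (α + 1) k z) z =
      (-(if Even α then 4 else 0) : ℂ) • psi τ α (k + 1) z +
        vec z * dirD (-τ) (psi τ (α + 1) k) z := by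
  rw [dirD_mul contDiff_vec (isHom_psi τ _ k).contDiff]
  simp only [dirD_vec]
  rw [map_neg, neg_mul, vec_mul_psi_succ hτ, neg_smul]

/-- `∂_{-τ}` lowers `α` by two. Both sides are monogenic, so that it suffices to compare them modulo
functions `z R`, which are orthogonal to the monogenic polynomials. -/
theorem dirD_neg_monoPsi (hm : 2 ≤ m) (hτ : IsIso τ) (α k : ℕ) :
    dirD (-τ) (monoPsi τ (α + 2) k) = fun z => lower m α k • monoPsi τ α (k + 1) z := by
  have hM := isHom_monoPsi τ (α + 2) k
  have hM' := isHom_monoPsi τ α (k + 1)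
  rw [show α + 2 + k = α + (k + 1) + 1 by ring] at hM
  refine monogenic_eq_of_perp (n := α + (k + 1)) (by omega) (hM.dirD_succ _)
    (hM'.const_smul _) (fun z => ?_) (fun z => ?_) ?_
  · have h0 : dirac (monoPsi τ (α + 2) k) = fun _ => 0 :=
      funext fun z => dirac_monoPsi (by omega) hτ (α + 2) k z
    have h1 : dirac (dirD (-τ) (monoPsi τ (α + 2) k)) z =
        dirD (-τ) (dirac (monoPsi τ (α + 2) k)) z := by
      have h2 : dirac (monoPsi τ (α + 2) k) = fun z =>
          ∑ i, e {i} * dirD (Pi.single i 1) (monoPsi τ (α + 2) k) z := rfl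
      rw [h2, dirD_sum _ fun i => contDiff_mul contDiff_const (contDiff_dirD hM.contDiff _),
        dirac_eq]
      refine Finset.sum_congr rfl fun i _ => ?_
      rw [dirD_const_mul (contDiff_dirD hM.contDiff _), dirD_comm hM.contDiff]
    rw [h1, h0]
    simp [dirD]
  · rw [dirac_const_smul hM'.contDiff, dirac_monoPsi (by omega) hτ, smul_zero]
  -- modulo functions of the form `z R`, only the terms `i = 0, 1, 2` of `M[ψ]` contribute
  let W : ℕ → (Fin m → ℂ) → Cl m := fun i z => vec z ^ (i + 1) * psi τ (α - (i + 1)) k z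
  have hW : ∀ i, ContDiff ℂ ∞ (W i) := fun i => contDiff_vec_pow_mul_psi τ _ k (i + 1)
  have key : (fun z => dirD (-τ) (monoPsi τ (α + 2) k) z -
      lower m α k • monoPsi τ α (k + 1) z) = fun z =>
      ((∑ i ∈ Finset.range α, fcoef m (α + 2) k (i + 3) •
        (vec z * ((2 * (z ⬝ᵥ τ)) • (vec z ^ i * psi τ (α - (i + 1)) k z) +
          vec z * dirD (-τ) (W i) z))) +
        fcoef m (α + 2) k 2 • (vec z * (vec z * dirD (-τ) (psi τ α k) z)) +
        fcoef m (α + 2) k 1 • (vec z * dirD (-τ) (psi τ (α + 1) k) z)) +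
        lower m α k • (psi τ α (k + 1) z - monoPsi τ α (k + 1) z) := by
    funext z
    have h0 : monoPsi τ (α + 2) k = fun z => ∑ i ∈ Finset.range (α + 3),
      (fun i z => fcoef m (α + 2) k i • (vec z ^ i * psi τ (α + 2 - i) k z)) i z := rfl
    rw [h0, dirD_sum _ (f := fun i z => fcoef m (α + 2) k i • (vec z ^ i * psi τ (α + 2 - i) k z))
      fun i => (contDiff_vec_pow_mul_psi τ (α + 2 - i) k i).const_smul _]
    simp only [dirD_const_smul (contDiff_vec_pow_mul_psi τ _ k _)]
    rw [Finset.sum_range_succ', Finset.sum_range_succ', Finset.sum_range_succ']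
    have e0 : dirD (-τ) (fun z => vec z ^ 0 * psi τ (α + 2 - 0) k z) z =
        (2 * ((α + 2) / 2 : ℕ) : ℂ) • psi τ α (k + 1) z := by
      simp only [pow_zero, one_mul]
      exact dirD_neg_psi hτ α k z
    have e1 : dirD (-τ) (fun z => vec z ^ (0 + 1) * psi τ (α + 2 - (0 + 1)) k z) z =
        (-(if Even α then 4 else 0) : ℂ) • psi τ α (k + 1) z +
        vec z * dirD (-τ) (psi τ (α + 1) k) z := by
      simp only [zero_add, pow_one]
      exact dirD_vec_mul_psi hτ α k z
    have e2 : dirD (-τ) (fun z => vec z ^ (0 + 1 + 1) * psi τ (α + 2 - (0 + 1 + 1)) k z) z =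
        (2 : ℂ) • psi τ α (k + 1) z + vec z * (vec z * dirD (-τ) (psi τ α k) z) := by
      simp only [zero_add, pow_succ, pow_zero, one_mul, mul_assoc, Nat.add_sub_cancel]
      rw [dirD_vec_sq_mul (isHom_psi τ α k).contDiff, dotProduct_neg, ← dotProduct_smul_psi,
        smul_smul]
      congr 2
      ring
    have e3 : ∀ i ∈ Finset.range α, dirD (-τ) (fun z => vec z ^ (i + 1 + 1 + 1) *
        psi τ (α + 2 - (i + 1 + 1 + 1)) k z) z =
        vec z * ((2 * (z ⬝ᵥ τ)) • (vec z ^ i * psi τ (α - (i + 1)) k z) +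
          vec z * dirD (-τ) (W i) z) := by
      intro i _
      have : (fun z => vec z ^ (i + 1 + 1 + 1) * psi τ (α + 2 - (i + 1 + 1 + 1)) k z) =
          fun z => vec z * (vec z * W i z) := by
        funext z
        simp only [W, pow_succ' _ (i + 1 + 1), pow_succ' _ (i + 1), mul_assoc]
        rw [show α + 2 - (i + 1 + 1 + 1) = α - (i + 1) by omega]
      rw [this, dirD_vec_sq_mul (hW i), dotProduct_neg, mul_add, mul_smul_comm, ← mul_assoc (vec z)
        (vec z ^ i), ← pow_succ']
      congr 2
      ring
    rw [e0, e1, e2]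
    rw [Finset.sum_congr rfl fun i hi => by rw [e3 i hi]]
    simp only [zero_add, fcoef, lower]
    module
  rw [key]
  have c1 : ∀ i, Continuous (dirD (-τ) (W i)) := fun i => (contDiff_dirD (hW i) _).continuous
  have c2 : ∀ α k, Continuous (dirD (-τ) (psi τ α k)) := fun α k =>
    (contDiff_dirD (isHom_psi τ α k).contDiff _).continuous
  have c3 : ∀ α k, Continuous (psi τ α k) := fun α k => (isHom_psi τ α k).contDiff.continuous
  have c4 := hM'.contDiff.continuous
  have c5 : Continuous fun z : Fin m → ℂ => (vec z : Cl m) := contDiff_vec.continuous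
  have c6 : Continuous fun z : Fin m → ℂ => z ⬝ᵥ τ := (IsHom.dotProduct τ).contDiff.continuous
  have c7 : ∀ i, Continuous fun z => vec z * ((2 * (z ⬝ᵥ τ)) •
      (vec z ^ i * psi τ (α - (i + 1)) k z) + vec z * dirD (-τ) (W i) z) := by
    intro i
    have := c1 i
    have := c3 (α - (i + 1)) k
    have := (contDiff_vec_pow (m := m) i).continuous
    fun_prop
  have c8 : Continuous fun z => vec z * (vec z * dirD (-τ) (psi τ α k) z) :=
    c5.mul (c5.mul (c2 _ _))
  have c9 : Continuous fun z => vec z * dirD (-τ) (psi τ (α + 1) k) z := c5.mul (c2 _ _)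
  have d7 : Continuous fun z => ∑ i ∈ Finset.range α, fcoef m (α + 2) k (i + 3) •
      (vec z * ((2 * (z ⬝ᵥ τ)) • (vec z ^ i * psi τ (α - (i + 1)) k z) +
        vec z * dirD (-τ) (W i) z)) :=
    continuous_finsetSum _ fun i _ => (c7 i).const_smul (fcoef m (α + 2) k (i + 3))
  have d8 := c8.const_smul (fcoef m (α + 2) k 2)
  have d9 := c9.const_smul (fcoef m (α + 2) k 1)
  refine PerpMono.add (PerpMono.add (PerpMono.add (PerpMono.sum (fun i hi => ?_)
    fun i _ => (c7 i).const_smul (fcoef m (α + 2) k (i + 3))) ?_ ?_ ?_) ?_ ?_ ?_)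
    ((perp_psi_sub_monoPsi hm τ α (k + 1)).const_smul _) ?_ ?_
  · refine PerpMono.const_smul ?_ _
    have hi' := Finset.mem_range.mp hi
    have h1 : IsHom (1 + (i + (α - (i + 1) + k))) fun z : Fin m → ℂ =>
        (2 * (z ⬝ᵥ τ)) • (vec z ^ i * psi τ (α - (i + 1)) k z) :=
      ((IsHom.dotProduct τ).const_smul 2).smul ((IsHom.vec_pow i).mul (isHom_psi τ _ k))
    have hWi : IsHom (α + k - 1 + 1) (W i) := by
      have := (IsHom.vec_pow (m := m) (i + 1)).mul (isHom_psi τ (α - (i + 1)) k)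
      rwa [show i + 1 + (α - (i + 1) + k) = α + k - 1 + 1 by omega] at this
    have h2 : IsHom (1 + (α + k - 1)) fun z => vec z * dirD (-τ) (W i) z :=
      IsHom.vec.mul (hWi.dirD_succ _)
    rw [show 1 + (i + (α - (i + 1) + k)) = 1 + (α + k - 1) by omega] at h1
    exact PerpMono.vec_mul hm (h1.add h2) (by omega)
  · exact (PerpMono.vec_mul hm (IsHom.vec.mul ((isHom_psi τ α k).dirD _)) (by omega)).const_smul _
  · exact d7
  · exact d8
  · exact (PerpMono.vec_mul hm ((isHom_psi τ (α + 1) k).dirD _) (by omega)).const_smul _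
  · exact d7.add d8
  · exact d9
  · exact (d7.add d8).add d9
  · exact ((c3 α (k + 1)).sub c4).const_smul (lower m α k)

end

section

variable {m : ℕ} {τ : Fin m → ℂ}

/-! ### Pairings of `M[ψ_{τ,α,k}]` with monomials -/

/-- The pairing `∫ conj(⟨x,τ⟩^p ⟨x,τ†⟩^q) M(x) dS(x)` over the unit sphere. -/
def pairJ (τ : Fin m → ℂ) (p q : ℕ) (M : (Fin m → ℂ) → Cl m) : Cl m :=
  sphI fun z => ((z ⬝ᵥ star τ) ^ p * (z ⬝ᵥ (-τ)) ^ q) • M z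

/-- A factor `⟨x,τ†⟩` of the conjugated monomial is traded for the derivative `∂_{-τ}`. -/
theorem pairJ_succ_right (hm : 2 ≤ m) {p q : ℕ} {M : (Fin m → ℂ) → Cl m}
    (hM : IsHom (p + q + 1) M) (hh : IsHarm M) :
    (2 * (p + q : ℕ) + m : ℂ) • pairJ τ p (q + 1) M = pairJ τ p q (dirD (-τ) M) := by
  have h := sphI_dotProduct_mul hm (isHom_pow_mul_pow (star τ) (-τ) p q 1) hM hh (-τ)
  simp only [smul_mul_assoc, one_mul, smul_smul] at h
  rw [pairJ, pairJ, ← h]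
  simp only [pow_succ]
  congr 3; funext z; ring_nf

/-- A factor `⟨x,τ⟩` of the conjugated monomial is traded for the derivative along `conj τ`. -/
theorem pairJ_succ_left (hm : 2 ≤ m) {p q : ℕ} {M : (Fin m → ℂ) → Cl m}
    (hM : IsHom (p + q + 1) M) (hh : IsHarm M) :
    (2 * (p + q : ℕ) + m : ℂ) • pairJ τ (p + 1) q M = pairJ τ p q (dirD (star τ) M) := by
  have h := sphI_dotProduct_mul hm (isHom_pow_mul_pow (star τ) (-τ) p q 1) hM hh (star τ)
  simp only [smul_mul_assoc, one_mul, smul_smul] at h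
  rw [pairJ, pairJ, ← h]
  simp only [pow_succ]
  congr 3; funext z; ring_nf

theorem pairJ_smul (p q : ℕ) (M : (Fin m → ℂ) → Cl m) (c : ℂ) :
    pairJ τ p q (fun z => c • M z) = c • pairJ τ p q M := by
  rw [pairJ, pairJ, ← sphI_const_smul]
  congr 1; funext z; rw [smul_comm]

theorem isHarm_monoPsi (hm : 1 ≤ m) (hτ : IsIso τ) (α k : ℕ) : IsHarm (monoPsi τ α k) :=
  isHarm_of_dirac_eq_zero (isHom_monoPsi τ α k).contDiff (dirac_monoPsi hm hτ α k)

theorem dirD_neg_monoPsi_of_le_one (hτ : IsIso τ) {α : ℕ} (hα : α ≤ 1) (k : ℕ) :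
    dirD (-τ) (monoPsi τ α k) = fun _ => 0 := by
  funext z
  have h0 : monoPsi τ α k = fun z => ∑ i ∈ Finset.range (α + 1),
    (fun i z => fcoef m α k i • (vec z ^ i * psi τ (α - i) k z)) i z := rfl
  rw [h0, dirD_sum _ (f := fun i z => fcoef m α k i • (vec z ^ i * psi τ (α - i) k z))
    fun i => (contDiff_vec_pow_mul_psi τ (α - i) k i).const_smul _]
  simp only [dirD_const_smul (contDiff_vec_pow_mul_psi τ _ k _)]
  refine Finset.sum_eq_zero fun i hi => ?_
  have hi' := Finset.mem_range.mp hi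
  have key : dirD (-τ) (fun z => vec z ^ i * psi τ (α - i) k z) z = 0 := by
    rcases i with _ | i
    · simp only [pow_zero, one_mul]
      exact dirD_neg_psi_of_le_one hτ (by omega) k z
    · obtain rfl : α = 1 := by omega
      obtain rfl : i = 0 := by omega
      simp only [zero_add, pow_one, Nat.sub_self]
      rw [dirD_mul contDiff_vec (isHom_psi τ _ k).contDiff]
      simp only [dirD_vec]
      rw [dirD_neg_psi_of_le_one hτ (by omega), mul_zero, add_zero, map_neg, neg_mul,
        show 0 = 2 * 0 by rfl, psi_even, mul_smul_comm, hτ.vec_sq, smul_zero, neg_zero]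
  rw [key, smul_zero]

theorem natCast_two_mul_add_ne_zero (hm : 1 ≤ m) (n : ℕ) : (2 * (n : ℕ) + m : ℂ) ≠ 0 := by
  exact_mod_cast (by omega : 2 * n + m ≠ 0)

/-- The pairing vanishes if the exponent of `⟨x,τ†⟩` is too large. -/
theorem pairJ_eq_zero (hm : 2 ≤ m) (hτ : IsIso τ) (α k p q : ℕ) (h : p + q = α + k)
    (hq : α / 2 < q) : pairJ τ p q (monoPsi τ α k) = 0 := by
  induction α using Nat.strong_induction_on generalizing k p q with
  | _ α ih =>
  obtain ⟨q, rfl⟩ : ∃ r, q = r + 1 := ⟨q - 1, by omega⟩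
  have h1 := isHom_monoPsi τ α k
  rw [← h, ← add_assoc] at h1
  have h2 := pairJ_succ_right (τ := τ) hm h1 (isHarm_monoPsi (by omega) hτ α k)
  refine (smul_eq_zero.mp (h2.trans ?_)).resolve_left (natCast_two_mul_add_ne_zero (by omega) _)
  by_cases hα : α ≤ 1
  · rw [dirD_neg_monoPsi_of_le_one hτ hα, pairJ]; simp
  · obtain ⟨β, rfl⟩ : ∃ β, α = β + 2 := ⟨α - 2, by omega⟩
    rw [dirD_neg_monoPsi hm hτ, pairJ_smul, ih β (by omega) (k + 1) p q (by omega) (by omega),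
      smul_zero]

/-- The constant Clifford factor of `ψ_{τ,α,k}`. -/
def psiC (τ : Fin m → ℂ) (α : ℕ) : Cl m := if Even α then vec τ else dagger (vec τ) * vec τ

/-- The exponent of `⟨z,τ⟩` in `ψ_{τ,α,k}`. -/
def psiExp (α k : ℕ) : ℕ := if Even α then α / 2 + k else α / 2 + k + 1

theorem psiExp_add (α k : ℕ) : psiExp α k + α / 2 = α + k := by
  unfold psiExp
  obtain ⟨s, rfl | rfl⟩ := Nat.even_or_odd' α
  · simp; omega
  · simp; omega

theorem psiExp_add_two (α k : ℕ) : psiExp (α + 2) k = psiExp α (k + 1) := by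
  have : (α + 2) / 2 = α / 2 + 1 := by omega
  simp only [psiExp, Nat.even_add, even_two, iff_true, this]
  split_ifs <;> ring

theorem psi_eq (τ : Fin m → ℂ) (α k : ℕ) (z : Fin m → ℂ) :
    psi τ α k z = ((z ⬝ᵥ τ) ^ psiExp α k * (z ⬝ᵥ (-star τ)) ^ (α / 2)) • psiC τ α := by
  unfold psi psiExp psiC; split_ifs <;> rfl

theorem dagger_psi_toC (τ : Fin m → ℂ) (α k : ℕ) (x : EuclideanSpace ℝ (Fin m)) :
    dagger (psi τ α k (toC x)) =
      ((toC x ⬝ᵥ star τ) ^ psiExp α k * (toC x ⬝ᵥ (-τ)) ^ (α / 2)) • dagger (psiC τ α) := by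
  have h1 : ∀ w, star (toC x ⬝ᵥ w) = toC x ⬝ᵥ star w := fun w => by
    rw [← Matrix.star_dotProduct_star, star_toC, dotProduct_comm]
  rw [psi_eq, dagger_smul, map_mul, map_pow, map_pow, starRingEnd_apply, starRingEnd_apply, h1, h1,
    star_neg, star_star]

theorem sphI_dagger_psi_mul {M : (Fin m → ℂ) → Cl m} (hM : Continuous M) (α k : ℕ) :
    sphI (fun z => dagger (psi τ α k z) * M z) =
      dagger (psiC τ α) * pairJ τ (psiExp α k) (α / 2) M := by
  have hc1 := (IsHom.dotProduct (star τ)).contDiff.continuous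
  have hc2 := (IsHom.dotProduct (-τ)).contDiff.continuous
  rw [pairJ, ← sphI_const_mul (by fun_prop)]
  refine sphI_congr fun x _ => ?_
  rw [dagger_psi_toC, smul_mul_assoc, mul_smul_comm]

/-- In pairings with monogenic polynomials, `M[ψ]` may be replaced by `ψ`. -/
theorem sphI_dagger_monoPsi_mul (hm : 2 ≤ m) {M : (Fin m → ℂ) → Cl m} (α k : ℕ)
    (hM : IsHom (α + k) M) (hmon : ∀ z, dirac M z = 0) :
    sphI (fun z => dagger (monoPsi τ α k z) * M z) =
      dagger (psiC τ α) * pairJ τ (psiExp α k) (α / 2) M := by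
  have hc := hM.contDiff.continuous
  have hc1 := (isHom_psi τ α k).contDiff.continuous
  have hc2 := (isHom_monoPsi τ α k).contDiff.continuous
  have h := perp_psi_sub_monoPsi hm τ α k M hM hmon
  have h1 : sphI (fun z => dagger (psi τ α k z) * M z) =
      sphI (fun z => dagger (psi τ α k z - monoPsi τ α k z) * M z) +
        sphI (fun z => dagger (monoPsi τ α k z) * M z) := by
    rw [← sphI_add (by fun_prop) (by fun_prop)]
    congr 1; funext z; rw [← add_mul, ← dagger_add, sub_add_cancel]
  rw [← sphI_dagger_psi_mul hc, h1, h, zero_add]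

theorem dagger_sphI {F : (Fin m → ℂ) → Cl m} (hF : Continuous F) :
    dagger (sphI F) = sphI fun z => dagger (F z) := by
  exact ((daggerR m).integral_comp_comm (integrable_sphere hF)).symm

theorem sphI_dagger_mul_comm {F G : (Fin m → ℂ) → Cl m} (hF : Continuous F) (hG : Continuous G) :
    sphI (fun z => dagger (F z) * G z) = dagger (sphI fun z => dagger (G z) * F z) := by
  rw [dagger_sphI (by fun_prop)]
  congr 1; funext z; rw [dagger_mul, dagger_dagger]

/-! ### The area of the sphere -/

theorem sphereArea_eq (hm : 1 ≤ m) :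
    (volume : Measure (EuclideanSpace ℝ (Fin m))).toSphere.real Set.univ = sphereArea m := by
  have : Nonempty (Fin m) := ⟨⟨0, hm⟩⟩
  rw [Measure.toSphere_real_apply_univ, Measure.real, EuclideanSpace.volume_ball]
  have hm' : (0 : ℝ) < (m : ℝ) / 2 := by positivity
  have hG := Real.Gamma_pos_of_pos hm'
  simp only [finrank_euclideanSpace, Fintype.card_fin, ENNReal.ofReal_one, one_pow, one_mul]
  rw [ENNReal.toReal_ofReal (by rw [Real.Gamma_add_one hm'.ne']; positivity),
    Real.Gamma_add_one hm'.ne', sphereArea,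
    show Real.pi ^ ((m : ℝ) / 2) = √Real.pi ^ m by
      rw [Real.sqrt_eq_rpow, ← Real.rpow_mul_natCast Real.pi_pos.le]; congr 1; ring]
  field_simp

theorem sphI_const (hm : 1 ≤ m) (a : Cl m) :
    sphI (fun _ : Fin m → ℂ => a) = (sphereArea m : ℂ) • a := by
  rw [sphI, integral_const, sphereArea_eq hm, Complex.coe_smul]

theorem sphereArea_pos (hm : 1 ≤ m) : 0 < sphereArea m := by
  have hm' : (0 : ℝ) < (m : ℝ) / 2 := by positivity
  have hG := Real.Gamma_pos_of_pos hm'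
  have := Real.pi_pos
  unfold sphereArea
  positivity

/-! ### The coefficients `λ` -/

theorem lam_even (m s k : ℕ) : lam m (2 * s) k =
    1 / (Real.pi * sphereArea m * ((m : ℝ) / 2 - 1)) *
      (Real.Gamma ((m : ℝ) / 2 + 2 * s + k) ^ 2 /
        (4 * s.factorial * (s + k).factorial *
          Real.Gamma (s - 1 + (m : ℝ) / 2) * Real.Gamma ((m : ℝ) / 2 + s + k))) := by
  rw [lam, if_pos (by simp), show 2 * s / 2 = s by omega]

theorem lam_odd (m s k : ℕ) : lam m (2 * s + 1) k =
    1 / (Real.pi * sphereArea m * ((m : ℝ) / 2 - 1)) *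
      (Real.Gamma ((m : ℝ) / 2 + 2 * s + k + 1) ^ 2 /
        (16 * s.factorial * (s + k + 1).factorial *
          Real.Gamma (s + (m : ℝ) / 2) * Real.Gamma ((m : ℝ) / 2 + s + k))) := by
  rw [lam, if_neg (by simp), show (2 * s + 1) / 2 = s by omega]

theorem lam_pos (hm : 3 ≤ m) (α k : ℕ) : 0 < lam m α k := by
  have hA := sphereArea_pos (m := m) (by omega)
  have hpi := Real.pi_pos
  have h3 : (3 : ℝ) ≤ m := by exact_mod_cast hm
  have h1 : 0 < (m : ℝ) / 2 - 1 := by linarith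
  have h0 : ∀ n : ℕ, (0 : ℝ) ≤ n := fun n => n.cast_nonneg
  obtain ⟨s, rfl | rfl⟩ := Nat.even_or_odd' α
  · rw [lam_even]
    have g1 := Real.Gamma_pos_of_pos (s := (m : ℝ) / 2 + 2 * s + k) (by positivity)
    have g2 := Real.Gamma_pos_of_pos (s := s - 1 + (m : ℝ) / 2) (by linarith [h0 s])
    have g3 := Real.Gamma_pos_of_pos (s := (m : ℝ) / 2 + s + k) (by positivity)
    positivity
  · rw [lam_odd]
    have g1 := Real.Gamma_pos_of_pos (s := (m : ℝ) / 2 + 2 * s + k + 1) (by positivity)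
    have g2 := Real.Gamma_pos_of_pos (s := s + (m : ℝ) / 2) (by positivity)
    have g3 := Real.Gamma_pos_of_pos (s := (m : ℝ) / 2 + s + k) (by positivity)
    positivity

/-- This recursion and the following ones match those of the pairings `pairJ`, under `∂_{-τ}` for
`α + 2` and under `∂_{conj τ}` for `α = 0, 1`. -/
theorem lam_even_add_two (hm : 3 ≤ m) (s k : ℕ) :
    lam m (2 * s + 2) k * (2 * (s + 1) * (m + 2 * s - 2)) =
      (2 * (2 * s + 1 + k) + m) * (m + 4 * s + 2 * k + 2) * lam m (2 * s) (k + 1) := by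
  have hA := sphereArea_pos (m := m) (by omega)
  have hpi := Real.pi_pos
  have h3 : (3 : ℝ) ≤ m := by exact_mod_cast hm
  have h1 : 0 < (m : ℝ) / 2 - 1 := by linarith
  have h0 : ∀ n : ℕ, (0 : ℝ) ≤ n := fun n => n.cast_nonneg
  rw [show 2 * s + 2 = 2 * (s + 1) by ring, lam_even, lam_even,
    show (m : ℝ) / 2 + 2 * (s + 1 : ℕ) + k = ((m : ℝ) / 2 + 2 * s + (k + 1 : ℕ)) + 1 by
      push_cast; ring,
    show ((s + 1 : ℕ) : ℝ) - 1 + (m : ℝ) / 2 = (s - 1 + (m : ℝ) / 2) + 1 by push_cast; ring,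
    show (m : ℝ) / 2 + (s + 1 : ℕ) + k = (m : ℝ) / 2 + s + (k + 1 : ℕ) by push_cast; ring,
    show s + 1 + k = s + (k + 1) by ring, Nat.factorial_succ s,
    Real.Gamma_add_one (by positivity), Real.Gamma_add_one (by linarith [h0 s])]
  have g1 := Real.Gamma_pos_of_pos (s := (m : ℝ) / 2 + 2 * s + (k + 1 : ℕ)) (by positivity)
  have g2 := Real.Gamma_pos_of_pos (s := s - 1 + (m : ℝ) / 2) (by linarith [h0 s])
  have g3 := Real.Gamma_pos_of_pos (s := (m : ℝ) / 2 + s + (k + 1 : ℕ)) (by positivity)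
  have g4 : 0 < s - 1 + (m : ℝ) / 2 := by linarith [h0 s]
  generalize Real.Gamma ((m : ℝ) / 2 + 2 * s + (k + 1 : ℕ)) = G1 at *
  generalize Real.Gamma (s - 1 + (m : ℝ) / 2) = G2 at *
  generalize Real.Gamma ((m : ℝ) / 2 + s + (k + 1 : ℕ)) = G3 at *
  have f1 : (0 : ℝ) < s.factorial := by positivity
  have f2 : (0 : ℝ) < (s + (k + 1)).factorial := by positivity
  generalize ((s + (k + 1)).factorial : ℝ) = f2 at *
  rw [show (m + 2 * s - 2 : ℝ) = 2 * (s - 1 + (m : ℝ) / 2) by ring]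
  generalize hx : (s : ℝ) - 1 + m / 2 = x at *
  push_cast
  field_simp
  ring

theorem lam_odd_add_two (hm : 3 ≤ m) (s k : ℕ) :
    lam m (2 * s + 1 + 2) k * (2 * (s + 1) * (m + 2 * s)) =
      (2 * (2 * s + 2 + k) + m) * (m + 4 * s + 2 * k + 4) * lam m (2 * s + 1) (k + 1) := by
  have hA := sphereArea_pos (m := m) (by omega)
  have hpi := Real.pi_pos
  have h3 : (3 : ℝ) ≤ m := by exact_mod_cast hm
  have h1 : 0 < (m : ℝ) / 2 - 1 := by linarith
  rw [show 2 * s + 1 + 2 = 2 * (s + 1) + 1 by ring, lam_odd, lam_odd,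
    show (m : ℝ) / 2 + 2 * (s + 1 : ℕ) + k + 1 = ((m : ℝ) / 2 + 2 * s + (k + 1 : ℕ) + 1) + 1 by
      push_cast; ring,
    show ((s + 1 : ℕ) : ℝ) + (m : ℝ) / 2 = (s + (m : ℝ) / 2) + 1 by push_cast; ring,
    show (m : ℝ) / 2 + (s + 1 : ℕ) + k = (m : ℝ) / 2 + s + (k + 1 : ℕ) by push_cast; ring,
    show s + 1 + k = s + (k + 1) by ring, Nat.factorial_succ s,
    Real.Gamma_add_one (s := (m : ℝ) / 2 + 2 * s + (k + 1 : ℕ) + 1) (by positivity),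
    Real.Gamma_add_one (s := s + (m : ℝ) / 2) (by positivity)]
  have g1 := Real.Gamma_pos_of_pos (s := (m : ℝ) / 2 + 2 * s + (k + 1 : ℕ) + 1) (by positivity)
  have g2 := Real.Gamma_pos_of_pos (s := s + (m : ℝ) / 2) (by positivity)
  have g3 := Real.Gamma_pos_of_pos (s := (m : ℝ) / 2 + s + (k + 1 : ℕ)) (by positivity)
  have g4 : 0 < s + (m : ℝ) / 2 := by positivity
  generalize Real.Gamma ((m : ℝ) / 2 + 2 * s + (k + 1 : ℕ) + 1) = G1 at *
  generalize Real.Gamma (s + (m : ℝ) / 2) = G2 at *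
  generalize Real.Gamma ((m : ℝ) / 2 + s + (k + 1 : ℕ)) = G3 at *
  have f1 : (0 : ℝ) < s.factorial := by positivity
  have f2 : (0 : ℝ) < (s + (k + 1) + 1).factorial := by positivity
  generalize ((s + (k + 1) + 1).factorial : ℝ) = f2 at *
  rw [show (m + 2 * s : ℝ) = 2 * (s + (m : ℝ) / 2) by ring]
  generalize hx : (s : ℝ) + m / 2 = x at *
  push_cast
  field_simp
  ring

theorem lam_zero_succ (hm : 3 ≤ m) (k : ℕ) :
    lam m 0 (k + 1) * (2 * (k + 1)) = (2 * k + m) * lam m 0 k := by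
  have h3 : (3 : ℝ) ≤ m := by exact_mod_cast hm
  have hA := sphereArea_pos (m := m) (by omega)
  have hpi := Real.pi_pos
  have h1 : 0 < (m : ℝ) / 2 - 1 := by linarith
  have e1 := lam_even m 0 (k + 1)
  have e2 := lam_even m 0 k
  rw [mul_zero] at e1 e2
  rw [e1, e2, zero_add, zero_add, Nat.factorial_succ k,
    show (m : ℝ) / 2 + 2 * (0 : ℕ) + (k + 1 : ℕ) = ((m : ℝ) / 2 + k) + 1 by push_cast; ring,
    show (m : ℝ) / 2 + (0 : ℕ) + (k + 1 : ℕ) = ((m : ℝ) / 2 + k) + 1 by push_cast; ring,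
    show (m : ℝ) / 2 + 2 * (0 : ℕ) + k = (m : ℝ) / 2 + k by push_cast; ring,
    show (m : ℝ) / 2 + (0 : ℕ) + k = (m : ℝ) / 2 + k by push_cast; ring,
    Real.Gamma_add_one (by positivity)]
  have g1 := Real.Gamma_pos_of_pos (s := (m : ℝ) / 2 + k) (by positivity)
  have g2 := Real.Gamma_pos_of_pos (s := (0 : ℕ) - 1 + (m : ℝ) / 2) (by simpa using by linarith)
  have f1 : (0 : ℝ) < k.factorial := by positivity
  generalize Real.Gamma ((m : ℝ) / 2 + k) = G1 at *
  generalize Real.Gamma ((0 : ℕ) - 1 + (m : ℝ) / 2) = G2 at *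
  push_cast
  field_simp
  ring

theorem lam_one_succ (hm : 3 ≤ m) (k : ℕ) :
    lam m 1 (k + 1) * (2 * (k + 2) * (m + 2 * k)) =
      (2 * (k + 1) + m) * (m + 2 * k + 2) * lam m 1 k := by
  have h3 : (3 : ℝ) ≤ m := by exact_mod_cast hm
  have hA := sphereArea_pos (m := m) (by omega)
  have hpi := Real.pi_pos
  have h1 : 0 < (m : ℝ) / 2 - 1 := by linarith
  have e1 := lam_odd m 0 (k + 1)
  have e2 := lam_odd m 0 k
  rw [mul_zero, zero_add] at e1 e2
  rw [e1, e2, zero_add, zero_add, Nat.factorial_succ (k + 1),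
    show (m : ℝ) / 2 + 2 * (0 : ℕ) + (k + 1 : ℕ) + 1 = ((m : ℝ) / 2 + k + 1) + 1 by push_cast; ring,
    show (m : ℝ) / 2 + (0 : ℕ) + (k + 1 : ℕ) = ((m : ℝ) / 2 + k) + 1 by push_cast; ring,
    show (m : ℝ) / 2 + 2 * (0 : ℕ) + k + 1 = ((m : ℝ) / 2 + k) + 1 by push_cast; ring,
    show (m : ℝ) / 2 + (0 : ℕ) + k = (m : ℝ) / 2 + k by push_cast; ring,
    Real.Gamma_add_one (s := (m : ℝ) / 2 + k + 1) (by positivity),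
    Real.Gamma_add_one (s := (m : ℝ) / 2 + k) (by positivity)]
  have g1 := Real.Gamma_pos_of_pos (s := (m : ℝ) / 2 + k) (by positivity)
  have g2 := Real.Gamma_pos_of_pos (s := (0 : ℕ) + (m : ℝ) / 2) (by positivity)
  have f1 : (0 : ℝ) < (k + 1).factorial := by positivity
  generalize Real.Gamma ((m : ℝ) / 2 + k) = G1 at *
  generalize Real.Gamma ((0 : ℕ) + (m : ℝ) / 2) = G2 at *
  push_cast [Nat.cast_mul]
  generalize ((k + 1).factorial : ℝ) = f2 at *
  field_simp
  ring

theorem lam_zero_zero (hm : 3 ≤ m) : 4 * Real.pi * lam m 0 0 * sphereArea m = 1 := by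
  have h3 : (3 : ℝ) ≤ m := by exact_mod_cast hm
  have hA := sphereArea_pos (m := m) (by omega)
  have hpi := Real.pi_pos
  have h1 : 0 < (m : ℝ) / 2 - 1 := by linarith
  have e1 := lam_even m 0 0
  rw [mul_zero] at e1
  have g2 := Real.Gamma_pos_of_pos h1
  have e2 : Real.Gamma ((m : ℝ) / 2) = ((m : ℝ) / 2 - 1) * Real.Gamma ((m : ℝ) / 2 - 1) := by
    rw [← Real.Gamma_add_one h1.ne', sub_add_cancel]
  rw [e1]
  simp only [Nat.cast_zero, mul_zero, add_zero, Nat.factorial_zero, Nat.cast_one, mul_one, zero_sub]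
  rw [neg_add_eq_sub, e2]
  generalize Real.Gamma ((m : ℝ) / 2 - 1) = G at *
  generalize (m : ℝ) / 2 - 1 = x at *
  field_simp

theorem lam_one_zero (hm : 3 ≤ m) :
    16 * Real.pi * lam m 1 0 * (sphereArea m * (2 * (m - 2))) = (m : ℝ) ^ 2 := by
  have h3 : (3 : ℝ) ≤ m := by exact_mod_cast hm
  have hA := sphereArea_pos (m := m) (by omega)
  have hpi := Real.pi_pos
  have h1 : 0 < (m : ℝ) / 2 - 1 := by linarith
  have e1 := lam_odd m 0 0
  rw [mul_zero, zero_add] at e1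
  have g2 := Real.Gamma_pos_of_pos (s := (m : ℝ) / 2) (by positivity)
  rw [e1]
  simp only [Nat.cast_zero, mul_zero, add_zero, Nat.factorial_one, zero_add,
    Nat.factorial_zero, Nat.cast_one, mul_one]
  rw [Real.Gamma_add_one (by positivity), show (m - 2 : ℝ) = 2 * ((m : ℝ) / 2 - 1) by ring]
  generalize Real.Gamma ((m : ℝ) / 2) = G at *
  generalize hx : (m : ℝ) / 2 - 1 = x at *
  field_simp

end

section

variable {m : ℕ} {τ : Fin m → ℂ}

/-! ### The Gram matrix of the functions `M[ψ_{τ,α,k}]` on the sphere -/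

theorem lower_even (hm : 1 ≤ m) (s k : ℕ) :
    lower m (2 * s) k * (m + 4 * s + 2 * k + 2) = 2 * (s + 1) * (m + 2 * s - 2) := by
  have hD : (m + 4 * s + 2 * k + 2 : ℂ) ≠ 0 := by
    exact_mod_cast (by omega : m + 4 * s + 2 * k + 2 ≠ 0)
  have hD' : (m + 2 * (2 * s + 1 + k : ℕ) : ℂ) ≠ 0 := by
    exact_mod_cast (by omega : m + 2 * (2 * s + 1 + k) ≠ 0)
  have e1 : (2 * s + 2) / 2 = s + 1 := by omega
  have e2 : (2 * s + 2 - 1) / 2 = s := by omega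
  have e3 : Even (2 * s + 2) := by simp [Nat.even_add]
  have e4 : ¬ Even (2 * s + 2 - 1) := by
    rw [show 2 * s + 2 - 1 = 2 * s + 1 by omega]; simp
  have e5 : 2 * s + 2 - 1 + k = 2 * s + 1 + k := by omega
  simp only [lower, fcoef, mu, kap, e1, e2, e3, e4, even_two_mul, if_true, if_false, zero_add,
    Nat.sub_zero, e5, Nat.not_even_one, one_add_one_eq_two, even_two]
  push_cast at hD' ⊢
  have hD2 : (1 - 1 + m + 2 * (2 * s + 1 + k) : ℂ) ≠ 0 := by convert hD' using 1; ring
  rw [show (m + 4 * s + 2 * k + 2 : ℂ) = 1 - 1 + m + 2 * (2 * s + 1 + k) by ring]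
  field_simp
  ring

theorem lower_odd (hm : 1 ≤ m) (s k : ℕ) :
    lower m (2 * s + 1) k * (m + 4 * s + 2 * k + 4) = 2 * (s + 1) * (m + 2 * s) := by
  have hD' : (1 - 1 + m + 2 * (2 * s + 2 + k) : ℂ) ≠ 0 := by
    have : (m + 2 * (2 * s + 2 + k : ℕ) : ℂ) ≠ 0 := by
      exact_mod_cast (by omega : m + 2 * (2 * s + 2 + k) ≠ 0)
    push_cast at this; convert this using 1; ring
  have e1 : (2 * s + 1 + 2) / 2 = s + 1 := by omega
  have e2 : (2 * s + 1 + 2 - 1) / 2 = s + 1 := by omega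
  have e3 : ¬ Even (2 * s + 1 + 2) := by simp [Nat.even_add]
  have e4 : Even (2 * s + 1 + 2 - 1) := by
    rw [show 2 * s + 1 + 2 - 1 = 2 * (s + 1) by omega]; simp
  have e5 : 2 * s + 1 + 2 - 1 + k = 2 * s + 2 + k := by omega
  have e6 : ¬ Even (2 * s + 1) := by simp
  simp only [lower, fcoef, mu, kap, e1, e2, e3, e4, e6, if_true, if_false, zero_add,
    Nat.sub_zero, e5, Nat.not_even_one, one_add_one_eq_two, even_two]
  push_cast
  rw [show (m + 4 * s + 2 * k + 4 : ℂ) = 1 - 1 + m + 2 * (2 * s + 2 + k) by ring]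
  generalize hx : (1 - 1 + m + 2 * (2 * s + 2 + k) : ℂ) = D at *
  have hm' : (m : ℂ) = D - 4 * s - 4 - 2 * k := by rw [← hx]; ring
  rw [hm']
  field_simp
  ring

/-- One step of the recursion for the normalization: the pairings satisfy `P J = L J'`, and the
coefficients `a`, `a'` satisfy the matching relation, with `L = X / D`. -/
theorem smul_eq_of_smul_eq {V : Type*} [AddCommGroup V] [Module ℂ V] {a a' c P L D X : ℂ}
    {J J' v : V} (hJ : P • J = L • J') (hP : P ≠ 0) (hD : D ≠ 0) (hL : L * D = X)
    (hl : a * X = P * D * a') (h : (c * a') • J' = v) : (c * a) • J = v := by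
  have h1 : a * L = P * a' := by
    refine mul_right_cancel₀ hD ?_
    rw [mul_assoc, hL, hl]; ring
  refine smul_right_injective V hP ?_
  beta_reduce
  rw [← h, smul_comm, hJ, smul_smul, smul_smul, show c * a * L = c * (a * L) by ring, h1]
  congr 1; ring

theorem psiC_add_two (τ : Fin m → ℂ) (α : ℕ) : psiC τ (α + 2) = psiC τ α := by
  simp [psiC, Nat.even_add]

theorem monoPsi_zero (τ : Fin m → ℂ) (k : ℕ) (z : Fin m → ℂ) :
    monoPsi τ 0 k z = ((z ⬝ᵥ τ) ^ k) • vec τ := by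
  simp [monoPsi, fcoef, psi_eq, psiExp, psiC]

theorem monoPsi_one (τ : Fin m → ℂ) (k : ℕ) (z : Fin m → ℂ) :
    monoPsi τ 1 k z = ((z ⬝ᵥ τ) ^ (k + 1)) • (dagger (vec τ) * vec τ) +
      (4 * (k + 1) / (m + 2 * k) : ℂ) • (vec z * ((z ⬝ᵥ τ) ^ k) • vec τ) := by
  simp [monoPsi, fcoef, psi_eq, psiExp, psiC, mu, kap, Finset.sum_range_succ]

theorem dirD_star_pow (hτ : IsIso τ) (k : ℕ) (c : Cl m) (z : Fin m → ℂ) :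
    dirD (star τ) (fun z => ((z ⬝ᵥ τ) ^ k) • c) z = (2 * k * (z ⬝ᵥ τ) ^ (k - 1) : ℂ) • c := by
  have h := dirD_pow_mul_pow τ 0 (star τ) k 0 c z
  simp only [pow_zero, mul_one, Nat.cast_zero, zero_mul, add_zero, hτ.conj_self] at h
  rw [h]; congr 1; ring

theorem contDiff_pow_smul (τ : Fin m → ℂ) (k : ℕ) (c : Cl m) :
    ContDiff ℂ ∞ fun z : Fin m → ℂ => ((z ⬝ᵥ τ) ^ k) • c := by
  simpa using (isHom_pow_mul_pow τ 0 k 0 c).contDiff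

theorem dirD_star_monoPsi_zero (hτ : IsIso τ) (k : ℕ) :
    dirD (star τ) (monoPsi τ 0 (k + 1)) = fun z => (2 * (k + 1) : ℂ) • monoPsi τ 0 k z := by
  funext z
  rw [funext (monoPsi_zero τ (k + 1)), dirD_star_pow hτ, monoPsi_zero, smul_smul,
    Nat.add_sub_cancel]
  push_cast; rfl

theorem dirD_star_monoPsi_one_aux (hτ : IsIso τ) (k : ℕ) (z : Fin m → ℂ) :
    dirD (star τ) (monoPsi τ 1 k) z =
      (2 * (k + 1) * (z ⬝ᵥ τ) ^ k - 4 * (k + 1) / (m + 2 * k) * (z ⬝ᵥ τ) ^ k : ℂ) •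
        (dagger (vec τ) * vec τ) +
      (4 * (k + 1) / (m + 2 * k) : ℂ) •
        (vec z * ((2 * k * (z ⬝ᵥ τ) ^ (k - 1) : ℂ) • vec τ)) := by
  have h1 : ContDiff ℂ ∞ fun z : Fin m → ℂ => ((z ⬝ᵥ τ) ^ k) • (vec τ : Cl m) :=
    contDiff_pow_smul τ k _
  have h2 := contDiff_mul contDiff_vec h1
  have h3 : (vec (star τ) : Cl m) = -dagger (vec τ) := by rw [dagger_vec, map_neg, neg_neg]
  rw [funext (monoPsi_one τ k), dirD_add (contDiff_pow_smul τ (k + 1) _) (h2.const_smul _)]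
  beta_reduce
  rw [dirD_star_pow hτ, dirD_const_smul h2]
  beta_reduce
  rw [dirD_mul contDiff_vec h1]
  beta_reduce
  rw [dirD_star_pow hτ]
  simp only [dirD_vec, h3, Nat.add_sub_cancel]
  rw [mul_smul_comm, neg_mul]
  push_cast
  module

theorem dirD_star_monoPsi_one (hm : 1 ≤ m) (hτ : IsIso τ) (k : ℕ) :
    dirD (star τ) (monoPsi τ 1 (k + 1)) = fun z =>
      (2 * (k + 2) * (m + 2 * k) / (m + 2 * k + 2) : ℂ) • monoPsi τ 1 k z := by
  funext z
  have hD : (m + 2 * k + 2 : ℂ) ≠ 0 := by exact_mod_cast (by omega : m + 2 * k + 2 ≠ 0)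
  have hD' : (m + 2 * k : ℂ) ≠ 0 := by exact_mod_cast (by omega : m + 2 * k ≠ 0)
  have hD2 : (m + 2 * ((k : ℂ) + 1)) ≠ 0 := by convert hD using 1; ring
  rw [dirD_star_monoPsi_one_aux hτ, monoPsi_one, smul_add, smul_smul, smul_smul, mul_smul_comm,
    mul_smul_comm, smul_smul, smul_smul, Nat.add_sub_cancel]
  push_cast
  generalize hx : (m + 2 * k : ℂ) = D at *
  rw [show (m + 2 * ((k : ℂ) + 1)) = D + 2 by rw [← hx]; ring]
  congr 2 <;> field_simp <;> ring

/-- The constant in the normalization of `M[ψ_{τ,α,k}]`. -/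
def parC (α : ℕ) : ℂ := if Even α then 4 else 16

/-- The normalization of `M[ψ_{τ,α,k}]`, by induction on `α` in steps of two with the help of
`∂_{-τ}`, starting from `α = 0, 1`, where the derivative along `conj τ` gives an induction on `k`. -/
theorem smul_pairJ_monoPsi (hm : 3 ≤ m) (hτ : IsIso τ) (α k : ℕ) :
    (parC α * Real.pi * (lam m α k : ℝ)) • pairJ τ (psiExp α k) (α / 2) (monoPsi τ α k) =
      psiC τ α := by
  have hm2 : 2 ≤ m := by omega
  have hm1 : 1 ≤ m := by omega
  induction α using Nat.twoStepInduction generalizing k with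
  | zero =>
    have e : ∀ k, psiExp 0 k = k := by simp [psiExp]
    induction k with
    | zero =>
      have : pairJ τ 0 0 (monoPsi τ 0 0) = (sphereArea m : ℂ) • vec τ := by
        rw [pairJ, ← sphI_const hm1]
        congr 1; funext z; simp [monoPsi_zero]
      rw [e, Nat.zero_div, this, smul_smul]
      have h := congrArg (fun r : ℝ => (r : ℂ)) (lam_zero_zero hm)
      push_cast at h
      simp [parC, psiC, h]
    | succ k ih =>
      have h := pairJ_succ_left (τ := τ) (p := k) (q := 0) (M := monoPsi τ 0 (k + 1)) hm2
        (by simpa using isHom_monoPsi τ 0 (k + 1)) (isHarm_monoPsi hm1 hτ _ _)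
      rw [dirD_star_monoPsi_zero hτ, pairJ_smul] at h
      rw [e] at ih ⊢
      refine smul_eq_of_smul_eq h (natCast_two_mul_add_ne_zero hm1 _) one_ne_zero (mul_one _) ?_ ih
      have := congrArg (fun r : ℝ => (r : ℂ)) (lam_zero_succ hm k)
      push_cast at this
      rw [this]; push_cast; ring
  | one =>
    have e : ∀ k, psiExp 1 k = k + 1 := by simp [psiExp]
    induction k with
    | zero =>
      have hm0 : (m : ℂ) ≠ 0 := by exact_mod_cast (by omega : m ≠ 0)
      have h := pairJ_succ_left (τ := τ) (p := 0) (q := 0) (M := monoPsi τ 1 0) hm2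
        (by simpa using isHom_monoPsi τ 1 0) (isHarm_monoPsi hm1 hτ _ _)
      have h2 : dirD (star τ) (monoPsi τ 1 0) = fun z =>
          (2 - 4 / m : ℂ) • (dagger (vec τ) * vec τ) := by
        funext z; rw [dirD_star_monoPsi_one_aux hτ]; simp
      have h3 : pairJ τ 0 0 (fun _ => (2 - 4 / m : ℂ) • (dagger (vec τ) * vec τ)) =
          (sphereArea m : ℂ) • ((2 - 4 / m : ℂ) • (dagger (vec τ) * vec τ)) := by
        rw [pairJ, ← sphI_const hm1]
        congr 1; funext z; simp
      rw [h2, h3] at h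
      rw [e, show 1 / 2 = 0 by rfl]
      refine smul_right_injective _ hm0 ?_
      beta_reduce
      have hl := congrArg (fun r : ℝ => (r : ℂ)) (lam_one_zero hm)
      push_cast at hl
      simp only [add_zero, Nat.cast_zero, mul_zero, zero_add] at h
      rw [smul_comm, zero_add, h, smul_smul, smul_smul]
      simp only [parC, psiC, Nat.not_even_one, if_false]
      congr 1
      refine mul_right_cancel₀ hm0 ?_
      rw [← sq, ← hl]
      field_simp
      ring
    | succ k ih =>
      have h := pairJ_succ_left (τ := τ) (p := k + 1) (q := 0) (M := monoPsi τ 1 (k + 1)) hm2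
        (by
          have := isHom_monoPsi τ 1 (k + 1)
          rwa [show 1 + (k + 1) = k + 1 + 0 + 1 by ring] at this) (isHarm_monoPsi hm1 hτ _ _)
      rw [dirD_star_monoPsi_one hm1 hτ, pairJ_smul] at h
      rw [e] at ih ⊢
      have hD : (m + 2 * k + 2 : ℂ) ≠ 0 := by exact_mod_cast (by omega : m + 2 * k + 2 ≠ 0)
      refine smul_eq_of_smul_eq h (natCast_two_mul_add_ne_zero hm1 _) hD
        (div_mul_cancel₀ _ hD) ?_ ih
      have := congrArg (fun r : ℝ => (r : ℂ)) (lam_one_succ hm k)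
      push_cast at this
      rw [this]; push_cast; ring
  | more α ih _ =>
    have h := pairJ_succ_right (τ := τ) (p := psiExp α (k + 1)) (q := α / 2)
      (M := monoPsi τ (α + 2) k) hm2
      (by
        have := isHom_monoPsi τ (α + 2) k
        rwa [show α + 2 + k = psiExp α (k + 1) + α / 2 + 1 by rw [psiExp_add]; ring] at this)
      (isHarm_monoPsi hm1 hτ _ _)
    rw [dirD_neg_monoPsi hm2 hτ, pairJ_smul, psiExp_add] at h
    have hc : parC (α + 2) = parC α := by simp [parC, Nat.even_add]
    rw [psiExp_add_two, psiC_add_two, hc, show (α + 2) / 2 = α / 2 + 1 by omega]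
    have hP := natCast_two_mul_add_ne_zero hm1 (α + (k + 1))
    obtain ⟨s, rfl | rfl⟩ := Nat.even_or_odd' α
    · have hD : (m + 4 * s + 2 * k + 2 : ℂ) ≠ 0 := by
        exact_mod_cast (by omega : m + 4 * s + 2 * k + 2 ≠ 0)
      refine smul_eq_of_smul_eq h hP hD (lower_even hm1 s k) ?_ (ih (k + 1))
      have := congrArg (fun r : ℝ => (r : ℂ)) (lam_even_add_two hm s k)
      push_cast at this
      rw [this]; push_cast; ring
    · have hD : (m + 4 * s + 2 * k + 4 : ℂ) ≠ 0 := by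
        exact_mod_cast (by omega : m + 4 * s + 2 * k + 4 ≠ 0)
      refine smul_eq_of_smul_eq h hP hD (lower_odd hm1 s k) ?_ (ih (k + 1))
      have := congrArg (fun r : ℝ => (r : ℂ)) (lam_odd_add_two hm s k)
      push_cast at this
      rw [this]; push_cast; ring

theorem IsIso.sq_dagger_mul_vec (hτ : IsIso τ) :
    (dagger (vec τ) * vec τ : Cl m) * (dagger (vec τ) * vec τ) =
      (4 : ℂ) • (dagger (vec τ) * vec τ) := by
  rw [mul_assoc, hτ.vec_mul_dagger_mul_vec, mul_smul_comm]

/-- `∫ M[ψ]† M[ψ] dS = τ† τ / (4 π λ)`. -/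
theorem smul_sphI_dagger_monoPsi_self (hm : 3 ≤ m) (hτ : IsIso τ) (α k : ℕ) :
    (4 * Real.pi * (lam m α k : ℝ) : ℂ) •
      sphI (fun z => dagger (monoPsi τ α k z) * monoPsi τ α k z) = dagger (vec τ) * vec τ := by
  rw [sphI_dagger_monoPsi_mul (by omega) α k (isHom_monoPsi τ α k)
    (dirac_monoPsi (by omega) hτ α k), ← mul_smul_comm]
  have h := smul_pairJ_monoPsi hm hτ α k
  by_cases hα : Even α
  · simp only [parC, psiC, hα, if_true] at h ⊢
    rw [h]
  · simp only [parC, psiC, hα, if_false] at h ⊢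
    rw [dagger_mul, dagger_dagger]
    have h2 : (4 * Real.pi * (lam m α k : ℝ) : ℂ) • pairJ τ (psiExp α k) (α / 2) (monoPsi τ α k) =
        (1 / 4 : ℂ) • (dagger (vec τ) * vec τ) := by
      rw [← h, smul_smul]; congr 1; ring
    rw [h2, mul_smul_comm, hτ.sq_dagger_mul_vec, smul_smul]; norm_num

/-- The pairing vanishes because the exponent of `⟨x,τ†⟩` is too large, or, if `α' = 2s` and
`α = 2s + 1`, because of `τ τ = 0`. -/
theorem sphI_dagger_monoPsi_of_lt (hm : 3 ≤ m) (hτ : IsIso τ) {α k α' k' : ℕ}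
    (h : α + k = α' + k') (hlt : α' < α) :
    sphI (fun z => dagger (monoPsi τ α k z) * monoPsi τ α' k' z) = 0 := by
  rw [sphI_dagger_monoPsi_mul (by omega) α k (h ▸ isHom_monoPsi τ α' k')
    (dirac_monoPsi (by omega) hτ α' k')]
  by_cases h2 : α' / 2 < α / 2
  · rw [pairJ_eq_zero (by omega) hτ α' k' _ _ (by rw [psiExp_add, h]) h2, mul_zero]
  · obtain ⟨s, rfl⟩ : ∃ s, α' = 2 * s := ⟨α' / 2, by omega⟩
    obtain rfl : α = 2 * s + 1 := by omega
    obtain rfl : k' = k + 1 := by omega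
    have e1 : psiExp (2 * s + 1) k = psiExp (2 * s) (k + 1) := by
      have : (2 * s + 1) / 2 = s := by omega
      simp [psiExp, this]; ring
    have h3 := smul_pairJ_monoPsi hm hτ (2 * s) (k + 1)
    simp only [parC, psiC, even_two_mul, if_true] at h3
    have hne : (4 * Real.pi * (lam m (2 * s) (k + 1) : ℝ) : ℂ) ≠ 0 := by
      have h4 := (lam_pos hm (2 * s) (k + 1)).ne'
      exact mul_ne_zero (mul_ne_zero (by norm_num) (by exact_mod_cast Real.pi_ne_zero))
        (by exact_mod_cast h4)
    rw [e1, show (2 * s + 1) / 2 = 2 * s / 2 by omega]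
    refine smul_right_injective _ hne ?_
    beta_reduce
    rw [← mul_smul_comm, h3, smul_zero, psiC, if_neg (by simp), dagger_mul, dagger_dagger,
      mul_assoc, hτ.vec_sq, mul_zero]

theorem sphI_dagger_monoPsi_of_ne (hm : 3 ≤ m) (hτ : IsIso τ) {α k α' k' : ℕ}
    (h : α + k = α' + k') (hne : α ≠ α') :
    sphI (fun z => dagger (monoPsi τ α k z) * monoPsi τ α' k' z) = 0 := by
  rcases lt_or_gt_of_ne hne with hl | hl
  · rw [sphI_dagger_mul_comm (isHom_monoPsi τ α k).contDiff.continuous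
      (isHom_monoPsi τ α' k').contDiff.continuous, sphI_dagger_monoPsi_of_lt hm hτ h.symm hl,
      dagger_zero]
  · exact sphI_dagger_monoPsi_of_lt hm hτ h hl

theorem psi_mul_dagger_mul_vec (hτ : IsIso τ) (α k : ℕ) (z : Fin m → ℂ) :
    psi τ α k z * (dagger (vec τ) * vec τ) = (4 : ℂ) • psi τ α k z := by
  rw [psi_eq, psiC]
  split_ifs
  · rw [smul_mul_assoc, hτ.vec_mul_dagger_mul_vec, smul_comm]
  · rw [smul_mul_assoc, hτ.sq_dagger_mul_vec, smul_comm]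

theorem monoPsi_mul_dagger_mul_vec (hτ : IsIso τ) (α k : ℕ) (z : Fin m → ℂ) :
    monoPsi τ α k z * (dagger (vec τ) * vec τ) = (4 : ℂ) • monoPsi τ α k z := by
  rw [monoPsi, Finset.sum_mul, Finset.smul_sum]
  refine Finset.sum_congr rfl fun i _ => ?_
  rw [smul_mul_assoc, mul_assoc, psi_mul_dagger_mul_vec hτ, mul_smul_comm, smul_comm]

/-! ### Orthogonality on the Lie sphere -/

theorem sphI_eq_zero_of_odd (hm : 1 ≤ m) {F : (Fin m → ℂ) → Cl m} {d : ℕ}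
    (hd : Odd d) (hF : ∀ (c : ℝ) x, F (toC (c • x)) = c ^ d • F (toC x)) : sphI F = 0 := by
  have : Nontrivial (EuclideanSpace ℝ (Fin m)) :=
    Module.nontrivial_of_finrank_pos (R := ℝ) (by rw [finrank_euclideanSpace_fin]; omega)
  have h := integral_radial_smul_homogeneous (F := fun x => F (toC x)) hF
    fun r => Real.exp (-r ^ 2)
  have h1 : ∫ x : EuclideanSpace ℝ (Fin m), Real.exp (-‖x‖ ^ 2) • F (toC x) = 0 := by
    have h2 := integral_neg_eq_self (μ := (volume : Measure (EuclideanSpace ℝ (Fin m))))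
      fun x => Real.exp (-‖x‖ ^ 2) • F (toC x)
    have h3 : ∀ x, F (toC (-x)) = -F (toC x) := fun x => by
      rw [← neg_one_smul ℝ x, hF, hd.neg_one_pow, neg_one_smul]
    simp only [norm_neg, h3, smul_neg, integral_neg] at h2
    have h4 : (2 : ℝ) • ∫ x : EuclideanSpace ℝ (Fin m), Real.exp (-‖x‖ ^ 2) • F (toC x) = 0 := by
      rw [two_smul]; nth_rewrite 1 [← h2]; exact neg_add_cancel _
    exact (smul_eq_zero.mp h4).resolve_left two_ne_zero
  rw [h1] at h
  refine (smul_eq_zero.mp h.symm).resolve_left ?_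
  rw [integral_pow_mul_gaussian]
  have := Real.Gamma_pos_of_pos
    (s := (((d + (Module.finrank ℝ (EuclideanSpace ℝ (Fin m)) - 1) : ℕ) : ℝ) + 1) / 2)
    (by positivity)
  positivity

theorem integral_exp_mul_I_of_even {k : ℤ} (hk : k ≠ 0) (he : Even k) :
    ∫ θ in Set.Ico 0 Real.pi, Complex.exp (k * (θ * Complex.I)) = 0 := by
  obtain ⟨l, rfl⟩ := he
  have hl : ((l + l : ℤ) * Complex.I : ℂ) ≠ 0 :=
    mul_ne_zero (by exact_mod_cast hk) Complex.I_ne_zero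
  rw [integral_Ico_eq_integral_Ioc, ← intervalIntegral.integral_of_le Real.pi_pos.le]
  have h : ∀ θ : ℝ, Complex.exp ((l + l : ℤ) * (θ * Complex.I)) =
      Complex.exp (((l + l : ℤ) * Complex.I) * θ) := fun θ => by congr 1; ring
  simp only [h]
  rw [integral_exp_mul_complex hl]
  have h2 : Complex.exp ((l + l : ℤ) * Complex.I * Real.pi) = 1 := by
    rw [Complex.exp_eq_one_iff]
    exact ⟨l, by push_cast; ring⟩
  rw [h2]; simp

theorem liePoint_eq (p : ℝ × UnitSphere m) :
    liePoint p = Complex.exp (p.1 * Complex.I) • toC (p.2 : EuclideanSpace ℝ (Fin m)) := by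
  funext i; simp [liePoint, toC]

theorem continuous_liePoint : Continuous (liePoint : ℝ × UnitSphere m → Fin m → ℂ) := by
  simp only [funext liePoint_eq]
  fun_prop

theorem toC_smul (c : ℝ) (x : EuclideanSpace ℝ (Fin m)) : toC (c • x) = (c : ℂ) • toC x := by
  funext i; simp [toC]

theorem dagger_vec_toC (x : EuclideanSpace ℝ (Fin m)) :
    dagger (vec (toC x) : Cl m) = -vec (toC x) := by
  rw [dagger_vec, star_toC, map_neg]

theorem dagger_vec_liePoint_mul (p : ℝ × UnitSphere m) :
    dagger (vec (liePoint p)) * vec (liePoint p) = (1 : Cl m) := by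
  have h : ‖(p.2 : EuclideanSpace ℝ (Fin m))‖ = 1 := by simp
  rw [liePoint_eq, map_smul, dagger_smul, dagger_vec_toC, smul_mul_smul_comm, neg_mul,
    vec_mul_self, toC_dotProduct_self, h, ← Complex.exp_conj, ← Complex.exp_add]
  simp

theorem vec_liePoint_mul_dagger (p : ℝ × UnitSphere m) :
    vec (liePoint p) * dagger (vec (liePoint p)) = (1 : Cl m) := by
  have h : ‖(p.2 : EuclideanSpace ℝ (Fin m))‖ = 1 := by simp
  rw [liePoint_eq, map_smul, dagger_smul, dagger_vec_toC, smul_mul_smul_comm, mul_neg,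
    vec_mul_self, toC_dotProduct_self, h, ← Complex.exp_conj, ← Complex.exp_add]
  simp

theorem dagger_pow_vec_liePoint_mul (p : ℝ × UnitSphere m) (j : ℕ) :
    dagger (vec (liePoint p) ^ j) * vec (liePoint p) ^ j = (1 : Cl m) := by
  rw [dagger_pow]
  have hc : Commute (dagger (vec (liePoint p) : Cl m)) (vec (liePoint p)) := by
    rw [Commute, SemiconjBy, dagger_vec_liePoint_mul, vec_liePoint_mul_dagger]
  rw [← hc.mul_pow, dagger_vec_liePoint_mul, one_pow]

/-- The explicit form `z^j M[ψ_{τ,α,k}]` of the generators. -/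
def gen (τ : Fin m → ℂ) (j : ℕ) (q : ℕ × ℕ) (z : Fin m → ℂ) : Cl m :=
  vec z ^ j * monoPsi τ q.1 q.2 z

theorem isHom_gen (τ : Fin m → ℂ) (j : ℕ) (q : ℕ × ℕ) : IsHom (j + (q.1 + q.2)) (gen τ j q) :=
  (IsHom.vec_pow j).mul (isHom_monoPsi τ q.1 q.2)

theorem dagger_gen_mul_gen_liePoint (τ : Fin m → ℂ) (j : ℕ) (q q' : ℕ × ℕ)
    (p : ℝ × UnitSphere m) :
    dagger (gen τ j q (liePoint p)) * gen τ j q' (liePoint p) =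
      Complex.exp (((q'.1 + q'.2 : ℕ) - (q.1 + q.2 : ℕ) : ℤ) * (p.1 * Complex.I)) •
        (dagger (monoPsi τ q.1 q.2 (toC (p.2 : EuclideanSpace ℝ (Fin m)))) *
          monoPsi τ q'.1 q'.2 (toC (p.2 : EuclideanSpace ℝ (Fin m)))) := by
  have h1 : dagger (gen τ j q (liePoint p)) * gen τ j q' (liePoint p) =
      dagger (monoPsi τ q.1 q.2 (liePoint p)) * monoPsi τ q'.1 q'.2 (liePoint p) := by
    rw [gen, gen, dagger_mul, mul_assoc, ← mul_assoc _ (vec _ ^ j), dagger_pow_vec_liePoint_mul,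
      one_mul]
  rw [h1, liePoint_eq, (isHom_monoPsi τ _ _).homog, (isHom_monoPsi τ _ _).homog, dagger_smul,
    smul_mul_smul_comm, map_pow, ← Complex.exp_conj, ← Complex.exp_nat_mul, ← Complex.exp_nat_mul,
    ← Complex.exp_add]
  congr 2
  simp only [map_mul, Complex.conj_ofReal, Complex.conj_I]
  push_cast
  ring

/-- The Gram matrix of the generators on the Lie sphere. -/
theorem integral_dagger_gen_mul_gen (hm : 3 ≤ m) (hτ : IsIso τ) (j : ℕ) (q q' : ℕ × ℕ) :
    (4 * (lam m q.1 q.2 : ℝ) : ℂ) •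
      ∫ p, dagger (gen τ j q (liePoint p)) * gen τ j q' (liePoint p) ∂lieMeasure m =
      if q = q' then dagger (vec τ) * vec τ else 0 := by
  simp only [dagger_gen_mul_gen_liePoint]
  have h1 := integral_prod_smul (μ := volume.restrict (Set.Ico 0 Real.pi))
    (ν := (volume : Measure (EuclideanSpace ℝ (Fin m))).toSphere)
    (fun θ : ℝ => Complex.exp (((q'.1 + q'.2 : ℕ) - (q.1 + q.2 : ℕ) : ℤ) * (θ * Complex.I)))
    (fun u : UnitSphere m =>
        (dagger (monoPsi τ q.1 q.2 (toC (u : EuclideanSpace ℝ (Fin m)))) *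
          monoPsi τ q'.1 q'.2 (toC (u : EuclideanSpace ℝ (Fin m)))))
  rw [lieMeasure, h1]
  have h2 : (∫ u : UnitSphere m, dagger (monoPsi τ q.1 q.2 (toC (u : EuclideanSpace ℝ (Fin m)))) *
          monoPsi τ q'.1 q'.2 (toC (u : EuclideanSpace ℝ (Fin m)))
          ∂(volume : Measure (EuclideanSpace ℝ (Fin m))).toSphere) =
      sphI fun z => dagger (monoPsi τ q.1 q.2 z) * monoPsi τ q'.1 q'.2 z := rfl
  rw [h2]
  obtain ⟨α, k⟩ := q
  obtain ⟨α', k'⟩ := q'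
  by_cases hd : α + k = α' + k'
  · have h3 : (∫ θ in Set.Ico 0 Real.pi,
        Complex.exp (((α' + k' : ℕ) - (α + k : ℕ) : ℤ) * (θ * Complex.I))) = Real.pi := by
      rw [hd]; simp [Real.pi_pos.le]
    simp only [h3]
    by_cases ha : α = α'
    · obtain rfl := ha
      obtain rfl : k = k' := by omega
      rw [if_pos rfl, smul_smul, ← smul_sphI_dagger_monoPsi_self hm hτ α k]
      congr 1; ring
    · rw [if_neg (by simp [ha]), sphI_dagger_monoPsi_of_ne hm hτ hd ha, smul_zero, smul_zero]
  · rw [if_neg (by rintro h; simp only [Prod.mk.injEq] at h; omega)]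
    rcases Int.even_or_odd ((α' + k' : ℕ) - (α + k : ℕ) : ℤ) with he | ho
    · rw [integral_exp_mul_I_of_even (by simp only [ne_eq]; omega) he, zero_smul, smul_zero]
    · have hodd : Odd (α + k + (α' + k')) := by
        rw [← Int.odd_coe_nat]
        obtain ⟨r, hr⟩ := ho
        exact ⟨r + (α + k : ℕ), by push_cast at hr ⊢; linarith⟩
      rw [sphI_eq_zero_of_odd (by omega) hodd fun c x => ?_, smul_zero, smul_zero]
      beta_reduce
      rw [toC_smul, (isHom_monoPsi τ _ _).homog, (isHom_monoPsi τ _ _).homog, dagger_smul,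
        smul_mul_smul_comm, map_pow, Complex.conj_ofReal, ← pow_add, ← Complex.ofReal_pow,
        Complex.coe_smul]

/-- The generators absorb the factor `τ† τ / 4`; this is why they reproduce although their Gram
matrix consists of the zero divisors `τ† τ / (4 λ)`. -/
theorem gen_mul_dagger_mul_vec (hτ : IsIso τ) (j : ℕ) (q : ℕ × ℕ) (z : Fin m → ℂ) :
    gen τ j q z * (dagger (vec τ) * vec τ) = (4 : ℂ) • gen τ j q z := by
  rw [gen, mul_assoc, monoPsi_mul_dagger_mul_vec hτ, mul_smul_comm]

theorem psij_eq_gen (hm : 2 ≤ m) (hτ : IsIso τ) (j α k : ℕ) : psij τ j α k = gen τ j (α, k) := by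
  funext z; rw [psij, Mpsi_eq hm hτ, gen]

theorem isIso_tau {t s : EuclideanSpace ℝ (Fin m)} (ht : ‖t‖ = 1) (hs : ‖s‖ = 1)
    (hts : inner ℝ t s = 0) : IsIso (tau t s) := by
  have h1 : ∑ i, (t i : ℂ) * t i = 1 := by
    have := EuclideanSpace.real_norm_sq_eq t
    rw [ht] at this
    have h := congrArg (fun r : ℝ => (r : ℂ)) this
    push_cast at h
    simpa [sq] using h.symm
  have h2 : ∑ i, (s i : ℂ) * s i = 1 := by
    have := EuclideanSpace.real_norm_sq_eq s
    rw [hs] at this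
    have h := congrArg (fun r : ℝ => (r : ℂ)) this
    push_cast at h
    simpa [sq] using h.symm
  have h3 : ∑ i, (t i : ℂ) * s i = 0 := by
    rw [PiLp.inner_apply] at hts
    have h := congrArg (fun r : ℝ => (r : ℂ)) hts
    push_cast at h
    simpa [mul_comm] using h
  have key : ∀ c : ℂ, ∑ i, ((t i : ℂ) + Complex.I * s i) * (t i + c * s i) =
      1 + Complex.I * c := by
    intro c
    have : ∀ i, ((t i : ℂ) + Complex.I * s i) * (t i + c * s i) =
        t i * t i + (c + Complex.I) * (t i * s i) + Complex.I * c * (s i * s i) := fun i => by ring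
    simp only [this, Finset.sum_add_distrib, ← Finset.mul_sum, h1, h2, h3]
    ring
  constructor
  · have := key Complex.I
    rw [Complex.I_mul_I] at this
    simpa [dotProduct, tau] using this
  · have := key (-Complex.I)
    rw [mul_neg, Complex.I_mul_I] at this
    norm_num at this
    simpa [dotProduct, tau] using this

end

section

variable {m : ℕ}

/-! ### The Lie norm and a maximum principle on the Lie ball -/

/-- The square `∑ |z_i|²` of the Hermitian norm. -/
def hermSq (z : Fin m → ℂ) : ℝ := ∑ i, ‖z i‖ ^ 2

theorem hermSq_eq (z : Fin m → ℂ) : hermSq z = ∑ i, (z i).re ^ 2 + ∑ i, (z i).im ^ 2 := by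
  rw [hermSq, ← Finset.sum_add_distrib]
  refine Finset.sum_congr rfl fun i _ => ?_
  rw [Complex.sq_norm, Complex.normSq_apply]; ring

theorem dotProduct_star_self (z : Fin m → ℂ) : z ⬝ᵥ star z = (hermSq z : ℂ) := by
  rw [hermSq, dotProduct]
  push_cast
  refine Finset.sum_congr rfl fun i _ => ?_
  simpa using Complex.mul_conj' (z i)

theorem hermSq_nonneg (z : Fin m → ℂ) : 0 ≤ hermSq z :=
  Finset.sum_nonneg fun _ _ => by positivity

theorem hermSq_smul (c : ℂ) (z : Fin m → ℂ) : hermSq (c • z) = ‖c‖ ^ 2 * hermSq z := by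
  simp [hermSq, mul_pow, Finset.mul_sum]

theorem smul_dotProduct_smul (c : ℂ) (z : Fin m → ℂ) : (c • z) ⬝ᵥ (c • z) = c ^ 2 * (z ⬝ᵥ z) := by
  rw [smul_dotProduct, dotProduct_smul, smul_eq_mul, smul_eq_mul]; ring

theorem norm_sq_dotProduct_self (z : Fin m → ℂ) : ‖z ⬝ᵥ z‖ ^ 2 =
    (∑ i, (z i).re ^ 2 - ∑ i, (z i).im ^ 2) ^ 2 + 4 * (∑ i, (z i).re * (z i).im) ^ 2 := by
  have h1 : (z ⬝ᵥ z).re = ∑ i, (z i).re ^ 2 - ∑ i, (z i).im ^ 2 := by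
    simp [dotProduct, sq]
  have h2 : (z ⬝ᵥ z).im = 2 * ∑ i, (z i).re * (z i).im := by
    simp only [dotProduct, Complex.im_sum, Complex.mul_im, Finset.mul_sum]
    exact Finset.sum_congr rfl fun i _ => by ring
  rw [Complex.sq_norm, Complex.normSq_apply, h1, h2]; ring

theorem lieNormSq_eq (z : Fin m → ℂ) :
    lieNormSq z = hermSq z + √(hermSq z ^ 2 - ‖z ⬝ᵥ z‖ ^ 2) := by
  rw [lieNormSq, norm_sq_dotProduct_self, hermSq_eq]
  congr 1
  set a := ∑ i, (z i).re ^ 2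
  set b := ∑ i, (z i).im ^ 2
  set c := ∑ i, (z i).re * (z i).im
  rw [show (a + b) ^ 2 - ((a - b) ^ 2 + 4 * c ^ 2) = 2 ^ 2 * (a * b - c ^ 2) by ring,
    Real.sqrt_mul (by norm_num), Real.sqrt_sq (by norm_num)]

theorem norm_dotProduct_self_le (z : Fin m → ℂ) : ‖z ⬝ᵥ z‖ ≤ hermSq z := by
  refine (norm_sum_le _ _).trans (Finset.sum_le_sum fun i _ => ?_)
  rw [norm_mul, sq]

theorem lieNormSq_nonneg (z : Fin m → ℂ) : 0 ≤ lieNormSq z := by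
  rw [lieNormSq_eq]; exact add_nonneg (hermSq_nonneg z) (Real.sqrt_nonneg _)

theorem lieNormSq_smul (c : ℂ) (z : Fin m → ℂ) :
    lieNormSq (c • z) = ‖c‖ ^ 2 * lieNormSq z := by
  rw [lieNormSq_eq, lieNormSq_eq, hermSq_smul, smul_dotProduct_smul, norm_mul, norm_pow, mul_pow,
    mul_pow, ← mul_sub, Real.sqrt_mul (by positivity), Real.sqrt_sq (by positivity)]
  ring

theorem continuous_lieNormSq : Continuous (lieNormSq : (Fin m → ℂ) → ℝ) := by
  unfold lieNormSq
  fun_prop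

theorem isOpen_lieBall : IsOpen (lieBall m) := isOpen_lt continuous_lieNormSq continuous_const

theorem lieNormSq_of_norm_eq {z : Fin m → ℂ} (h : ‖z ⬝ᵥ z‖ = hermSq z) :
    lieNormSq z = hermSq z := by
  rw [lieNormSq_eq, h]; simp

theorem hermSq_toC (x : EuclideanSpace ℝ (Fin m)) : hermSq (toC x) = ‖x‖ ^ 2 := by
  rw [hermSq, EuclideanSpace.real_norm_sq_eq]
  simp [toC]

theorem lieNormSq_toC (x : EuclideanSpace ℝ (Fin m)) : lieNormSq (toC x) = ‖x‖ ^ 2 := by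
  rw [lieNormSq_of_norm_eq, hermSq_toC]
  rw [hermSq_toC, toC_dotProduct_self, Complex.norm_real, Real.norm_of_nonneg (by positivity)]

theorem lieNormSq_liePoint (p : ℝ × UnitSphere m) : lieNormSq (liePoint p) = 1 := by
  rw [liePoint_eq, lieNormSq_smul, lieNormSq_toC, Complex.norm_exp_ofReal_mul_I]; simp

theorem smul_liePoint_mem {c : ℂ} (hc : ‖c‖ < 1) (p : ℝ × UnitSphere m) :
    c • liePoint p ∈ lieBall m := by
  change lieNormSq _ < 1
  rw [lieNormSq_smul, lieNormSq_liePoint, mul_one]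
  nlinarith [norm_nonneg c]

/-- Up to a rotation `e^{iθ}`, the product `⟨z,z⟩` is nonnegative. -/
theorem exists_rotation (z : Fin m → ℂ) :
    ∃ θ : ℝ, ∃ z' : Fin m → ℂ, z = Complex.exp (θ * Complex.I) • z' ∧
      z' ⬝ᵥ z' = (‖z ⬝ᵥ z‖ : ℂ) ∧ hermSq z' = hermSq z := by
  refine ⟨(z ⬝ᵥ z).arg / 2, Complex.exp (-((z ⬝ᵥ z).arg / 2 * Complex.I)) • z, ?_, ?_, ?_⟩
  · rw [smul_smul, ← Complex.exp_add]; simp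
  · rw [smul_dotProduct_smul]
    nth_rewrite 2 [← Complex.norm_mul_exp_arg_mul_I (z ⬝ᵥ z)]
    rw [← Complex.exp_nat_mul, mul_left_comm, ← Complex.exp_add]
    have : ((2 : ℕ) * -((z ⬝ᵥ z).arg / 2 * Complex.I) + (z ⬝ᵥ z).arg * Complex.I : ℂ) = 0 := by
      push_cast; ring
    rw [this]; simp
  · rw [hermSq_smul, show -((z ⬝ᵥ z).arg / 2 * Complex.I : ℂ) =
      ((-((z ⬝ᵥ z).arg / 2) : ℝ) : ℂ) * Complex.I by push_cast; ring,
      Complex.norm_exp_ofReal_mul_I]; simp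

/-- The points with `|⟨z,z⟩| = ∑ |z_i|²` are the multiples of the points of the Lie sphere. -/
theorem exists_eq_smul_liePoint (hm : 1 ≤ m) {z : Fin m → ℂ} (h : ‖z ⬝ᵥ z‖ = hermSq z) :
    ∃ p : ℝ × UnitSphere m, z = (√(hermSq z) : ℂ) • liePoint p := by
  obtain ⟨θ, z', hz, hd, hs⟩ := exists_rotation z
  have him : ∀ i, (z' i).im = 0 := by
    have h1 : (z' ⬝ᵥ z').re = ∑ i, (z' i).re ^ 2 - ∑ i, (z' i).im ^ 2 := by simp [dotProduct, sq]
    rw [hd, h, ← hs, Complex.ofReal_re, hermSq_eq] at h1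
    have h2 : ∑ i, (z' i).im ^ 2 = 0 := by linarith
    rw [Finset.sum_eq_zero_iff_of_nonneg fun i _ => sq_nonneg _] at h2
    exact fun i => pow_eq_zero_iff two_ne_zero |>.mp (h2 i (Finset.mem_univ i))
  let x : EuclideanSpace ℝ (Fin m) := WithLp.toLp 2 fun i => (z' i).re
  have hx : z' = toC x := by
    funext i
    apply Complex.ext <;> simp [toC, x, him]
  have hn : √(hermSq z) = ‖x‖ := by
    rw [← hs, hx, hermSq_toC, Real.sqrt_sq (norm_nonneg _)]
  rw [hn]
  rcases eq_or_ne x 0 with h0 | h0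
  · refine ⟨⟨0, ⟨EuclideanSpace.single ⟨0, hm⟩ 1, by simp⟩⟩, ?_⟩
    rw [hz, hx, h0]
    funext i; simp [toC]
  · have h0' : ‖x‖ ≠ 0 := norm_ne_zero_iff.mpr h0
    refine ⟨⟨θ, ⟨‖x‖⁻¹ • x, by simp [norm_smul, h0']⟩⟩, ?_⟩
    rw [liePoint_eq, smul_comm, ← toC_smul, smul_inv_smul₀ h0', hz, hx]

theorem hermSq_add_smul_star {w : Fin m → ℂ} (hw : w ⬝ᵥ w = 0) (ζ : ℂ) :
    hermSq (w + ζ • star w) = hermSq w * (1 + ‖ζ‖ ^ 2) := by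
  have hw' : star w ⬝ᵥ star w = 0 := by
    have := congrArg star hw
    rwa [← Matrix.star_dotProduct_star, star_zero] at this
  have h1 := dotProduct_star_self (w + ζ • star w)
  have h2 : ζ * star ζ = ((‖ζ‖ ^ 2 : ℝ) : ℂ) := by simpa using Complex.mul_conj' ζ
  simp only [star_add, star_smul, star_star, add_dotProduct, dotProduct_add, dotProduct_smul,
    smul_dotProduct, hw, hw', dotProduct_comm (star w) w, dotProduct_star_self, smul_eq_mul] at h1
  have h3 : ((hermSq (w + ζ • star w) : ℝ) : ℂ) = ((hermSq w * (1 + ‖ζ‖ ^ 2) : ℝ) : ℂ) := by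
    rw [← h1, Complex.ofReal_mul, Complex.ofReal_add, ← h2]
    push_cast; ring
  exact_mod_cast h3

theorem dotProduct_add_smul_star {w : Fin m → ℂ} (hw : w ⬝ᵥ w = 0) (ζ : ℂ) :
    (w + ζ • star w) ⬝ᵥ (w + ζ • star w) = 2 * ζ * hermSq w := by
  have hw' : star w ⬝ᵥ star w = 0 := by
    have := congrArg star hw
    rwa [← Matrix.star_dotProduct_star, star_zero] at this
  simp only [add_dotProduct, dotProduct_add, dotProduct_smul, smul_dotProduct, hw, hw',
    dotProduct_comm (star w) w, dotProduct_star_self, smul_eq_mul]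
  ring

/-- On the analytic disc `ζ ↦ w + ζ conj w`, `|ζ| ≤ 1`, the Lie norm is constant. -/
theorem lieNormSq_add_smul_star {w : Fin m → ℂ} (hw : w ⬝ᵥ w = 0) {ζ : ℂ} (hζ : ‖ζ‖ ≤ 1) :
    lieNormSq (w + ζ • star w) = 2 * hermSq w := by
  rw [lieNormSq_eq, hermSq_add_smul_star hw, dotProduct_add_smul_star hw, norm_mul, norm_mul,
    Complex.norm_real, Real.norm_of_nonneg (hermSq_nonneg w)]
  have : (hermSq w * (1 + ‖ζ‖ ^ 2)) ^ 2 - (‖(2 : ℂ)‖ * ‖ζ‖ * hermSq w) ^ 2 =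
      (hermSq w * (1 - ‖ζ‖ ^ 2)) ^ 2 := by
    rw [Complex.norm_ofNat]; ring
  have h2 : 0 ≤ 1 - ‖ζ‖ ^ 2 := by nlinarith [norm_nonneg ζ]
  rw [this, Real.sqrt_sq (mul_nonneg (hermSq_nonneg w) h2)]
  ring

/-- Every point which is not a multiple of a point of the Lie sphere lies, up to a rotation, on an
analytic disc `ζ ↦ w + ζ conj w`, `⟨w,w⟩ = 0`. -/
theorem exists_eq_disc {z : Fin m → ℂ} (h : ‖z ⬝ᵥ z‖ < hermSq z) :
    ∃ (θ : ℝ) (w : Fin m → ℂ) (ζ : ℂ), w ⬝ᵥ w = 0 ∧ ‖ζ‖ ≤ 1 ∧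
      z = Complex.exp (θ * Complex.I) • (w + ζ • star w) := by
  obtain ⟨θ, z', hz, hd, hs⟩ := exists_rotation z
  have h0 := norm_nonneg (z ⬝ᵥ z)
  set N := hermSq z
  set D := ‖z ⬝ᵥ z‖
  obtain ⟨E, hE0, hE⟩ : ∃ E : ℝ, 0 ≤ E ∧ E ^ 2 = N ^ 2 - D ^ 2 :=
    ⟨√(N ^ 2 - D ^ 2), Real.sqrt_nonneg _, Real.sq_sqrt (by nlinarith)⟩
  have hR : 0 < N + E := by linarith
  set ζ : ℝ := D / (N + E) with hζ
  have hζ0 : 0 ≤ ζ := by positivity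
  have hζ1 : ζ < 1 := by rw [hζ, div_lt_one hR]; linarith
  have hq : (1 + ζ ^ 2) * D = 2 * ζ * N := by
    rw [hζ]
    field_simp
    nlinarith
  have h1 : (1 - ζ ^ 2 : ℂ) ≠ 0 := by
    have : (1 - ζ ^ 2 : ℝ) ≠ 0 := by nlinarith
    exact_mod_cast this
  have hd' : star z' ⬝ᵥ star z' = (D : ℂ) := by
    have := congrArg star hd
    rw [← Matrix.star_dotProduct_star] at this
    simpa using this
  refine ⟨θ, (1 - ζ ^ 2 : ℂ)⁻¹ • (z' - (ζ : ℂ) • star z'), ζ, ?_, ?_, ?_⟩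
  · have h2 : (z' - (ζ : ℂ) • star z') ⬝ᵥ (z' - (ζ : ℂ) • star z') = 0 := by
      simp only [sub_dotProduct, dotProduct_sub, dotProduct_smul, smul_dotProduct, hd, hd',
        dotProduct_comm (star z') z', dotProduct_star_self, hs, smul_eq_mul]
      have := congrArg (fun r : ℝ => (r : ℂ)) hq
      push_cast at this
      linear_combination this
    rw [smul_dotProduct_smul, h2, mul_zero]
  · rw [Complex.norm_real, Real.norm_of_nonneg hζ0]; exact hζ1.le
  · rw [hz]
    congr 1
    have h3 : star ((1 - ζ ^ 2 : ℂ)⁻¹ • (z' - (ζ : ℂ) • star z')) =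
        (1 - ζ ^ 2 : ℂ)⁻¹ • (star z' - (ζ : ℂ) • z') := by
      rw [star_smul, star_sub, star_smul, star_star]
      simp
    rw [h3, smul_comm, ← smul_add, eq_inv_smul_iff₀ h1]
    module

/-- Maximum principle: a holomorphic function is bounded at `z` by its values on the multiple of
the Lie sphere of the same Lie norm. -/
theorem norm_le_of_forall_liePoint {E : Type*} [NormedAddCommGroup E] [NormedSpace ℂ E]
    (hm : 1 ≤ m) {h : (Fin m → ℂ) → E} {z : Fin m → ℂ} {C : ℝ}
    (hd : ∀ w, lieNormSq w = lieNormSq z → DifferentiableAt ℂ h w)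
    (hC : ∀ p : ℝ × UnitSphere m, ‖h ((√(lieNormSq z) : ℂ) • liePoint p)‖ ≤ C) : ‖h z‖ ≤ C := by
  rcases (norm_dotProduct_self_le z).eq_or_lt with h1 | h1
  · obtain ⟨p, hp⟩ := exists_eq_smul_liePoint hm h1
    have := hC p
    rwa [lieNormSq_of_norm_eq h1, ← hp] at this
  obtain ⟨θ, w, ζ₀, hw, hζ₀, hz⟩ := exists_eq_disc h1
  set c := Complex.exp (θ * Complex.I)
  have hc : ‖c‖ = 1 := Complex.norm_exp_ofReal_mul_I θ
  have hL : ∀ ζ : ℂ, ‖ζ‖ ≤ 1 → lieNormSq (c • (w + ζ • star w)) = 2 * hermSq w := fun ζ hζ => by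
    rw [lieNormSq_smul, hc, lieNormSq_add_smul_star hw hζ]; ring
  have hzL : lieNormSq z = 2 * hermSq w := by rw [hz, hL _ hζ₀]
  let G : ℂ → E := fun ζ => h (c • (w + ζ • star w))
  have hG : DifferentiableOn ℂ G (Metric.closedBall 0 1) := fun ζ hζ => by
    refine DifferentiableAt.differentiableWithinAt ?_
    refine DifferentiableAt.comp ζ (hd _ ?_) (by fun_prop)
    rw [hL _ (by simpa using hζ), hzL]
  have hG' : DiffContOnCl ℂ G (Metric.ball 0 1) := by
    refine DifferentiableOn.diffContOnCl ?_
    rwa [closure_ball _ one_ne_zero]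
  rw [hz]
  refine Complex.norm_le_of_forall_mem_frontier_norm_le (f := G) Metric.isBounded_ball hG'
    (fun ζ hζ => ?_) (z := ζ₀) (by rw [closure_ball _ one_ne_zero]; simpa using hζ₀)
  rw [frontier_ball _ one_ne_zero, mem_sphere_zero_iff_norm] at hζ
  have h3 : hermSq (c • (w + ζ • star w)) = 2 * hermSq w := by
    rw [hermSq_smul, hermSq_add_smul_star hw, hc, hζ]; ring
  have h2 : ‖(c • (w + ζ • star w)) ⬝ᵥ (c • (w + ζ • star w))‖ =
      hermSq (c • (w + ζ • star w)) := by
    rw [smul_dotProduct_smul, dotProduct_add_smul_star hw, h3, norm_mul, norm_pow, hc, norm_mul,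
      norm_mul, hζ, Complex.norm_real, Real.norm_of_nonneg (hermSq_nonneg w)]
    simp
  obtain ⟨p, hp⟩ := exists_eq_smul_liePoint hm h2
  have := hC p
  rw [hzL, ← h3, ← hp] at this
  exact this

end

section

variable {m : ℕ}

/-! ### Pointwise bounds by the norm on the sphere -/

theorem lieNormSq_le (z : Fin m → ℂ) :
    lieNormSq z ≤ (√(∑ i, (z i).re ^ 2) + √(∑ i, (z i).im ^ 2)) ^ 2 := by
  have ha : 0 ≤ ∑ i, (z i).re ^ 2 := Finset.sum_nonneg fun _ _ => by positivity
  have hb : 0 ≤ ∑ i, (z i).im ^ 2 := Finset.sum_nonneg fun _ _ => by positivity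
  rw [lieNormSq, add_sq, Real.sq_sqrt ha, Real.sq_sqrt hb, mul_assoc, ← Real.sqrt_mul ha]
  have : √((∑ i, (z i).re ^ 2) * (∑ i, (z i).im ^ 2) - (∑ i, (z i).re * (z i).im) ^ 2) ≤
      √((∑ i, (z i).re ^ 2) * (∑ i, (z i).im ^ 2)) :=
    Real.sqrt_le_sqrt (by linarith [sq_nonneg (∑ i, (z i).re * (z i).im)])
  linarith

theorem lieNormSq_toC_add_smul_le (x h : EuclideanSpace ℝ (Fin m)) (ζ : ℂ) :
    lieNormSq (toC x + ζ • toC h) ≤ (‖x‖ + 2 * (‖ζ‖ * ‖h‖)) ^ 2 := by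
  refine (lieNormSq_le _).trans ?_
  have h1 : ∑ i, ((toC x + ζ • toC h) i).re ^ 2 = ‖x + ζ.re • h‖ ^ 2 := by
    rw [EuclideanSpace.real_norm_sq_eq]
    simp [toC]
  have h2 : ∑ i, ((toC x + ζ • toC h) i).im ^ 2 = ‖ζ.im • h‖ ^ 2 := by
    rw [EuclideanSpace.real_norm_sq_eq]
    simp [toC]
  rw [h1, h2, Real.sqrt_sq (norm_nonneg _), Real.sqrt_sq (norm_nonneg _)]
  have h3 : ‖x + ζ.re • h‖ ≤ ‖x‖ + ‖ζ‖ * ‖h‖ := by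
    refine (norm_add_le _ _).trans ?_
    rw [norm_smul]
    gcongr
    exact Complex.abs_re_le_norm ζ
  have h4 : ‖ζ.im • h‖ ≤ ‖ζ‖ * ‖h‖ := by
    rw [norm_smul]
    gcongr
    exact Complex.abs_im_le_norm ζ
  refine pow_le_pow_left₀ (by positivity) ?_ 2
  linarith

section

variable {E : Type*} [NormedAddCommGroup E] [NormedSpace ℂ E] {n : ℕ} {Q : (Fin m → ℂ) → E}

/-- A homogeneous polynomial is bounded by its maximum on the real sphere. -/
theorem IsHom.norm_le_lieNorm (hm : 1 ≤ m) (h : IsHom n Q) {M : ℝ}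
    (hM : ∀ u : UnitSphere m, ‖Q (toC u)‖ ≤ M) (z : Fin m → ℂ) :
    ‖Q z‖ ≤ √(lieNormSq z) ^ n * M := by
  refine norm_le_of_forall_liePoint hm (fun w _ => h.differentiable w) fun p => ?_
  rw [liePoint_eq, h.homog, h.homog, norm_smul, norm_smul, norm_pow, norm_pow,
    Complex.norm_exp_ofReal_mul_I, one_pow, one_mul, Complex.norm_real,
    Real.norm_of_nonneg (Real.sqrt_nonneg _)]
  gcongr
  exact hM p.2

theorem one_add_two_div_pow_le (n : ℕ) : (1 + 2 * (1 / (n + 1 : ℝ))) ^ n ≤ 8 := by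
  have h1 : (1 + 2 * (1 / (n + 1 : ℝ))) ^ n ≤ Real.exp (2 * (1 / (n + 1 : ℝ))) ^ n := by
    gcongr
    linarith [Real.add_one_le_exp (2 * (1 / (n + 1 : ℝ)))]
  have h2 : Real.exp (2 * (1 / (n + 1 : ℝ))) ^ n ≤ Real.exp 2 := by
    rw [← Real.exp_nat_mul]
    refine Real.exp_le_exp.mpr ?_
    have h0 : (0 : ℝ) < n + 1 := by positivity
    rw [show n * (2 * (1 / (n + 1 : ℝ))) = 2 * (n / (n + 1)) by ring]
    have : (n : ℝ) / (n + 1) ≤ 1 := by rw [div_le_one h0]; linarith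
    linarith
  have h3 : Real.exp 2 = Real.exp 1 * Real.exp 1 := by rw [← Real.exp_add]; norm_num
  have h4 := Real.exp_one_lt_d9
  nlinarith [Real.exp_pos 1]

/-- A homogeneous polynomial of degree `n` is at least half of its maximum on the sphere on a ball
of radius comparable with `1 / n`. -/
theorem IsHom.half_le_norm (hm : 1 ≤ m) (h : IsHom n Q) {u : UnitSphere m}
    (hu : ∀ v : UnitSphere m, ‖Q (toC v)‖ ≤ ‖Q (toC u)‖) {x : EuclideanSpace ℝ (Fin m)}
    (hx : ‖x - u‖ ≤ 1 / (20 * (n + 1 : ℝ))) : ‖Q (toC u)‖ / 2 ≤ ‖Q (toC x)‖ := by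
  set M := ‖Q (toC u)‖
  have hM0 : 0 ≤ M := norm_nonneg _
  rcases eq_or_ne x u with rfl | hne
  · linarith
  have hxu : 0 < ‖x - u‖ := norm_pos_iff.mpr (sub_ne_zero.mpr hne)
  set v := x - u
  -- the restriction of `Q` to the complex line through `u` and `x`
  let g : ℂ → E := fun ζ => Q (toC u + ζ • toC v)
  set R : ℝ := 1 / ((n + 1 : ℝ) * ‖v‖)
  have hR : 0 < R := by positivity
  have hg : Differentiable ℂ g := h.differentiable.comp (by fun_prop)
  have hmaps : Set.MapsTo g (Metric.ball 0 R) (Metric.closedBall (g 0) (9 * M)) := by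
    intro ζ hζ
    rw [mem_ball_zero_iff] at hζ
    have h0 : g 0 = Q (toC u) := by simp [g]
    have h1 : ‖g ζ‖ ≤ 8 * M := by
      refine (h.norm_le_lieNorm hm hu _).trans ?_
      gcongr
      refine le_trans ?_ (one_add_two_div_pow_le n)
      gcongr
      refine Real.sqrt_le_iff.mpr ⟨by positivity, (lieNormSq_toC_add_smul_le _ _ _).trans ?_⟩
      have h2 : ‖ζ‖ * ‖v‖ ≤ 1 / (n + 1 : ℝ) := by
        calc ‖ζ‖ * ‖v‖ ≤ R * ‖v‖ := by gcongr
          _ = _ := by simp only [R]; field_simp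
      have h3 : ‖(u : EuclideanSpace ℝ (Fin m))‖ = 1 := by simp
      rw [h3]
      gcongr
    rw [mem_closedBall_iff_norm, h0]
    refine (norm_sub_le _ _).trans ?_
    linarith
  have hR1 : 20 ≤ R := by
    simp only [R]
    rw [le_div_iff₀ (by positivity)]
    have := mul_le_mul_of_nonneg_left hx (by positivity : (0 : ℝ) ≤ 20 * (n + 1))
    rw [mul_one_div_cancel (by positivity)] at this
    linarith
  have hS := Complex.dist_le_div_mul_dist_of_mapsTo_ball hg.differentiableOn hmaps
    (z := 1) (by rw [mem_ball_zero_iff, norm_one]; linarith)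
  have h1 : g 1 = Q (toC x) := by
    simp only [g]
    congr 1
    funext i; simp [toC, v]
  have h0 : g 0 = Q (toC u) := by simp [g]
  rw [h1, h0, dist_zero_right, norm_one, mul_one, dist_comm, dist_eq_norm] at hS
  have h4 : 9 * M / R ≤ M / 2 := by
    rw [div_le_iff₀ hR]
    nlinarith
  have h5 := norm_sub_norm_le (Q (toC u)) (Q (toC x))
  change M - _ ≤ _ at h5
  linarith

/-- The maximum of a homogeneous polynomial on the sphere is bounded by its `L²` norm, up to a
factor which grows polynomially in the degree. -/
theorem exists_norm_sq_le_integral_sphere (hm : 1 ≤ m) :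
    ∃ C : ℝ, 0 < C ∧ ∀ (n : ℕ) (Q : (Fin m → ℂ) → E), IsHom n Q → ∀ v : UnitSphere m,
      ‖Q (toC v)‖ ^ 2 ≤ C * (n + 1) ^ m *
        ∫ u : UnitSphere m, ‖Q (toC u)‖ ^ 2
          ∂(volume : Measure (EuclideanSpace ℝ (Fin m))).toSphere := by
  have : Nontrivial (EuclideanSpace ℝ (Fin m)) :=
    Module.nontrivial_of_finrank_pos (R := ℝ) (by rw [finrank_euclideanSpace_fin]; omega)
  set V : ℝ := (volume : Measure (EuclideanSpace ℝ (Fin m))).real (Metric.ball 0 1)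
  have hV : 0 < V := by
    refine ENNReal.toReal_pos (Metric.measure_ball_pos _ _ one_pos).ne' measure_ball_lt_top.ne
  refine ⟨4 * 40 ^ m / V, by positivity, fun n Q h v => ?_⟩
  have hc : Continuous fun x : EuclideanSpace ℝ (Fin m) => Q (toC x) :=
    h.contDiff.continuous.comp continuous_toC
  obtain ⟨u, -, hu⟩ := isCompact_univ.exists_isMaxOn (s := (Set.univ : Set (UnitSphere m)))
    ⟨v, trivial⟩ (f := fun u : UnitSphere m => ‖Q (toC u)‖)
    (hc.comp continuous_subtype_val).norm.continuousOn
  have hu' : ∀ v : UnitSphere m, ‖Q (toC v)‖ ≤ ‖Q (toC u)‖ := fun v => hu (Set.mem_univ v)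
  have hn1 : ‖(u : EuclideanSpace ℝ (Fin m))‖ = 1 := by simp
  set I := ∫ u : UnitSphere m, ‖Q (toC u)‖ ^ 2
    ∂(volume : Measure (EuclideanSpace ℝ (Fin m))).toSphere with hI
  have hI0 : 0 ≤ I := integral_nonneg fun _ => by positivity
  -- integration over the unit ball
  have hball : ∫ x in Metric.ball (0 : EuclideanSpace ℝ (Fin m)) 1, ‖Q (toC x)‖ ^ 2 ≤ I := by
    have hp := integral_radial_smul_homogeneous (E := EuclideanSpace ℝ (Fin m)) (d := n + n)
      (F := fun x => ‖Q (toC x)‖ ^ 2) (fun c x => by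
        rw [toC_smul, h.homog, norm_smul, norm_pow, Complex.norm_real, mul_pow, Real.norm_eq_abs,
          ← pow_mul, mul_comm n 2, pow_mul, sq_abs, ← pow_mul, two_mul, smul_eq_mul])
      ((Set.Iio (1 : ℝ)).indicator fun _ => 1)
    have h1 : ∫ x in Metric.ball (0 : EuclideanSpace ℝ (Fin m)) 1, ‖Q (toC x)‖ ^ 2 =
        ∫ x : EuclideanSpace ℝ (Fin m),
          (Set.Iio (1 : ℝ)).indicator (fun _ => (1 : ℝ)) ‖x‖ • ‖Q (toC x)‖ ^ 2 := by
      rw [← integral_indicator measurableSet_ball]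
      congr 1; funext x
      by_cases hx : ‖x‖ < 1
      · simp [hx]
      · simp [hx]
    rw [h1, hp, smul_eq_mul]
    refine mul_le_of_le_one_left hI0 ?_
    have h2 : ∀ r : ℝ, r ^ (n + n + (Module.finrank ℝ (EuclideanSpace ℝ (Fin m)) - 1)) *
        (Set.Iio (1 : ℝ)).indicator (fun _ => 1) r = (Set.Iio (1 : ℝ)).indicator
        (fun r => r ^ (n + n + (Module.finrank ℝ (EuclideanSpace ℝ (Fin m)) - 1))) r := fun r => by
      by_cases hr : r < 1 <;> simp [hr]
    simp only [h2]
    rw [setIntegral_indicator measurableSet_Iio, Set.Ioi_inter_Iio]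
    refine (setIntegral_mono_on ?_ (integrableOn_const (by simp) (C := (1 : ℝ)) (by simp))
      measurableSet_Ioo fun r hr => pow_le_one₀ hr.1.le hr.2.le).trans ?_
    · exact (Continuous.integrableOn_Icc (by fun_prop)).mono_set Set.Ioo_subset_Icc_self
    · simp
  set δ : ℝ := 1 / (40 * (n + 1 : ℝ)) with hδ
  have hδ0 : 0 < δ := by positivity
  have hδ1 : δ ≤ 1 := by
    rw [hδ, div_le_one (by positivity)]
    have : (0 : ℝ) ≤ n := n.cast_nonneg
    linarith
  set c : EuclideanSpace ℝ (Fin m) := (1 - δ) • (u : EuclideanSpace ℝ (Fin m))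
  have hcn : ‖c‖ = 1 - δ := by rw [norm_smul, hn1, mul_one, Real.norm_of_nonneg (by linarith)]
  have hsub : Metric.ball c δ ⊆ Metric.ball 0 1 := by
    intro x hx
    rw [mem_ball_iff_norm] at hx
    rw [mem_ball_zero_iff]
    have : ‖x‖ ≤ ‖x - c‖ + ‖c‖ := by simpa using norm_add_le (x - c) c
    linarith
  have hlow : ∀ x ∈ Metric.ball c δ, (‖Q (toC u)‖ / 2) ^ 2 ≤ ‖Q (toC x)‖ ^ 2 := by
    intro x hx
    rw [mem_ball_iff_norm] at hx
    have h1 : ‖x - u‖ ≤ 1 / (20 * (n + 1 : ℝ)) := by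
      have h2 : ‖c - u‖ = δ := by
        have : c - u = (-δ) • (u : EuclideanSpace ℝ (Fin m)) := by simp only [c]; module
        rw [this, norm_smul, hn1, norm_neg, Real.norm_of_nonneg hδ0.le, mul_one]
      have h3 : ‖x - u‖ ≤ ‖x - c‖ + ‖c - u‖ := by simpa using norm_add_le (x - c) (c - u)
      have h4 : 1 / (20 * (n + 1 : ℝ)) = δ + δ := by rw [hδ]; field_simp; norm_num
      linarith
    exact pow_le_pow_left₀ (by positivity) (h.half_le_norm hm hu' h1) 2
  have hint : IntegrableOn (fun x : EuclideanSpace ℝ (Fin m) => ‖Q (toC x)‖ ^ 2)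
      (Metric.ball 0 1) :=
    ((hc.norm.pow 2).continuousOn.integrableOn_compact
      (isCompact_closedBall 0 1)).mono_set Metric.ball_subset_closedBall
  have h1 : (‖Q (toC u)‖ / 2) ^ 2 * (δ ^ m * V) ≤ I := by
    calc (‖Q (toC u)‖ / 2) ^ 2 * (δ ^ m * V)
        = ∫ x in Metric.ball c δ, (‖Q (toC u)‖ / 2) ^ 2 := by
          rw [setIntegral_const, smul_eq_mul, mul_comm, Measure.real,
            Measure.addHaar_ball _ _ hδ0.le]
          simp [V, Measure.real, hδ0.le]
      _ ≤ ∫ x in Metric.ball c δ, ‖Q (toC x)‖ ^ 2 :=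
          setIntegral_mono_on (integrableOn_const measure_ball_lt_top.ne) (hint.mono_set hsub)
            measurableSet_ball hlow
      _ ≤ ∫ x in Metric.ball 0 1, ‖Q (toC x)‖ ^ 2 :=
          setIntegral_mono_set hint (Eventually.of_forall fun _ => by positivity)
            hsub.eventuallyLE
      _ ≤ I := hball
  have h2 : ‖Q (toC u)‖ ^ 2 ≤ 4 * 40 ^ m / V * (n + 1) ^ m * I := by
    have h3 : (δ : ℝ) ^ m = 1 / (40 ^ m * (n + 1) ^ m) := by
      rw [hδ, div_pow, mul_pow, one_pow]
    rw [h3] at h1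
    have hp : (0 : ℝ) < 40 ^ m * (n + 1) ^ m := by positivity
    calc ‖Q (toC u)‖ ^ 2 = 4 * (40 ^ m * (n + 1) ^ m) / V *
          ((‖Q (toC u)‖ / 2) ^ 2 * (1 / (40 ^ m * (n + 1) ^ m) * V)) := by field_simp; ring
      _ ≤ 4 * (40 ^ m * (n + 1) ^ m) / V * I := by gcongr
      _ = _ := by ring
  refine le_trans ?_ h2
  gcongr
  exact hu' v

end

/-! ### Summability of the kernel -/

theorem exists_pow_mul_le (d : ℕ) {L : ℝ} (h0 : 0 ≤ L) (h1 : L < 1) :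
    ∃ ρ C : ℝ, 0 < ρ ∧ ρ < 1 ∧ 0 ≤ C ∧ ∀ n : ℕ, ((n : ℝ) + 1) ^ d * L ^ n ≤ C * ρ ^ n := by
  set L' := (1 + L) / 2 with hL'
  have hL0 : 0 < L' := by rw [hL']; linarith
  have hL1 : L' < 1 := by rw [hL']; linarith
  set ρ := (1 + L') / 2 with hρ
  have hρ0 : 0 < ρ := by rw [hρ]; linarith
  set r := L' / ρ with hr
  have hr0 : 0 < r := by positivity
  have hr1 : r < 1 := by rw [hr, div_lt_one hρ0]; linarith
  have ht := (tendsto_pow_const_mul_const_pow_of_abs_lt_one d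
    (r := r) (by rwa [abs_of_pos hr0])).comp (tendsto_add_atTop_nat 1)
  obtain ⟨B, hB⟩ := ht.bddAbove_range
  refine ⟨ρ, max B 0 / r, hρ0, by linarith, by positivity, fun n => ?_⟩
  have h2 : ((n : ℝ) + 1) ^ d * r ^ (n + 1) ≤ B := by
    have := hB ⟨n, rfl⟩
    simpa using this
  have h3 : ((n : ℝ) + 1) ^ d * r ^ n ≤ max B 0 / r := by
    rw [le_div_iff₀ hr0, mul_assoc, ← pow_succ]
    exact h2.trans (le_max_left _ _)
  calc ((n : ℝ) + 1) ^ d * L ^ n ≤ ((n : ℝ) + 1) ^ d * L' ^ n := by gcongr; linarith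
    _ = (((n : ℝ) + 1) ^ d * r ^ n) * ρ ^ n := by
      rw [mul_assoc, ← mul_pow, hr, div_mul_cancel₀ _ hρ0.ne']
    _ ≤ _ := by gcongr

theorem summable_add_one_pow_mul (d : ℕ) {L : ℝ} (h0 : 0 ≤ L) (h1 : L < 1) :
    Summable fun q : ℕ × ℕ => (((q.1 + q.2 : ℕ) : ℝ) + 1) ^ d * L ^ (q.1 + q.2) := by
  obtain ⟨ρ, C, hρ0, hρ1, hC, h⟩ := exists_pow_mul_le d h0 h1
  have hg := summable_geometric_of_lt_one hρ0.le hρ1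
  have h2 := (hg.mul_of_nonneg hg (fun _ => by positivity) fun _ => by positivity).mul_left C
  refine Summable.of_nonneg_of_le (fun q => by positivity) (fun q => ?_) h2
  rw [← pow_add]
  exact h (q.1 + q.2)

variable {τ : Fin m → ℂ}

theorem lam_mul_integral_sphere (hm : 3 ≤ m) (hτ : IsIso τ) :
    ∃ c : ℝ, 0 ≤ c ∧ ∀ q : ℕ × ℕ, lam m q.1 q.2 * ∫ u : UnitSphere m,
      ‖monoPsi τ q.1 q.2 (toC u)‖ ^ 2
        ∂(volume : Measure (EuclideanSpace ℝ (Fin m))).toSphere = c := by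
  have hpi := Real.pi_pos
  refine ⟨‖(vec τ : Cl m)‖ ^ 2 / (4 * Real.pi), by positivity, fun q => ?_⟩
  have h := smul_sphI_dagger_monoPsi_self hm hτ q.1 q.2
  have h2 := congrArg (fun a : Cl m => a.coord ∅) h
  beta_reduce at h2
  rw [coord_smul, sphI_sharp_mul_self (isHom_monoPsi τ q.1 q.2).contDiff.continuous,
    coord_dagger_mul, inner_self_eq_norm_sq_to_K] at h2
  have h3 : 4 * Real.pi * lam m q.1 q.2 * ∫ u : UnitSphere m, ‖monoPsi τ q.1 q.2 (toC u)‖ ^ 2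
      ∂(volume : Measure (EuclideanSpace ℝ (Fin m))).toSphere = ‖(vec τ : Cl m)‖ ^ 2 := by
    refine Complex.ofReal_injective ?_
    simp only [Complex.ofReal_mul, Complex.ofReal_pow, Complex.ofReal_ofNat]
    exact h2
  rw [eq_div_iff (by positivity), ← h3]
  ring

/-- Uniform bound for the normalized generators. -/
theorem exists_lam_mul_norm_gen_sq_le (hm : 3 ≤ m) (hτ : IsIso τ) (j : ℕ) :
    ∃ C : ℝ, 0 ≤ C ∧ ∀ (q : ℕ × ℕ) (z : Fin m → ℂ), lam m q.1 q.2 * ‖gen τ j q z‖ ^ 2 ≤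
      C * (((q.1 + q.2 : ℕ) : ℝ) + 1) ^ m * lieNormSq z ^ (j + (q.1 + q.2)) := by
  have hm1 : 1 ≤ m := by omega
  obtain ⟨C, hC, hb⟩ := exists_norm_sq_le_integral_sphere (E := Cl m) hm1
  obtain ⟨c, hc, hi⟩ := lam_mul_integral_sphere hm hτ
  obtain ⟨B, hB⟩ := (isCompact_univ (X := UnitSphere m)).exists_bound_of_continuousOn
    (f := fun u : UnitSphere m => (vec (toC (u : EuclideanSpace ℝ (Fin m))) : Cl m) ^ j) (by
      have := (contDiff_vec_pow (m := m) j).continuous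
      exact (this.comp (continuous_toC.comp continuous_subtype_val)).continuousOn)
  refine ⟨(‖mulL m‖ * max B 0) ^ 2 * (C * c), by positivity, fun q z => ?_⟩
  have hl := lam_pos hm q.1 q.2
  set n := q.1 + q.2
  set I := ∫ u : UnitSphere m, ‖monoPsi τ q.1 q.2 (toC u)‖ ^ 2
    ∂(volume : Measure (EuclideanSpace ℝ (Fin m))).toSphere
  have hI : 0 ≤ I := integral_nonneg fun _ => by positivity
  have h1 : ∀ u : UnitSphere m, ‖gen τ j q (toC u)‖ ≤
      ‖mulL m‖ * max B 0 * √(C * (n + 1) ^ m * I) := fun u => by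
    refine (norm_mul_le_mulL _ _).trans ?_
    gcongr
    · exact (hB u (Set.mem_univ u)).trans (le_max_left _ _)
    · exact Real.le_sqrt_of_sq_le (hb n _ (isHom_monoPsi τ q.1 q.2) u)
  have h2 := (isHom_gen τ j q).norm_le_lieNorm hm1 h1 z
  calc lam m q.1 q.2 * ‖gen τ j q z‖ ^ 2
      ≤ lam m q.1 q.2 * (√(lieNormSq z) ^ (j + n) *
        (‖mulL m‖ * max B 0 * √(C * (n + 1) ^ m * I))) ^ 2 := by gcongr
    _ = lam m q.1 q.2 * (lieNormSq z ^ (j + n) *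
        ((‖mulL m‖ * max B 0) ^ 2 * (C * (n + 1) ^ m * I))) := by
      rw [mul_pow, mul_pow _ √_, Real.sq_sqrt (by positivity), ← pow_mul, mul_comm (j + n) 2,
        pow_mul, Real.sq_sqrt (lieNormSq_nonneg z)]
    _ = (‖mulL m‖ * max B 0) ^ 2 * (C * (lam m q.1 q.2 * I)) * (n + 1) ^ m *
        lieNormSq z ^ (j + n) := by ring
    _ = _ := by rw [hi q]

/-- The terms of the kernel are dominated, uniformly on the Lie sphere, by a summable sequence. -/
theorem exists_lam_mul_norm_gen_mul_le (hm : 3 ≤ m) (hτ : IsIso τ) (j : ℕ) :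
    ∃ C : ℝ, 0 ≤ C ∧ ∀ (q : ℕ × ℕ) (z : Fin m → ℂ) (p : ℝ × UnitSphere m), lieNormSq z ≤ 1 →
      lam m q.1 q.2 * (‖gen τ j q z‖ * ‖gen τ j q (liePoint p)‖) ≤
      C * ((((q.1 + q.2 : ℕ) : ℝ) + 1) ^ m * √(lieNormSq z) ^ (q.1 + q.2)) := by
  obtain ⟨C, hC, h⟩ := exists_lam_mul_norm_gen_sq_le hm hτ j
  refine ⟨C, hC, fun q z p hz => ?_⟩
  have hl := lam_pos hm q.1 q.2
  have hL := lieNormSq_nonneg z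
  set n := q.1 + q.2
  set L := lieNormSq z
  have h1 := h q z
  have h2 := h q (liePoint p)
  rw [lieNormSq_liePoint, one_pow, mul_one] at h2
  have h3 : L ^ (j + n) ≤ L ^ n := pow_le_pow_of_le_one hL hz (by omega)
  have h4 : (lam m q.1 q.2 * (‖gen τ j q z‖ * ‖gen τ j q (liePoint p)‖)) ^ 2 ≤
      (C * ((n + 1) ^ m * √L ^ n)) ^ 2 := by
    calc _ = (lam m q.1 q.2 * ‖gen τ j q z‖ ^ 2) *
        (lam m q.1 q.2 * ‖gen τ j q (liePoint p)‖ ^ 2) := by ring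
      _ ≤ (C * (n + 1) ^ m * L ^ n) * (C * (n + 1) ^ m) := by
        exact mul_le_mul (h1.trans (by gcongr)) h2 (by positivity) (by positivity)
      _ = _ := by
        rw [mul_pow, mul_pow, ← pow_mul (√L), mul_comm n 2, pow_mul, Real.sq_sqrt hL]
        ring
  exact (sq_le_sq₀ (by positivity) (by positivity)).mp h4

theorem sqrt_lieNormSq_lt_one {z : Fin m → ℂ} (hz : z ∈ lieBall m) : √(lieNormSq z) < 1 := by
  rw [Real.sqrt_lt' one_pos, one_pow]
  exact hz

theorem summable_kernelTerm (hm : 3 ≤ m) (hτ : IsIso τ) {z : Fin m → ℂ} (hz : z ∈ lieBall m)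
    (p : ℝ × UnitSphere m) :
    Summable fun q : ℕ × ℕ => kernelTerm τ q.1 q.2 z (star (liePoint p)) := by
  obtain ⟨C, hC, h⟩ := exists_lam_mul_norm_gen_mul_le hm hτ 0
  have hs := (summable_add_one_pow_mul m (Real.sqrt_nonneg (lieNormSq z))
    (sqrt_lieNormSq_lt_one hz)).mul_left (‖mulL m‖ * C)
  refine Summable.of_norm_bounded hs fun q => ?_
  have h1 := h q z p (le_of_lt hz)
  have hl := lam_pos hm q.1 q.2
  have e : ∀ z, Mpsi τ q.1 q.2 z = gen τ 0 q z := fun z => by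
    rw [Mpsi_eq (by omega) hτ, gen, pow_zero, one_mul]
  rw [kernelTerm, star_star, norm_smul, Complex.norm_real, Real.norm_of_nonneg hl.le, e, e]
  calc _ ≤ lam m q.1 q.2 * (‖mulL m‖ * ‖gen τ 0 q z‖ * ‖dagger (gen τ 0 q (liePoint p))‖) := by
        gcongr
        exact norm_mul_le_mulL _ _
    _ = ‖mulL m‖ * (lam m q.1 q.2 * (‖gen τ 0 q z‖ * ‖gen τ 0 q (liePoint p)‖)) := by
        rw [norm_dagger]; ring
    _ ≤ ‖mulL m‖ * (C * _) := by gcongr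
    _ = _ := by ring

end

section

variable {m : ℕ}

/-! ### Boundary values -/

instance : IsFiniteMeasure (lieMeasure m) := by unfold lieMeasure; infer_instance

theorem measurePreserving_neg_sphere :
    MeasurePreserving (fun u : UnitSphere m => -u)
      (volume : Measure (EuclideanSpace ℝ (Fin m))).toSphere
      (volume : Measure (EuclideanSpace ℝ (Fin m))).toSphere := by
  refine ⟨continuous_neg.measurable, Measure.ext fun s hs => ?_⟩
  rw [Measure.map_apply continuous_neg.measurable hs, Measure.toSphere_apply' _ hs,
    Measure.toSphere_apply' _ (continuous_neg.measurable hs)]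
  congr 1
  rw [← Measure.measure_neg]
  congr 1
  ext x
  simp only [Set.mem_neg, Set.mem_smul, Set.mem_image, Set.mem_preimage]
  constructor
  · rintro ⟨r, hr, _, ⟨u, hu, rfl⟩, h⟩
    exact ⟨r, hr, _, ⟨-u, hu, rfl⟩, by rw [coe_neg_sphere, smul_neg, h, neg_neg]⟩
  · rintro ⟨r, hr, _, ⟨u, hu, rfl⟩, h⟩
    exact ⟨r, hr, _, ⟨-u, by simpa using hu, rfl⟩, by rw [coe_neg_sphere, smul_neg, h]⟩

section

variable {E : Type*} [NormedAddCommGroup E]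

theorem continuous_comp_smul_liePoint {f : (Fin m → ℂ) → E} (hf : ContinuousOn f (lieBall m))
    {c : ℂ} (hc : ‖c‖ < 1) : Continuous fun p : ℝ × UnitSphere m => f (c • liePoint p) :=
  hf.comp_continuous (continuous_liePoint.const_smul c) fun p => smul_liePoint_mem hc p

theorem eventually_norm_lt_one : ∀ᶠ r : ℝ in 𝓝[<] 1, 0 < r ∧ r < 1 ∧ ‖(r : ℂ)‖ < 1 := by
  filter_upwards [Ioo_mem_nhdsLT (show (0 : ℝ) < 1 by norm_num)] with r hr
  refine ⟨hr.1, hr.2, ?_⟩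
  rw [Complex.norm_real, Real.norm_of_nonneg hr.1.le]
  exact hr.2

end

theorem IsBoundaryValue.ae_eq {f : (Fin m → ℂ) → Cl m} {g g' : ℝ × UnitSphere m → Cl m}
    (hf : DifferentiableOn ℂ f (lieBall m)) (h : IsBoundaryValue f g)
    (h' : IsBoundaryValue f g') : g =ᵐ[lieMeasure m] g' := by
  have h1 : eLpNorm (g - g') 2 (lieMeasure m) = 0 := by
    have hlim := h'.2.add h.2
    rw [add_zero] at hlim
    refine le_antisymm (ge_of_tendsto hlim ?_) zero_le
    filter_upwards [eventually_norm_lt_one] with r hr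
    have hm := (continuous_comp_smul_liePoint hf.continuousOn hr.2.2).aestronglyMeasurable
      (μ := lieMeasure m)
    refine le_trans (le_of_eq ?_) (eLpNorm_sub_le (hm.sub h'.1.1) (hm.sub h.1.1) (by norm_num))
    congr 1
    funext p
    simp
  rw [eLpNorm_eq_zero_iff (h.1.1.sub h'.1.1) (by norm_num)] at h1
  filter_upwards [h1] with p hp
  exact sub_eq_zero.mp hp

theorem IsBoundaryValue.sub {f f' : (Fin m → ℂ) → Cl m} {g g' : ℝ × UnitSphere m → Cl m}
    (hf : DifferentiableOn ℂ f (lieBall m)) (hf' : DifferentiableOn ℂ f' (lieBall m))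
    (h : IsBoundaryValue f g) (h' : IsBoundaryValue f' g') :
    IsBoundaryValue (f - f') (g - g') := by
  refine ⟨h.1.sub h'.1, ?_⟩
  have hlim := h.2.add h'.2
  rw [add_zero] at hlim
  refine tendsto_of_tendsto_of_tendsto_of_le_of_le' tendsto_const_nhds hlim
    (Eventually.of_forall fun _ => zero_le) ?_
  filter_upwards [eventually_norm_lt_one] with r hr
  have hm := (continuous_comp_smul_liePoint hf.continuousOn hr.2.2).aestronglyMeasurable
    (μ := lieMeasure m)
  have hm' := (continuous_comp_smul_liePoint hf'.continuousOn hr.2.2).aestronglyMeasurable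
    (μ := lieMeasure m)
  refine le_trans (le_of_eq ?_) (eLpNorm_sub_le (hm.sub h.1.1) (hm'.sub h'.1.1) (by norm_num))
  congr 1
  funext p
  simp only [Pi.sub_apply]
  abel

theorem MemOL2.isBoundaryValue {f : (Fin m → ℂ) → Cl m} (hf : MemOL2 f) :
    IsBoundaryValue f (bdry f) := by
  rw [bdry, dif_pos hf.2]
  exact hf.2.choose_spec

theorem MemOL2.memLp {f : (Fin m → ℂ) → Cl m} (hf : MemOL2 f) :
    MemLp (bdry f) 2 (lieMeasure m) := hf.isBoundaryValue.1

theorem MemOL2.of_isBoundaryValue {f : (Fin m → ℂ) → Cl m} {g : ℝ × UnitSphere m → Cl m}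
    (hf : DifferentiableOn ℂ f (lieBall m)) (h : IsBoundaryValue f g) :
    MemOL2 f ∧ bdry f =ᵐ[lieMeasure m] g :=
  have hM : MemOL2 f := ⟨hf, g, h⟩
  ⟨hM, IsBoundaryValue.ae_eq hf hM.isBoundaryValue h⟩

theorem MemOL2.sub {f f' : (Fin m → ℂ) → Cl m} (hf : MemOL2 f) (hf' : MemOL2 f') :
    MemOL2 (f - f') ∧ bdry (f - f') =ᵐ[lieMeasure m] bdry f - bdry f' :=
  MemOL2.of_isBoundaryValue (hf.1.sub hf'.1)
    (hf.isBoundaryValue.sub hf.1 hf'.1 hf'.isBoundaryValue)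

theorem norm_liePoint_le (p : ℝ × UnitSphere m) : ‖liePoint p‖ ≤ 1 := by
  refine (pi_norm_le_iff_of_nonneg zero_le_one).mpr fun i => ?_
  have h1 : ‖(p.2 : EuclideanSpace ℝ (Fin m)) i‖ ≤ ‖(p.2 : EuclideanSpace ℝ (Fin m))‖ :=
    PiLp.norm_apply_le _ i
  have h2 : ‖(p.2 : EuclideanSpace ℝ (Fin m))‖ = 1 := by simp
  rw [liePoint, norm_mul, Complex.norm_exp_ofReal_mul_I, one_mul, Complex.norm_real]
  exact h1.trans h2.le

/-- A function which is continuous on all of `ℂ^m` is its own boundary value. -/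
theorem isBoundaryValue_of_continuous {F : (Fin m → ℂ) → Cl m} (hF : Continuous F) :
    IsBoundaryValue F fun p => F (liePoint p) := by
  have hK : IsCompact (Metric.closedBall (0 : Fin m → ℂ) 1) := isCompact_closedBall 0 1
  have hmem : ∀ p : ℝ × UnitSphere m, liePoint p ∈ Metric.closedBall (0 : Fin m → ℂ) 1 :=
    fun p => by simpa using norm_liePoint_le p
  obtain ⟨B, hB⟩ := hK.exists_bound_of_continuousOn hF.continuousOn
  refine ⟨MemLp.of_bound (hF.comp continuous_liePoint).aestronglyMeasurable B
    (Eventually.of_forall fun p => hB _ (hmem p)), ?_⟩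
  set M := lieMeasure m Set.univ ^ (2 : ENNReal).toReal⁻¹ with hM
  have hMtop : M ≠ ⊤ := by finiteness
  have hu := hK.uniformContinuousOn_of_continuous hF.continuousOn
  have key : Tendsto (fun r : ℝ => sSup (Set.range fun p : ℝ × UnitSphere m =>
      ‖F ((r : ℂ) • liePoint p) - F (liePoint p)‖)) (𝓝[<] 1) (𝓝 0) := by
    rw [Metric.tendsto_nhds]
    intro ε hε
    rw [Metric.uniformContinuousOn_iff] at hu
    obtain ⟨δ, hδ, h⟩ := hu (ε / 2) (by positivity)
    filter_upwards [eventually_norm_lt_one, Ioo_mem_nhdsLT (show 1 - δ < 1 by linarith)]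
      with r hr hr2
    have hle : sSup (Set.range fun p : ℝ × UnitSphere m =>
        ‖F ((r : ℂ) • liePoint p) - F (liePoint p)‖) ≤ ε / 2 := by
      refine Real.sSup_le ?_ (by positivity)
      rintro _ ⟨p, rfl⟩
      change ‖_ - _‖ ≤ _
      rw [← dist_eq_norm]
      refine (h _ ?_ _ (hmem p) ?_).le
      · rw [mem_closedBall_zero_iff, norm_smul]
        exact mul_le_one₀ hr.2.2.le (norm_nonneg _) (norm_liePoint_le p)
      · rw [dist_eq_norm]
        have : (r : ℂ) • liePoint p - liePoint p = ((r - 1 : ℝ) : ℂ) • liePoint p := by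
          push_cast; module
        rw [this, norm_smul, Complex.norm_real, Real.norm_eq_abs, abs_of_neg (by linarith)]
        have := norm_liePoint_le p
        nlinarith [hr2.1, norm_nonneg (liePoint p)]
    have h0 : 0 ≤ sSup (Set.range fun p : ℝ × UnitSphere m =>
        ‖F ((r : ℂ) • liePoint p) - F (liePoint p)‖) := by
      refine Real.sSup_nonneg ?_
      rintro _ ⟨p, rfl⟩
      exact norm_nonneg _
    rw [Real.dist_eq, sub_zero, abs_of_nonneg h0]
    linarith
  have key2 := ENNReal.Tendsto.const_mul (ENNReal.tendsto_ofReal key) (Or.inr hMtop)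
  rw [ENNReal.ofReal_zero, mul_zero] at key2
  refine tendsto_of_tendsto_of_tendsto_of_le_of_le' tendsto_const_nhds key2
    (Eventually.of_forall fun _ => zero_le) ?_
  filter_upwards [eventually_norm_lt_one] with r hr
  refine eLpNorm_le_of_ae_bound (Eventually.of_forall fun p => ?_)
  refine le_csSup ⟨B + B, ?_⟩ ⟨p, rfl⟩
  rintro _ ⟨p, rfl⟩
  refine (norm_sub_le _ _).trans (add_le_add (hB _ ?_) (hB _ (hmem p)))
  rw [mem_closedBall_zero_iff, norm_smul]
  exact mul_le_one₀ hr.2.2.le (norm_nonneg _) (norm_liePoint_le p)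

theorem memOL2_of_differentiable {F : (Fin m → ℂ) → Cl m} (hF : Differentiable ℂ F) :
    MemOL2 F ∧ bdry F =ᵐ[lieMeasure m] fun p => F (liePoint p) :=
  MemOL2.of_isBoundaryValue hF.differentiableOn (isBoundaryValue_of_continuous hF.continuous)

/-! ### Uniqueness -/

/-- Cauchy's formula on a circle, as an estimate by the `L¹` norm. -/
theorem enorm_le_lintegral_circle {E : Type*} [NormedAddCommGroup E] [NormedSpace ℂ E]
    [CompleteSpace E] {k : ℂ → E} {w : ℂ} {ρ r : ℝ}
    (hw : ‖w‖ < ρ) (hρ : ρ < r) (hr : r < 1) (hk : DifferentiableOn ℂ k (Metric.ball 0 1)) :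
    ‖k w‖ₑ ≤ ENNReal.ofReal (1 / (ρ - ‖w‖)) *
      ∫⁻ θ in Set.Ioc 0 (2 * Real.pi), ‖k (r * Complex.exp (θ * Complex.I))‖ₑ := by
  have hw0 := norm_nonneg w
  have hr0 : 0 < r := by linarith
  have hd : DifferentiableOn ℂ k (Metric.closedBall 0 r) :=
    hk.mono (Metric.closedBall_subset_ball hr)
  have hC := (hd.mono (closure_ball (0 : ℂ) hr0.ne').le).diffContOnCl.circleIntegral_sub_inv_smul
    (w := w) (by rw [mem_ball_zero_iff]; linarith)
  have h1 : ‖(2 * Real.pi * Complex.I : ℂ) • k w‖ₑ ≤ ∫⁻ θ in Set.Ioc 0 (2 * Real.pi),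
      ENNReal.ofReal (1 / (ρ - ‖w‖)) * ‖k (r * Complex.exp (θ * Complex.I))‖ₑ := by
    rw [← hC, circleIntegral, intervalIntegral.integral_of_le Real.two_pi_pos.le]
    refine (enorm_integral_le_lintegral_enorm _).trans (lintegral_mono fun θ => ?_)
    rw [deriv_circleMap, enorm_smul, enorm_smul, ← mul_assoc]
    have e : circleMap 0 r θ = r * Complex.exp (θ * Complex.I) := by simp [circleMap]
    have hn : ‖(r * Complex.exp (θ * Complex.I) : ℂ)‖ = r := by
      rw [norm_mul, Complex.norm_exp_ofReal_mul_I, Complex.norm_real, Real.norm_of_nonneg hr0.le,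
        mul_one]
    rw [e]
    gcongr
    rw [← enorm_mul, ← ofReal_norm]
    refine ENNReal.ofReal_le_ofReal ?_
    rw [norm_mul, norm_mul, Complex.norm_I, mul_one, hn, norm_inv, ← div_eq_mul_inv]
    have h2 := norm_sub_norm_le (r * Complex.exp (θ * Complex.I) : ℂ) w
    rw [hn] at h2
    exact div_le_div₀ zero_le_one hr.le (by linarith) (by linarith)
  rw [lintegral_const_mul' _ _ ENNReal.ofReal_ne_top] at h1
  refine le_trans ?_ h1
  rw [enorm_smul]
  refine le_mul_of_one_le_left' ?_
  rw [← ofReal_norm]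
  refine ENNReal.one_le_ofReal.mpr ?_
  simp only [norm_mul, Complex.norm_I, Complex.norm_real, Complex.norm_ofNat, mul_one,
    Real.norm_of_nonneg Real.pi_pos.le]
  linarith [Real.pi_gt_three]

theorem liePoint_add_pi (θ : ℝ) (u : UnitSphere m) : liePoint (θ + Real.pi, u) = liePoint (θ, -u) := by
  funext i
  simp [liePoint, add_mul, Complex.exp_add, Complex.exp_pi_mul_I]

/-- As `e^{i(θ+π)} ω = e^{iθ} (-ω)`, the angles in `(0, 2π]` cover the Lie sphere twice. -/
theorem lintegral_circle_sphere {Φ : (Fin m → ℂ) → ENNReal}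
    (hΦ : Measurable fun p : ℝ × UnitSphere m => Φ (liePoint p)) :
    ∫⁻ u, (∫⁻ θ in Set.Ioc 0 (2 * Real.pi), Φ (liePoint (θ, u)))
      ∂(volume : Measure (EuclideanSpace ℝ (Fin m))).toSphere =
      2 * ∫⁻ p, Φ (liePoint p) ∂lieMeasure m := by
  set σ := (volume : Measure (EuclideanSpace ℝ (Fin m))).toSphere
  have hpi := Real.pi_pos
  have h1 : ∀ u : UnitSphere m, ∫⁻ θ in Set.Ioc 0 (2 * Real.pi), Φ (liePoint (θ, u)) =
      (∫⁻ θ in Set.Ico 0 Real.pi, Φ (liePoint (θ, u))) +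
        ∫⁻ θ in Set.Ico 0 Real.pi, Φ (liePoint (θ, -u)) := by
    intro u
    rw [setLIntegral_congr Ico_ae_eq_Ioc.symm,
      ← Set.Ico_union_Ico_eq_Ico hpi.le (by linarith : Real.pi ≤ 2 * Real.pi),
      lintegral_union measurableSet_Ico (Set.Ico_disjoint_Ico_same)]
    congr 1
    have h2 := (measurePreserving_add_right (volume : Measure ℝ) Real.pi).setLIntegral_comp_preimage_emb
      (MeasurableEquiv.addRight Real.pi).measurableEmbedding (fun θ => Φ (liePoint (θ, u)))
      (Set.Ico Real.pi (2 * Real.pi))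
    rw [← h2]
    have h3 : (fun x => x + Real.pi) ⁻¹' Set.Ico Real.pi (2 * Real.pi) = Set.Ico 0 Real.pi := by
      rw [Set.preimage_add_const_Ico, sub_self]
      congr 1; ring
    rw [h3]
    simp only [liePoint_add_pi]
  have hA : Measurable fun u : UnitSphere m => ∫⁻ θ in Set.Ico 0 Real.pi, Φ (liePoint (θ, u)) :=
    hΦ.lintegral_prod_left'
  simp only [h1]
  rw [lintegral_add_left hA, measurePreserving_neg_sphere.lintegral_comp hA, two_mul, lieMeasure,
    lintegral_prod_symm' _ hΦ]

/-- A function in `OL²(LB(0,1))` is determined by its boundary value. -/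
theorem eq_zero_of_bdry_ae_eq_zero (hm : 1 ≤ m) {h : (Fin m → ℂ) → Cl m} (hh : MemOL2 h)
    (h0 : bdry h =ᵐ[lieMeasure m] 0) {z : Fin m → ℂ} (hz : z ∈ lieBall m) : h z = 0 := by
  set σ := (volume : Measure (EuclideanSpace ℝ (Fin m))).toSphere with hσ
  have hlim : Tendsto (fun r : ℝ => eLpNorm (fun p => h ((r : ℂ) • liePoint p)) 2 (lieMeasure m))
      (𝓝[<] 1) (𝓝 0) := by
    refine hh.isBoundaryValue.2.congr fun r => eLpNorm_congr_ae ?_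
    filter_upwards [h0] with p hp
    rw [hp]; simp
  have key : ∀ w : ℂ, ‖w‖ < 1 → ∀ u : UnitSphere m, h (w • toC u) = 0 := by
    intro w hw
    have hcont : Continuous fun u : UnitSphere m => h (w • toC u) := by
      have := (continuous_comp_smul_liePoint hh.1.continuousOn hw).comp
        (Continuous.prodMk_right (0 : ℝ) (Y := UnitSphere m))
      refine this.congr fun u => ?_
      simp [liePoint_eq]
    set ρ := (1 + ‖w‖) / 2 with hρ
    set C := ENNReal.ofReal (1 / (ρ - ‖w‖))
    set c := lieMeasure m Set.univ ^ (1 / (1 : ENNReal).toReal - 1 / (2 : ENNReal).toReal)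
    have hc : c ≠ ⊤ := by
      refine ENNReal.rpow_ne_top_of_nonneg ?_ (measure_ne_top _ _)
      norm_num
    have hz : ∫⁻ u : UnitSphere m, ‖h (w • toC u)‖ₑ ∂σ = 0 := by
      have hlim2 := ENNReal.Tendsto.const_mul
        (ENNReal.Tendsto.const_mul (ENNReal.Tendsto.mul_const hlim (Or.inr hc))
          (Or.inr (ENNReal.ofNat_ne_top (n := 2)))) (Or.inr (ENNReal.ofReal_ne_top (r := 1 / (ρ - ‖w‖))))
      rw [zero_mul, mul_zero, mul_zero] at hlim2
      refine le_antisymm (ge_of_tendsto hlim2 ?_) zero_le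
      filter_upwards [eventually_norm_lt_one,
        Ioo_mem_nhdsLT (show ρ < 1 by rw [hρ]; linarith)] with r hr hr2
      have hcr := continuous_comp_smul_liePoint hh.1.continuousOn hr.2.2
      calc ∫⁻ u : UnitSphere m, ‖h (w • toC u)‖ₑ ∂σ
          ≤ ∫⁻ u : UnitSphere m, C * (∫⁻ θ in Set.Ioc 0 (2 * Real.pi),
            ‖h ((r : ℂ) • liePoint (θ, u))‖ₑ) ∂σ := by
            refine lintegral_mono fun u => ?_
            have hk : DifferentiableOn ℂ (fun ζ : ℂ => h (ζ • toC (u : EuclideanSpace ℝ (Fin m))))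
                (Metric.ball 0 1) := by
              refine hh.1.comp (by fun_prop) fun ζ hζ => ?_
              have := smul_liePoint_mem (m := m) (mem_ball_zero_iff.mp hζ) (0, u)
              simpa [liePoint_eq] using this
            have := enorm_le_lintegral_circle (w := w) (ρ := ρ) (by rw [hρ]; linarith) hr2.1 hr2.2 hk
            simpa only [liePoint_eq, smul_smul] using this
        _ = C * (2 * eLpNorm (fun p => h ((r : ℂ) • liePoint p)) 1 (lieMeasure m)) := by
            rw [lintegral_const_mul' _ _ ENNReal.ofReal_ne_top,
              lintegral_circle_sphere (Φ := fun z => ‖h ((r : ℂ) • z)‖ₑ) hcr.enorm.measurable,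
              eLpNorm_one_eq_lintegral_enorm]
        _ ≤ _ := by
            gcongr
            exact eLpNorm_le_eLpNorm_mul_rpow_measure_univ (by norm_num)
              hcr.aestronglyMeasurable
    rw [lintegral_eq_zero_iff hcont.enorm.measurable] at hz
    have hz2 : (fun u : UnitSphere m => h (w • toC u)) =ᵐ[σ] fun _ => 0 := by
      filter_upwards [hz] with u hu
      simpa using hu
    rw [hcont.ae_eq_iff_eq _ continuous_const] at hz2
    exact fun u => congrFun hz2 u
  have hn : ‖h z‖ ≤ 0 := by
    refine norm_le_of_forall_liePoint hm (fun w hw => ?_) fun p => ?_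
    · refine hh.1.differentiableAt (isOpen_lieBall.mem_nhds ?_)
      change lieNormSq w < 1
      rw [hw]; exact hz
    · rw [liePoint_eq, smul_smul, key _ _ p.2, norm_zero]
      rw [norm_mul, Complex.norm_exp_ofReal_mul_I, mul_one, Complex.norm_real,
        Real.norm_of_nonneg (Real.sqrt_nonneg _)]
      exact sqrt_lieNormSq_lt_one hz
  exact norm_le_zero_iff.mp hn

end

section

variable {m : ℕ}

/-! ### Orthogonal series in a Hilbert space -/

section Hilbert

variable {H ι : Type*} [NormedAddCommGroup H] [InnerProductSpace ℂ H] {v : ι → H}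

theorem norm_sq_sum_of_orthogonal (hv : ∀ i j, i ≠ j → inner ℂ (v i) (v j) = 0) (s : Finset ι) :
    ‖∑ i ∈ s, v i‖ ^ 2 = ∑ i ∈ s, ‖v i‖ ^ 2 := by
  classical
  have h : ((‖∑ i ∈ s, v i‖ ^ 2 : ℝ) : ℂ) = ((∑ i ∈ s, ‖v i‖ ^ 2 : ℝ) : ℂ) := by
    push_cast
    have h1 : ∀ x : H, (‖x‖ : ℂ) ^ 2 = inner ℂ x x := fun x => (inner_self_eq_norm_sq_to_K x).symm
    simp only [h1]
    rw [sum_inner]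
    refine Finset.sum_congr rfl fun i hi => ?_
    rw [inner_sum, Finset.sum_eq_single i (fun j _ hj => hv i j hj.symm) (fun h => absurd hi h)]
  exact_mod_cast h

/-- Bessel's inequality for the components of a vector. -/
theorem summable_norm_sq_of_inner_eq (hv : ∀ i j, i ≠ j → inner ℂ (v i) (v j) = 0) {x : H}
    (hx : ∀ i, inner ℂ (v i) x = inner ℂ (v i) (v i)) : Summable fun i => ‖v i‖ ^ 2 := by
  refine summable_of_sum_le (c := ‖x‖ ^ 2) (fun i => by positivity) fun s => ?_
  rw [← norm_sq_sum_of_orthogonal hv]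
  set y := ∑ i ∈ s, v i with hy
  have h1 : inner ℂ y x = inner ℂ y y := by
    have h2 : ((‖y‖ ^ 2 : ℝ) : ℂ) = ((∑ i ∈ s, ‖v i‖ ^ 2 : ℝ) : ℂ) := by
      rw [hy, norm_sq_sum_of_orthogonal hv]
    rw [inner_self_eq_norm_sq_to_K]
    refine Eq.trans ?_ ((Complex.ofReal_pow _ _).symm.trans h2).symm
    rw [hy, sum_inner, Complex.ofReal_sum]
    refine Finset.sum_congr rfl fun i _ => ?_
    rw [hx, inner_self_eq_norm_sq_to_K, Complex.ofReal_pow]; rfl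
  have h3 : ‖y‖ ^ 2 ≤ ‖y‖ * ‖x‖ := by
    have := norm_inner_le_norm (𝕜 := ℂ) y x
    rwa [h1, inner_self_eq_norm_sq_to_K, norm_pow, RCLike.norm_ofReal,
      abs_of_nonneg (norm_nonneg y)] at this
  have h4 : ‖y‖ ≤ ‖x‖ := by
    rcases (norm_nonneg y).eq_or_lt with h0 | h0
    · rw [← h0]; exact norm_nonneg x
    · exact le_of_mul_le_mul_left (by rwa [← sq]) h0
  gcongr

variable [CompleteSpace H]

theorem summable_of_orthogonal (hv : ∀ i j, i ≠ j → inner ℂ (v i) (v j) = 0)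
    (hs : Summable fun i => ‖v i‖ ^ 2) : Summable v := by
  rw [summable_iff_cauchySeq_finset, cauchySeq_finset_iff_vanishing_norm]
  intro ε hε
  obtain ⟨s, h⟩ := (summable_iff_vanishing_norm.mp hs) (ε ^ 2) (by positivity)
  refine ⟨s, fun t ht => ?_⟩
  have h1 := h t ht
  rw [← norm_sq_sum_of_orthogonal hv, Real.norm_of_nonneg (by positivity)] at h1
  exact lt_of_pow_lt_pow_left₀ 2 hε.le h1

theorem norm_sq_tsum_of_orthogonal (hv : ∀ i j, i ≠ j → inner ℂ (v i) (v j) = 0)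
    (hs : Summable fun i => ‖v i‖ ^ 2) : ‖∑' i, v i‖ ^ 2 = ∑' i, ‖v i‖ ^ 2 := by
  have h1 := ((summable_of_orthogonal hv hs).hasSum.norm.pow 2)
  refine tendsto_nhds_unique h1 ?_
  have h2 := hs.hasSum
  refine h2.congr fun s => ?_
  exact (norm_sq_sum_of_orthogonal hv s).symm

/-- Abel summation of an orthogonal series. -/
theorem tendsto_tsum_pow_smul (hv : ∀ i j, i ≠ j → inner ℂ (v i) (v j) = 0)
    (hs : Summable fun i => ‖v i‖ ^ 2) (d : ι → ℕ) :
    Tendsto (fun r : ℝ => ∑' i, ((r : ℂ) ^ d i) • v i) (𝓝[<] 1) (𝓝 (∑' i, v i)) := by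
  have hortho : ∀ a : ι → ℂ, ∀ i j, i ≠ j → inner ℂ (a i • v i) (a j • v j) = 0 := by
    intro a i j hij
    rw [inner_smul_left, inner_smul_right, hv i j hij]; simp
  have hsum : ∀ a : ι → ℂ, (∀ i, ‖a i‖ ≤ 1) → Summable fun i => ‖a i • v i‖ ^ 2 := by
    intro a ha
    refine Summable.of_nonneg_of_le (fun i => by positivity) (fun i => ?_) hs
    rw [norm_smul, mul_pow]
    exact mul_le_of_le_one_left (by positivity) (pow_le_one₀ (norm_nonneg _) (ha i))
  have hnorm : ∀ r : ℝ, 0 < r → r < 1 → ∀ i, ‖((r : ℂ) ^ d i)‖ ≤ 1 ∧ ‖((r : ℂ) ^ d i - 1)‖ ≤ 1 := by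
    intro r h0 h1 i
    have h2 : 0 ≤ r ^ d i := by positivity
    have h3 : r ^ d i ≤ 1 := pow_le_one₀ h0.le h1.le
    constructor
    · rw [← Complex.ofReal_pow, Complex.norm_real, Real.norm_of_nonneg h2]; exact h3
    · rw [← Complex.ofReal_pow, ← Complex.ofReal_one, ← Complex.ofReal_sub, Complex.norm_real,
        Real.norm_eq_abs, abs_le]
      constructor <;> linarith
  rw [tendsto_iff_norm_sub_tendsto_zero]
  have key : Tendsto (fun r : ℝ => ∑' i, ‖((r : ℂ) ^ d i - 1) • v i‖ ^ 2) (𝓝[<] 1) (𝓝 0) := by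
    have h0 : (0 : ℝ) = ∑' _ : ι, (0 : ℝ) := by simp
    rw [h0]
    refine tendsto_tsum_of_dominated_convergence hs (fun i => ?_) ?_
    · have : Continuous fun r : ℝ => ‖((r : ℂ) ^ d i - 1) • v i‖ ^ 2 := by fun_prop
      have h1 := (this.tendsto 1).mono_left (nhdsWithin_le_nhds (s := Set.Iio 1))
      simpa using h1
    · filter_upwards [eventually_norm_lt_one] with r hr i
      rw [Real.norm_of_nonneg (by positivity), norm_smul, mul_pow]
      exact mul_le_of_le_one_left (by positivity)
        (pow_le_one₀ (norm_nonneg _) (hnorm r hr.1 hr.2.1 i).2)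
  have key2 := key.sqrt
  rw [Real.sqrt_zero] at key2
  refine key2.congr' ?_
  filter_upwards [eventually_norm_lt_one] with r hr
  have ha := fun i => (hnorm r hr.1 hr.2.1 i).1
  have hb := fun i => (hnorm r hr.1 hr.2.1 i).2
  rw [← (summable_of_orthogonal (hortho _) (hsum _ ha)).tsum_sub (summable_of_orthogonal hv hs)]
  have : (fun i => (r : ℂ) ^ d i • v i - v i) = fun i => ((r : ℂ) ^ d i - 1) • v i := by
    funext i; rw [sub_smul, one_smul]
  rw [this, ← norm_sq_tsum_of_orthogonal (hortho fun i => (r : ℂ) ^ d i - 1)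
    (hsum (fun i => (r : ℂ) ^ d i - 1) hb), Real.sqrt_sq (norm_nonneg _)]

end Hilbert

/-! ### Series of holomorphic functions -/

/-- A series of holomorphic functions with a summable bound is holomorphic. The derivatives are
bounded by Cauchy's estimate on a smaller ball. -/
theorem differentiableAt_tsum_of_norm_le {ι E F : Type*} [NormedAddCommGroup E] [NormedSpace ℂ E]
    [NormedAddCommGroup F] [NormedSpace ℂ F] [CompleteSpace F] {f : ι → E → F} {u : ι → ℝ}
    {U : Set E} (hU : IsOpen U) (hu : Summable u) (hf : ∀ i, DifferentiableOn ℂ (f i) U)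
    (hb : ∀ i, ∀ z ∈ U, ‖f i z‖ ≤ u i) {z : E} (hz : z ∈ U) :
    DifferentiableAt ℂ (fun z => ∑' i, f i z) z := by
  obtain ⟨δ, hδ, hsub⟩ := Metric.isOpen_iff.mp hU z hz
  have hsub2 : ∀ w ∈ Metric.ball z (δ / 2), Metric.ball w (δ / 2) ⊆ U := by
    intro w hw
    refine (Metric.ball_subset_ball' ?_).trans hsub
    rw [Metric.mem_ball] at hw
    linarith
  have hmem : ∀ w ∈ Metric.ball z (δ / 2), w ∈ U := fun w hw =>
    hsub2 w hw (Metric.mem_ball_self (by positivity))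
  have hz' : z ∈ Metric.ball z (δ / 2) := Metric.mem_ball_self (by positivity)
  refine (hasFDerivAt_tsum_of_isPreconnected (f' := fun i w => fderiv ℂ (f i) w)
    (hu.mul_left (2 / (δ / 2))) Metric.isOpen_ball (convex_ball z (δ / 2)).isPreconnected
    (fun i w hw => ?_) (fun i w hw => ?_) hz' (Summable.of_norm_bounded hu fun i => hb i z hz)
    hz').differentiableAt
  · exact ((hf i).differentiableAt (hU.mem_nhds (hmem w hw))).hasFDerivAt
  · have := Complex.norm_fderiv_le_div_of_mapsTo_ball (R₂ := 2 * u i) ((hf i).mono (hsub2 w hw))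
      (fun y hy => ?_) (by positivity : 0 < δ / 2)
    · refine this.trans (le_of_eq ?_); ring
    · rw [mem_closedBall_iff_norm]
      refine (norm_sub_le _ _).trans ?_
      linarith [hb i y (hsub2 w hw hy), hb i w (hmem w hw)]

/-! ### The `ℂ_m`-valued pairing on `L²` of the Lie sphere -/

/-- The product `(a, b) ↦ a† b` as a real-bilinear map. -/
def daggerMulL (m : ℕ) : Cl m →L[ℝ] Cl m →L[ℝ] Cl m :=
  LinearMap.mkContinuous₂
    (LinearMap.mk₂ ℝ (fun a b : Cl m => dagger a * b)
      (fun a a' b => by rw [dagger_add, add_mul])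
      (fun c a b => by
        rw [← Complex.coe_smul, dagger_smul, Complex.conj_ofReal, smul_mul_assoc, Complex.coe_smul])
      (fun a b b' => mul_add _ _ _)
      (fun c a b => by rw [← Complex.coe_smul, mul_smul_comm, Complex.coe_smul]))
    ‖mulL m‖ fun a b => by
      have := norm_mul_le_mulL (dagger a) b
      rwa [norm_dagger] at this

/-- The Hilbert space `L²` of the Lie sphere. -/
abbrev LieL2 (m : ℕ) : Type := Lp (Cl m) 2 (lieMeasure m)

/-- The pairing `∫ x† y` on `L²` of the Lie sphere. -/
def pairL (m : ℕ) : LieL2 m →L[ℝ] LieL2 m →L[ℝ] Cl m :=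
  (daggerMulL m).lpPairing (lieMeasure m) 2 2

theorem pairL_apply (x y : LieL2 m) : pairL m x y = ∫ p, dagger (x p) * y p ∂lieMeasure m :=
  (daggerMulL m).lpPairing_eq_integral x y

theorem integrable_dagger_mul {x y : ℝ × UnitSphere m → Cl m} (hx : MemLp x 2 (lieMeasure m))
    (hy : MemLp y 2 (lieMeasure m)) : Integrable (fun p => dagger (x p) * y p) (lieMeasure m) :=
  memLp_one_iff_integrable.mp ((daggerMulL m).memLp_of_bilin 1 hx hy)

theorem pairL_toLp {x y : ℝ × UnitSphere m → Cl m} (hx : MemLp x 2 (lieMeasure m))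
    (hy : MemLp y 2 (lieMeasure m)) :
    pairL m hx.toLp hy.toLp = ∫ p, dagger (x p) * y p ∂lieMeasure m := by
  rw [pairL_apply]
  refine integral_congr_ae ?_
  filter_upwards [hx.coeFn_toLp, hy.coeFn_toLp] with p h1 h2
  rw [h1, h2]

theorem coord_pairL (x y : LieL2 m) : (pairL m x y).coord ∅ = inner ℂ x y := by
  rw [pairL_apply, L2.inner_def, ← coordL_apply, ← ContinuousLinearMap.integral_comp_comm]
  · simp only [coordL_apply, coord_dagger_mul]
  · exact integrable_dagger_mul (Lp.memLp x) (Lp.memLp y)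

theorem innerOL2_eq {f g : (Fin m → ℂ) → Cl m} (hf : MemOL2 f) (hg : MemOL2 g) :
    innerOL2 f g = pairL m hf.memLp.toLp hg.memLp.toLp := (pairL_toLp _ _).symm

theorem coord_innerOL2_self {f : (Fin m → ℂ) → Cl m} (hf : MemOL2 f) :
    ((innerOL2 f f).coord ∅).re = ‖hf.memLp.toLp‖ ^ 2 := by
  rw [innerOL2_eq hf hf, coord_pairL, inner_self_eq_norm_sq_to_K, ← RCLike.ofReal_pow]
  exact Complex.ofReal_re _

end

section

variable {m : ℕ} {τ : Fin m → ℂ}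

/-! ### The components of a function with respect to the generators -/

/-- The class in `L²` of the Lie sphere of a function which is continuous on all of `ℂ^m`. -/
def entL {Q : (Fin m → ℂ) → Cl m} (hQ : Continuous Q) : LieL2 m :=
  (isBoundaryValue_of_continuous hQ).1.toLp

theorem coeFn_entL {Q : (Fin m → ℂ) → Cl m} (hQ : Continuous Q) :
    entL hQ =ᵐ[lieMeasure m] fun p => Q (liePoint p) := MemLp.coeFn_toLp _

theorem integrable_dagger_comp_mul {Q : (Fin m → ℂ) → Cl m} (hQ : Continuous Q) (y : LieL2 m) :
    Integrable (fun p => dagger (Q (liePoint p)) * y p) (lieMeasure m) :=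
  integrable_dagger_mul (isBoundaryValue_of_continuous hQ).1 (Lp.memLp y)

theorem pairL_entL {Q : (Fin m → ℂ) → Cl m} (hQ : Continuous Q) (y : LieL2 m) :
    pairL m (entL hQ) y = ∫ p, dagger (Q (liePoint p)) * y p ∂lieMeasure m := by
  rw [pairL_apply]
  refine integral_congr_ae ?_
  filter_upwards [coeFn_entL hQ] with p hp
  rw [hp]

theorem continuous_mul_const {Q : (Fin m → ℂ) → Cl m} (hQ : Continuous Q) (a : Cl m) :
    Continuous fun z => Q z * a := hQ.mul continuous_const

theorem pairL_entL_mul_const {Q : (Fin m → ℂ) → Cl m} (hQ : Continuous Q) (a : Cl m)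
    (y : LieL2 m) :
    pairL m (entL (continuous_mul_const hQ a)) y = dagger a * pairL m (entL hQ) y := by
  rw [pairL_entL, pairL_entL, ← mulL_apply (dagger a),
    ← ContinuousLinearMap.integral_comp_comm _ (integrable_dagger_comp_mul hQ y)]
  simp only [mulL_apply, dagger_mul, mul_assoc]

theorem continuous_gen (τ : Fin m → ℂ) (j : ℕ) (q : ℕ × ℕ) : Continuous (gen τ j q) :=
  (isHom_gen τ j q).contDiff.continuous

/-- The coefficient `λ ∫ ψ† F` of `F` with respect to the generator `ψ`. -/
def coef (τ : Fin m → ℂ) (j : ℕ) (F : LieL2 m) (q : ℕ × ℕ) : Cl m :=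
  ((lam m q.1 q.2 : ℝ) : ℂ) • pairL m (entL (continuous_gen τ j q)) F

/-- The component `ψ c` of `F` in the module generated by the generator `ψ`. -/
def part (τ : Fin m → ℂ) (j : ℕ) (F : LieL2 m) (q : ℕ × ℕ) (z : Fin m → ℂ) : Cl m :=
  gen τ j q z * coef τ j F q

theorem continuous_part (τ : Fin m → ℂ) (j : ℕ) (F : LieL2 m) (q : ℕ × ℕ) :
    Continuous (part τ j F q) := continuous_mul_const (continuous_gen τ j q) _

theorem isHom_part (τ : Fin m → ℂ) (j : ℕ) (F : LieL2 m) (q : ℕ × ℕ) :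
    IsHom (j + (q.1 + q.2)) (part τ j F q) := (isHom_gen τ j q).mul_const _

/-- The pairing with a generator absorbs the factor `τ† τ / 4`. -/
theorem dagger_mul_vec_mul_pairL (hτ : IsIso τ) (j : ℕ) (F : LieL2 m) (q : ℕ × ℕ) :
    dagger (vec τ) * vec τ * pairL m (entL (continuous_gen τ j q)) F =
      (4 : ℂ) • pairL m (entL (continuous_gen τ j q)) F := by
  have h := pairL_entL_mul_const (continuous_gen τ j q) (dagger (vec τ) * vec τ) F
  rw [dagger_mul, dagger_dagger] at h
  rw [← h, pairL_entL, pairL_entL, ← integral_smul]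
  simp only [gen_mul_dagger_mul_vec hτ, dagger_smul, smul_mul_assoc, map_ofNat]

/-- Orthogonality of the components, and the reproducing property of the coefficients. -/
theorem pairL_gen_part (hm : 3 ≤ m) (hτ : IsIso τ) (j : ℕ) (F : LieL2 m) (q q' : ℕ × ℕ) :
    pairL m (entL (continuous_gen τ j q)) (entL (continuous_part τ j F q')) =
      if q = q' then pairL m (entL (continuous_gen τ j q)) F else 0 := by
  have hl : ((lam m q.1 q.2 : ℝ) : ℂ) ≠ 0 := by exact_mod_cast (lam_pos hm q.1 q.2).ne'
  have h1 : pairL m (entL (continuous_gen τ j q)) (entL (continuous_part τ j F q')) =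
      (∫ p, dagger (gen τ j q (liePoint p)) * gen τ j q' (liePoint p) ∂lieMeasure m) *
        coef τ j F q' := by
    have hi := integrable_dagger_mul (isBoundaryValue_of_continuous (continuous_gen τ j q)).1
      (isBoundaryValue_of_continuous (continuous_gen τ j q')).1
    rw [entL, entL, pairL_toLp]
    simp only [part, ← mul_assoc]
    exact ((mulL m).flip (coef τ j F q')).integral_comp_comm hi
  have h2 := integral_dagger_gen_mul_gen hm hτ j q q'
  rw [h1]
  have h4 : (4 * (lam m q.1 q.2 : ℝ) : ℂ) ≠ 0 := mul_ne_zero (by norm_num) hl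
  refine smul_right_injective _ h4 ?_
  beta_reduce
  rw [← smul_mul_assoc, h2]
  split_ifs with h
  · subst h
    rw [coef, mul_smul_comm, dagger_mul_vec_mul_pairL hτ, smul_smul]
    congr 1; ring
  · rw [zero_mul, smul_zero]

theorem inner_part_left (τ : Fin m → ℂ) (j : ℕ) (F : LieL2 m) (q : ℕ × ℕ) (y : LieL2 m) :
    inner ℂ (entL (continuous_part τ j F q)) y =
      (dagger (coef τ j F q) * pairL m (entL (continuous_gen τ j q)) y).coord ∅ := by
  rw [← coord_pairL]
  congr 1
  exact pairL_entL_mul_const (continuous_gen τ j q) (coef τ j F q) y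

theorem inner_part_part (hm : 3 ≤ m) (hτ : IsIso τ) (j : ℕ) (F : LieL2 m) (q q' : ℕ × ℕ)
    (h : q ≠ q') :
    inner ℂ (entL (continuous_part τ j F q)) (entL (continuous_part τ j F q')) = 0 := by
  rw [inner_part_left, pairL_gen_part hm hτ, if_neg h, mul_zero, coord_zero]

theorem summable_norm_sq_part (hm : 3 ≤ m) (hτ : IsIso τ) (j : ℕ) (F : LieL2 m) :
    Summable fun q => ‖entL (continuous_part τ j F q)‖ ^ 2 := by
  refine summable_norm_sq_of_inner_eq (inner_part_part hm hτ j F) (x := F) fun q => ?_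
  rw [inner_part_left, inner_part_left, pairL_gen_part hm hτ, if_pos rfl]

theorem summable_part (hm : 3 ≤ m) (hτ : IsIso τ) (j : ℕ) (F : LieL2 m) :
    Summable fun q => entL (continuous_part τ j F q) :=
  summable_of_orthogonal (inner_part_part hm hτ j F) (summable_norm_sq_part hm hτ j F)

/-- The sum of the components has the same coefficients as `F`. -/
theorem pairL_gen_sub_tsum (hm : 3 ≤ m) (hτ : IsIso τ) (j : ℕ) (F : LieL2 m) (q : ℕ × ℕ) :
    pairL m (entL (continuous_gen τ j q)) (F - ∑' q, entL (continuous_part τ j F q)) = 0 := by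
  rw [map_sub, ContinuousLinearMap.map_tsum _ (summable_part hm hτ j F)]
  simp only [pairL_gen_part hm hτ]
  rw [tsum_eq_single q (fun q' h => if_neg h.symm), if_pos rfl, sub_self]

/-! ### The integral kernel -/

/-- The terms `λ ψ(z) ψ(e^{iθ} ω)†` of the kernel. -/
def kern (τ : Fin m → ℂ) (j : ℕ) (q : ℕ × ℕ) (z : Fin m → ℂ) (p : ℝ × UnitSphere m) : Cl m :=
  ((lam m q.1 q.2 : ℝ) : ℂ) • (gen τ j q z * dagger (gen τ j q (liePoint p)))

/-- The dominating sequence `(n+1)^m L^n`, `n = α + k`. -/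
def domSeq (m : ℕ) (L : ℝ) (q : ℕ × ℕ) : ℝ :=
  (((q.1 + q.2 : ℕ) : ℝ) + 1) ^ m * L ^ (q.1 + q.2)

theorem summable_domSeq (m : ℕ) {L : ℝ} (h0 : 0 ≤ L) (h1 : L < 1) : Summable (domSeq m L) :=
  summable_add_one_pow_mul m h0 h1

theorem continuous_kern (τ : Fin m → ℂ) (j : ℕ) (q : ℕ × ℕ) (z : Fin m → ℂ) :
    Continuous (kern τ j q z) := by
  have := (continuous_gen τ j q).comp (continuous_liePoint (m := m))
  exact (continuous_const.mul (continuous_dagger.comp this)).const_smul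
    ((lam m q.1 q.2 : ℝ) : ℂ)

/-- Normal convergence of the kernel, uniformly on the Lie sphere. -/
theorem exists_norm_kern_le (hm : 3 ≤ m) (hτ : IsIso τ) (j : ℕ) :
    ∃ C : ℝ, 0 ≤ C ∧ ∀ (q : ℕ × ℕ) (z : Fin m → ℂ) (p : ℝ × UnitSphere m), lieNormSq z ≤ 1 →
      ‖kern τ j q z p‖ ≤ C * domSeq m (√(lieNormSq z)) q := by
  obtain ⟨C, hC, h⟩ := exists_lam_mul_norm_gen_mul_le hm hτ j
  refine ⟨‖mulL m‖ * C, by positivity, fun q z p hz => ?_⟩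
  have hl := lam_pos hm q.1 q.2
  rw [kern, norm_smul, Complex.norm_real, Real.norm_of_nonneg hl.le]
  calc _ ≤ lam m q.1 q.2 * (‖mulL m‖ * ‖gen τ j q z‖ * ‖dagger (gen τ j q (liePoint p))‖) := by
        gcongr
        exact norm_mul_le_mulL _ _
    _ = ‖mulL m‖ * (lam m q.1 q.2 * (‖gen τ j q z‖ * ‖gen τ j q (liePoint p)‖)) := by
        rw [norm_dagger]; ring
    _ ≤ ‖mulL m‖ * (C * domSeq m (√(lieNormSq z)) q) :=
        mul_le_mul_of_nonneg_left (h q z p hz) (norm_nonneg _)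
    _ = _ := by ring

theorem part_eq_integral (τ : Fin m → ℂ) (j : ℕ) (F : LieL2 m) (q : ℕ × ℕ) (z : Fin m → ℂ) :
    part τ j F q z = ∫ p, kern τ j q z p * F p ∂lieMeasure m := by
  rw [part, coef, mul_smul_comm, pairL_entL, ← mulL_apply (gen τ j q z),
    ← ContinuousLinearMap.integral_comp_comm _
      (integrable_dagger_comp_mul (continuous_gen τ j q) F), ← integral_smul]
  simp only [mulL_apply, kern, smul_mul_assoc, mul_assoc]

theorem integrable_of_LieL2 (F : LieL2 m) : Integrable F (lieMeasure m) :=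
  (Lp.memLp F).integrable (by norm_num)

theorem integrable_kern_mul (τ : Fin m → ℂ) (j : ℕ) (F : LieL2 m) (q : ℕ × ℕ) (z : Fin m → ℂ) :
    Integrable (fun p => kern τ j q z p * F p) (lieMeasure m) := by
  have := ((mulL m (gen τ j q z)).integrable_comp
    (integrable_dagger_comp_mul (continuous_gen τ j q) F)).smul ((lam m q.1 q.2 : ℝ) : ℂ)
  refine this.congr (Eventually.of_forall fun p => ?_)
  simp only [Pi.smul_apply, mulL_apply, kern, smul_mul_assoc, mul_assoc]

theorem exists_integral_norm_kern_mul_le (hm : 3 ≤ m) (hτ : IsIso τ) (j : ℕ) (F : LieL2 m) :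
    ∃ C : ℝ, 0 ≤ C ∧ ∀ (q : ℕ × ℕ) (z : Fin m → ℂ), lieNormSq z ≤ 1 →
      ∫ p, ‖kern τ j q z p * F p‖ ∂lieMeasure m ≤ C * domSeq m (√(lieNormSq z)) q := by
  obtain ⟨C, hC, h⟩ := exists_norm_kern_le hm hτ j
  have hI : 0 ≤ ∫ p, ‖F p‖ ∂lieMeasure m := integral_nonneg fun _ => norm_nonneg _
  refine ⟨‖mulL m‖ * C * ∫ p, ‖F p‖ ∂lieMeasure m, by positivity, fun q z hz => ?_⟩
  calc ∫ p, ‖kern τ j q z p * F p‖ ∂lieMeasure m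
      ≤ ∫ p, ‖mulL m‖ * (C * domSeq m (√(lieNormSq z)) q) * ‖F p‖ ∂lieMeasure m := by
        refine integral_mono (integrable_kern_mul τ j F q z).norm
          ((integrable_of_LieL2 F).norm.const_mul _) fun p => ?_
        refine (norm_mul_le_mulL _ _).trans ?_
        gcongr
        exact h q z p hz
    _ = _ := by rw [integral_const_mul]; ring

theorem exists_norm_part_le (hm : 3 ≤ m) (hτ : IsIso τ) (j : ℕ) (F : LieL2 m) :
    ∃ C : ℝ, 0 ≤ C ∧ ∀ (q : ℕ × ℕ) (z : Fin m → ℂ), lieNormSq z ≤ 1 →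
      ‖part τ j F q z‖ ≤ C * domSeq m (√(lieNormSq z)) q := by
  obtain ⟨C, hC, h⟩ := exists_integral_norm_kern_mul_le hm hτ j F
  refine ⟨C, hC, fun q z hz => ?_⟩
  rw [part_eq_integral]
  exact (norm_integral_le_integral_norm _).trans (h q z hz)

/-- The transform as a series. -/
def hua (τ : Fin m → ℂ) (j : ℕ) (F : LieL2 m) (z : Fin m → ℂ) : Cl m := ∑' q, part τ j F q z

theorem domSeq_mono {L L' : ℝ} (h0 : 0 ≤ L) (h : L ≤ L') (q : ℕ × ℕ) :
    domSeq m L q ≤ domSeq m L' q := by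
  unfold domSeq; gcongr

theorem differentiableOn_hua (hm : 3 ≤ m) (hτ : IsIso τ) (j : ℕ) (F : LieL2 m) :
    DifferentiableOn ℂ (hua τ j F) (lieBall m) := by
  intro z hz
  obtain ⟨C, hC, h⟩ := exists_norm_part_le hm hτ j F
  obtain ⟨L, hL, hL1⟩ := exists_between (sqrt_lieNormSq_lt_one hz)
  have hL0 : 0 ≤ L := (Real.sqrt_nonneg _).trans hL.le
  refine (differentiableAt_tsum_of_norm_le (U := {w | √(lieNormSq w) < L})
    (isOpen_lt (continuous_lieNormSq.sqrt) continuous_const)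
    ((summable_domSeq m hL0 hL1).mul_left C)
    (fun q => (isHom_part τ j F q).differentiable.differentiableOn) (fun q w hw => ?_)
    hL).differentiableWithinAt
  have hw' : √(lieNormSq w) < L := hw
  have hw1 : lieNormSq w ≤ 1 := by
    have := (Real.sqrt_lt' one_pos).mp (hw'.trans hL1)
    rw [one_pow] at this
    exact this.le
  exact (h q w hw1).trans (by gcongr; exact domSeq_mono (Real.sqrt_nonneg _) hw'.le q)

theorem lieNormSq_smul_liePoint (r : ℝ) (p : ℝ × UnitSphere m) :
    lieNormSq ((r : ℂ) • liePoint p) = r ^ 2 := by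
  rw [lieNormSq_smul, lieNormSq_liePoint, Complex.norm_real, Real.norm_eq_abs, sq_abs, mul_one]

theorem tsum_ofNormedAddCommGroup_apply {X ι : Type*} [TopologicalSpace X] {f : ι → X → Cl m}
    {u : ι → ℝ} (hc : ∀ i, Continuous (f i)) (hb : ∀ i x, ‖f i x‖ ≤ u i) (h0 : ∀ i, 0 ≤ u i)
    (hu : Summable u) :
    Summable (fun i => BoundedContinuousFunction.ofNormedAddCommGroup (f i) (hc i) (u i) (hb i)) ∧
    ∀ x, (∑' i, BoundedContinuousFunction.ofNormedAddCommGroup (f i) (hc i) (u i) (hb i)) x =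
      ∑' i, f i x := by
  have hs : Summable fun i =>
      BoundedContinuousFunction.ofNormedAddCommGroup (f i) (hc i) (u i) (hb i) :=
    Summable.of_norm_bounded hu fun i =>
      BoundedContinuousFunction.norm_ofNormedAddCommGroup_le (hc i) (h0 i) (hb i)
  exact ⟨hs, fun x => (BoundedContinuousFunction.evalCLM ℂ x).map_tsum hs⟩

theorem domSeq_nonneg {L : ℝ} (h0 : 0 ≤ L) (q : ℕ × ℕ) : 0 ≤ domSeq m L q := by
  unfold domSeq; positivity

/-- On the spheres inside the Lie ball the series converges in `L²`. -/
theorem coeFn_tsum_pow_smul (hm : 3 ≤ m) (hτ : IsIso τ) (j : ℕ) (F : LieL2 m) {r : ℝ}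
    (h0 : 0 < r) (h1 : r < 1) :
    (∑' q : ℕ × ℕ, ((r : ℂ) ^ (j + (q.1 + q.2))) • entL (continuous_part τ j F q) : LieL2 m)
      =ᵐ[lieMeasure m] fun p => hua τ j F ((r : ℂ) • liePoint p) := by
  obtain ⟨C, hC, h⟩ := exists_norm_part_le hm hτ j F
  have hc : ∀ q, Continuous fun p : ℝ × UnitSphere m => part τ j F q ((r : ℂ) • liePoint p) :=
    fun q => (continuous_part τ j F q).comp (continuous_liePoint.const_smul (r : ℂ))
  have hb : ∀ (q : ℕ × ℕ) (p : ℝ × UnitSphere m),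
      ‖part τ j F q ((r : ℂ) • liePoint p)‖ ≤ C * domSeq m r q := fun q p => by
    have := h q ((r : ℂ) • liePoint p) (by rw [lieNormSq_smul_liePoint]; nlinarith)
    rwa [lieNormSq_smul_liePoint, Real.sqrt_sq h0.le] at this
  obtain ⟨hs, he⟩ := tsum_ofNormedAddCommGroup_apply hc hb
    (fun q => mul_nonneg hC (domSeq_nonneg h0.le q)) ((summable_domSeq m h0.le h1).mul_left C)
  have h2 : ∀ q : ℕ × ℕ, ((r : ℂ) ^ (j + (q.1 + q.2))) • entL (continuous_part τ j F q) =
      BoundedContinuousFunction.toLp 2 (lieMeasure m) ℂ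
        (BoundedContinuousFunction.ofNormedAddCommGroup _ (hc q) _ (hb q)) := by
    intro q
    refine Lp.ext ?_
    filter_upwards [Lp.coeFn_smul ((r : ℂ) ^ (j + (q.1 + q.2))) (entL (continuous_part τ j F q)),
      coeFn_entL (continuous_part τ j F q), BoundedContinuousFunction.coeFn_toLp 2 (lieMeasure m) ℂ
        (BoundedContinuousFunction.ofNormedAddCommGroup _ (hc q) _ (hb q))] with p e1 e2 e3
    rw [e1, e3, Pi.smul_apply, e2]
    exact ((isHom_part τ j F q).homog _ _).symm
  simp only [h2]
  rw [← ContinuousLinearMap.map_tsum _ hs]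
  refine (BoundedContinuousFunction.coeFn_toLp 2 (lieMeasure m) ℂ _).trans
    (Eventually.of_forall fun p => ?_)
  exact he p

/-- The transform has the sum of the components as its boundary value, by Abel summation. -/
theorem isBoundaryValue_hua (hm : 3 ≤ m) (hτ : IsIso τ) (j : ℕ) (F : LieL2 m) :
    IsBoundaryValue (hua τ j F) (∑' q, entL (continuous_part τ j F q) : LieL2 m) := by
  refine ⟨Lp.memLp _, ?_⟩
  have h := tendsto_tsum_pow_smul (inner_part_part hm hτ j F) (summable_norm_sq_part hm hτ j F)
    fun q => j + (q.1 + q.2)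
  rw [tendsto_iff_edist_tendsto_0] at h
  refine h.congr' ?_
  filter_upwards [eventually_norm_lt_one] with r hr
  rw [Lp.edist_def]
  refine eLpNorm_congr_ae ?_
  filter_upwards [coeFn_tsum_pow_smul hm hτ j F hr.1 hr.2.1] with p hp
  rw [Pi.sub_apply, hp]

end

section

variable {m : ℕ} {τ : Fin m → ℂ}

/-! ### The orthogonal projection -/

/-- The class in `L²` of the boundary value of a function in `OL²(LB(0,1))`. -/
def MemOL2.toL2 {f : (Fin m → ℂ) → Cl m} (hf : MemOL2 f) : LieL2 m := hf.memLp.toLp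

theorem MemOL2.toL2_eq {f : (Fin m → ℂ) → Cl m} (hf : MemOL2 f) {y : LieL2 m}
    (h : bdry f =ᵐ[lieMeasure m] y) : hf.toL2 = y :=
  Lp.ext (hf.memLp.coeFn_toLp.trans h)

theorem MemOL2.toL2_sub {f f' : (Fin m → ℂ) → Cl m} (hf : MemOL2 f) (hf' : MemOL2 f')
    (h : MemOL2 (f - f')) : h.toL2 = hf.toL2 - hf'.toL2 := by
  refine h.toL2_eq ((hf.sub hf').2.trans ?_)
  filter_upwards [hf.memLp.coeFn_toLp, hf'.memLp.coeFn_toLp,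
    Lp.coeFn_sub hf.toL2 hf'.toL2] with p h1 h2 h3
  rw [h3, Pi.sub_apply, Pi.sub_apply]
  exact (congrArg₂ _ h1 h2).symm

theorem toL2_of_differentiable {Q : (Fin m → ℂ) → Cl m} (hQ : Differentiable ℂ Q)
    (h : MemOL2 Q) : h.toL2 = entL hQ.continuous :=
  h.toL2_eq ((memOL2_of_differentiable hQ).2.trans (coeFn_entL hQ.continuous).symm)

/-- The elements of the algebraic sum of the modules `𝔐^{j,α}(τ)` are entire, and orthogonal to
everything that is orthogonal to the generators. -/
theorem exists_pairL_eq_zero (hm : 2 ≤ m) (hτ : IsIso τ) {j : ℕ} {y : LieL2 m}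
    (hy : ∀ i, pairL m (entL (continuous_gen τ j i)) y = 0) {q : (Fin m → ℂ) → Cl m}
    (hq : q ∈ ⨆ α, modM τ j α) :
    ∃ hd : Differentiable ℂ q, pairL m (entL hd.continuous) y = 0 := by
  simp only [modM, Submodule.iSup_span] at hq
  induction hq using Submodule.span_induction with
  | mem q hq =>
    obtain ⟨α, k, rfl⟩ := Set.mem_iUnion.mp hq
    beta_reduce
    rw [psij_eq_gen hm hτ]
    exact ⟨(isHom_gen τ j (α, k)).differentiable, hy (α, k)⟩
  | zero =>
    refine ⟨differentiable_const 0, ?_⟩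
    rw [pairL_entL]
    simp
  | add q q' _ _ h h' =>
    obtain ⟨hd, h⟩ := h
    obtain ⟨hd', h'⟩ := h'
    refine ⟨hd.add hd', ?_⟩
    rw [pairL_entL] at h h' ⊢
    simp only [Pi.add_apply, dagger_add, add_mul]
    rw [integral_add (integrable_dagger_comp_mul hd.continuous y)
      (integrable_dagger_comp_mul hd'.continuous y), h, h', add_zero]
  | smul a q _ h =>
    obtain ⟨hd, h⟩ := h
    refine ⟨((mulL m).flip a.unop).differentiable.comp hd, ?_⟩
    have := pairL_entL_mul_const hd.continuous a.unop y
    rw [h, mul_zero] at this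
    exact this

/-- Elements of the closure are approximated by elements orthogonal to `y`. -/
theorem exists_norm_sub_entL_lt (hm : 2 ≤ m) (hτ : IsIso τ) {j : ℕ} {h : (Fin m → ℂ) → Cl m}
    (hh : h ∈ huaSpace τ j) {y : LieL2 m}
    (hy : ∀ i, pairL m (entL (continuous_gen τ j i)) y = 0) {ε : ℝ} (hε : 0 < ε) :
    ∃ x : LieL2 m, pairL m x y = 0 ∧ ‖hh.1.toL2 - x‖ < ε := by
  obtain ⟨q, hq, hlt⟩ := hh.2 (ε ^ 2) (by positivity)
  obtain ⟨hd, h0⟩ := exists_pairL_eq_zero hm hτ hy hq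
  have hM := (memOL2_of_differentiable hd).1
  have hs := (hh.1.sub hM).1
  rw [coord_innerOL2_self hs] at hlt
  refine ⟨_, h0, ?_⟩
  rw [← toL2_of_differentiable hd hM, ← hh.1.toL2_sub hM hs]
  exact lt_of_pow_lt_pow_left₀ 2 hε.le hlt

theorem pairL_eq_zero_of_mem_huaSpace (hm : 2 ≤ m) (hτ : IsIso τ) {j : ℕ}
    {h : (Fin m → ℂ) → Cl m} (hh : h ∈ huaSpace τ j) {y : LieL2 m}
    (hy : ∀ i, pairL m (entL (continuous_gen τ j i)) y = 0) : pairL m hh.1.toL2 y = 0 := by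
  have hcl : IsClosed {x : LieL2 m | pairL m x y = 0} :=
    isClosed_eq ((pairL m).flip y).continuous continuous_const
  refine hcl.closure_subset (Metric.mem_closure_iff.mpr fun ε hε => ?_)
  obtain ⟨x, hx, hlt⟩ := exists_norm_sub_entL_lt hm hτ hh hy hε
  exact ⟨x, hx, by rwa [dist_eq_norm]⟩

theorem part_mem (hm : 2 ≤ m) (hτ : IsIso τ) (j : ℕ) (F : LieL2 m) (q : ℕ × ℕ) :
    part τ j F q ∈ ⨆ α, modM τ j α := by
  refine Submodule.mem_iSup_of_mem q.1 ?_
  have h : psij τ j q.1 q.2 ∈ modM τ j q.1 := Submodule.subset_span ⟨q.2, rfl⟩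
  rw [psij_eq_gen hm hτ] at h
  exact Submodule.smul_mem _ (MulOpposite.op (coef τ j F q)) h

theorem memOL2_hua (hm : 3 ≤ m) (hτ : IsIso τ) (j : ℕ) (F : LieL2 m) : MemOL2 (hua τ j F) :=
  (MemOL2.of_isBoundaryValue (differentiableOn_hua hm hτ j F)
    (isBoundaryValue_hua hm hτ j F)).1

theorem toL2_hua (hm : 3 ≤ m) (hτ : IsIso τ) (j : ℕ) (F : LieL2 m) :
    (memOL2_hua hm hτ j F).toL2 = ∑' q, entL (continuous_part τ j F q) :=
  MemOL2.toL2_eq _ (MemOL2.of_isBoundaryValue (differentiableOn_hua hm hτ j F)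
    (isBoundaryValue_hua hm hτ j F)).2

theorem entL_sum {ι : Type*} (s : Finset ι) {Q : ι → (Fin m → ℂ) → Cl m}
    (hQ : ∀ i, Continuous (Q i)) (h : Continuous (∑ i ∈ s, Q i)) :
    entL h = ∑ i ∈ s, entL (hQ i) := by
  classical
  refine Lp.ext ((coeFn_entL h).trans ?_)
  refine EventuallyEq.trans ?_ (Lp.coeFn_finsetSum s fun i => entL (hQ i)).symm
  have h1 : ∀ᵐ p ∂lieMeasure m, ∀ i ∈ s, entL (hQ i) p = Q i (liePoint p) :=
    (Finset.eventually_all s).mpr fun i _ => coeFn_entL (hQ i)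
  filter_upwards [h1] with p hp
  rw [Finset.sum_apply, Finset.sum_apply]
  exact Finset.sum_congr rfl fun i hi => (hp i hi).symm

/-- The partial sums of the components lie in the algebraic sum of the modules. -/
theorem hua_mem_huaSpace (hm : 3 ≤ m) (hτ : IsIso τ) (j : ℕ) (F : LieL2 m) :
    hua τ j F ∈ huaSpace τ j := by
  have hG := memOL2_hua hm hτ j F
  refine ⟨hG, fun ε hε => ?_⟩
  obtain ⟨s, hs⟩ := ((Metric.tendsto_nhds.mp (summable_part hm hτ j F).hasSum (√ε)
    (Real.sqrt_pos.mpr hε))).exists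
  have hq : ∑ i ∈ s, part τ j F i ∈ ⨆ α, modM τ j α :=
    Submodule.sum_mem _ fun i _ => part_mem (by omega) hτ j F i
  have hd : Differentiable ℂ (∑ i ∈ s, part τ j F i) :=
    Differentiable.sum fun i _ => (isHom_part τ j F i).differentiable
  have hM := (memOL2_of_differentiable hd).1
  have hS := (hG.sub hM).1
  refine ⟨_, hq, ?_⟩
  rw [coord_innerOL2_self hS]
  change ‖hS.toL2‖ ^ 2 < ε
  rw [hG.toL2_sub hM hS, toL2_hua hm hτ, toL2_of_differentiable hd,
    entL_sum s (continuous_part τ j F) hd.continuous, ← dist_eq_norm, dist_comm,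
    ← Real.lt_sqrt dist_nonneg]
  exact hs

theorem isHuaRadonTransform_hua (hm : 3 ≤ m) (hτ : IsIso τ) (j : ℕ) {f : (Fin m → ℂ) → Cl m}
    (hf : MemOL2 f) : IsHuaRadonTransform τ j f (hua τ j hf.toL2) := by
  refine ⟨hua_mem_huaSpace hm hτ j _, fun h hh => ?_⟩
  have hG := memOL2_hua hm hτ j hf.toL2
  have hS := (hf.sub hG).1
  rw [innerOL2_eq hh.1 hS]
  change pairL m hh.1.toL2 hS.toL2 = 0
  rw [hf.toL2_sub hG hS, toL2_hua hm hτ]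
  exact pairL_eq_zero_of_mem_huaSpace (by omega) hτ hh (pairL_gen_sub_tsum hm hτ j _)

theorem IsHuaRadonTransform.pairL_eq {j : ℕ} {f g h : (Fin m → ℂ) → Cl m}
    (H : IsHuaRadonTransform τ j f g) (hf : MemOL2 f) (hh : h ∈ huaSpace τ j) :
    pairL m hh.1.toL2 hf.toL2 = pairL m hh.1.toL2 H.1.1.toL2 := by
  have hS := (hf.sub H.1.1).1
  have h0 := H.2 h hh
  rw [innerOL2_eq hh.1 hS] at h0
  change pairL m hh.1.toL2 hS.toL2 = 0 at h0
  rwa [hf.toL2_sub H.1.1 hS, map_sub, sub_eq_zero] at h0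

/-- Two projections of `f` have the same boundary value, and hence agree in the Lie ball. -/
theorem IsHuaRadonTransform.eqOn (hm : 1 ≤ m) {j : ℕ} {f g g' : (Fin m → ℂ) → Cl m}
    (hf : MemOL2 f) (H : IsHuaRadonTransform τ j f g) (H' : IsHuaRadonTransform τ j f g') :
    Set.EqOn g g' (lieBall m) := by
  have hS := H.1.1.sub H'.1.1
  have h1 : ∀ {h} (hh : h ∈ huaSpace τ j), inner ℂ hh.1.toL2 (H.1.1.toL2 - H'.1.1.toL2) = 0 := by
    intro h hh
    rw [← coord_pairL, map_sub, ← H.pairL_eq hf hh, ← H'.pairL_eq hf hh, sub_self, coord_zero]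
  have h2 : H.1.1.toL2 - H'.1.1.toL2 = 0 := by
    rw [← inner_self_eq_zero (𝕜 := ℂ), inner_sub_left, h1 H.1, h1 H'.1, sub_zero]
  rw [← H.1.1.toL2_sub H'.1.1 hS.1] at h2
  have h3 : bdry (g - g') =ᵐ[lieMeasure m] 0 := by
    refine hS.1.memLp.coeFn_toLp.symm.trans ?_
    change (hS.1.toL2 : ℝ × UnitSphere m → Cl m) =ᵐ[lieMeasure m] 0
    rw [h2]
    exact Lp.coeFn_zero _ _ _
  intro z hz
  exact sub_eq_zero.mp (eq_zero_of_bdry_ae_eq_zero hm hS.1 h3 hz)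

/-! ### The integral formula -/

instance : IsTopologicalSemiring (Cl m) where

theorem inverse_vec_liePoint (p : ℝ × UnitSphere m) :
    Ring.inverse (vec (liePoint p) : Cl m) = dagger (vec (liePoint p)) :=
  Ring.inverse_unit (⟨vec (liePoint p), dagger (vec (liePoint p)), vec_liePoint_mul_dagger p,
    dagger_vec_liePoint_mul p⟩ : (Cl m)ˣ)

/-- On the Lie sphere `u^{-1} = u†`, so that the factors `z^j` and `u^{-j}` turn the terms of the
kernels `L^α` into those built from the generators `z^j M[ψ]`. -/
theorem vec_pow_mul_kernelTerm_mul (hm : 2 ≤ m) (hτ : IsIso τ) (j : ℕ) (q : ℕ × ℕ)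
    (z : Fin m → ℂ) (p : ℝ × UnitSphere m) :
    vec z ^ j * kernelTerm τ q.1 q.2 z (star (liePoint p)) *
      Ring.inverse (vec (star (star (liePoint p)))) ^ j = kern τ j q z p := by
  rw [star_star, inverse_vec_liePoint, kernelTerm, star_star, kern, gen, gen, Mpsi_eq hm hτ,
    dagger_mul, dagger_pow]
  simp only [mul_smul_comm, smul_mul_assoc, mul_assoc]

/-- The iterated sum over `k` and `α` is the sum over the pairs. -/
theorem kernelK_eq_tsum (hm : 3 ≤ m) (hτ : IsIso τ) (j : ℕ) {z : Fin m → ℂ} (hz : z ∈ lieBall m)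
    (p : ℝ × UnitSphere m) :
    kernelK τ j z (star (liePoint p)) = ∑' q, kern τ j q z p := by
  have hs := summable_kernelTerm hm hτ hz p
  have h1 : ∀ q : ℕ × ℕ, kern τ j q z p = _ := fun q =>
    (vec_pow_mul_kernelTerm_mul (by omega) hτ j q z p).symm
  simp only [h1]
  rw [((hs.mul_left (vec z ^ j)).mul_right
    (Ring.inverse (vec (star (star (liePoint p)))) ^ j)).tsum_prod]
  unfold kernelK kernelKα kernelL
  refine tsum_congr fun α => ?_
  have hα := hs.prod_factor α
  rw [← hα.tsum_mul_left, ← (hα.mul_left _).tsum_mul_right]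

theorem lieNormSq_le_one {z : Fin m → ℂ} (hz : z ∈ lieBall m) : lieNormSq z ≤ 1 := by
  have : lieNormSq z < 1 := hz
  exact this.le

theorem memLp_kernelK (hm : 3 ≤ m) (hτ : IsIso τ) (j : ℕ) {z : Fin m → ℂ} (hz : z ∈ lieBall m) :
    MemLp (fun p => kernelK τ j z (star (liePoint p))) 2 (lieMeasure m) := by
  obtain ⟨C, hC, h⟩ := exists_norm_kern_le hm hτ j
  have h0 := Real.sqrt_nonneg (lieNormSq z)
  obtain ⟨-, he⟩ := tsum_ofNormedAddCommGroup_apply (fun q => continuous_kern τ j q z)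
    (fun q p => h q z p (lieNormSq_le_one hz)) (fun q => mul_nonneg hC (domSeq_nonneg h0 q))
    ((summable_domSeq m h0 (sqrt_lieNormSq_lt_one hz)).mul_left C)
  simp only [kernelK_eq_tsum hm hτ j hz, ← he]
  exact MemLp.of_bound (BoundedContinuousFunction.continuous _).aestronglyMeasurable _
    (Eventually.of_forall (BoundedContinuousFunction.norm_coe_le_norm _))

theorem summable_kern (hm : 3 ≤ m) (hτ : IsIso τ) (j : ℕ) {z : Fin m → ℂ} (hz : z ∈ lieBall m)
    (p : ℝ × UnitSphere m) : Summable fun q => kern τ j q z p := by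
  obtain ⟨C, hC, h⟩ := exists_norm_kern_le hm hτ j
  exact Summable.of_norm_bounded ((summable_domSeq m (Real.sqrt_nonneg (lieNormSq z))
    (sqrt_lieNormSq_lt_one hz)).mul_left C) fun q => h q z p (lieNormSq_le_one hz)

theorem hua_eq_integral (hm : 3 ≤ m) (hτ : IsIso τ) (j : ℕ) (F : LieL2 m) {z : Fin m → ℂ}
    (hz : z ∈ lieBall m) :
    hua τ j F z = ∫ p, kernelK τ j z (star (liePoint p)) * F p ∂lieMeasure m := by
  obtain ⟨C, hC, h⟩ := exists_integral_norm_kern_mul_le hm hτ j F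
  have hs : Summable fun q => ∫ p, ‖kern τ j q z p * F p‖ ∂lieMeasure m :=
    Summable.of_nonneg_of_le (fun q => integral_nonneg fun _ => norm_nonneg _)
      (fun q => h q z (lieNormSq_le_one hz)) ((summable_domSeq m (Real.sqrt_nonneg (lieNormSq z))
        (sqrt_lieNormSq_lt_one hz)).mul_left C)
  have hsum := hasSum_integral_of_summable_integral_norm
    (fun q => integrable_kern_mul τ j F q z) hs
  simp only [← part_eq_integral] at hsum
  rw [hua, hsum.tsum_eq]
  refine integral_congr_ae (Eventually.of_forall fun p => ?_)
  beta_reduce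
  rw [(summable_kern hm hτ j hz p).tsum_mul_right, kernelK_eq_tsum hm hτ j hz]

theorem integrable_kernelK_mul (hm : 3 ≤ m) (hτ : IsIso τ) (j : ℕ) {z : Fin m → ℂ}
    (hz : z ∈ lieBall m) {y : ℝ × UnitSphere m → Cl m} (hy : MemLp y 2 (lieMeasure m)) :
    Integrable (fun p => kernelK τ j z (star (liePoint p)) * y p) (lieMeasure m) :=
  memLp_one_iff_integrable.mp ((mulL m).memLp_of_bilin 1 (memLp_kernelK hm hτ j hz) hy)

end

end

end HuaRadon

open HuaRadon in
theorem theorem5p2 (m : ℕ) (hm : 3 ≤ m) (t s : EuclideanSpace ℝ (Fin m))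
    (ht : ‖t‖ = 1) (hs : ‖s‖ = 1) (hts : inner ℝ t s = 0) (j : ℕ) :
    (∀ z ∈ lieBall m, ∀ p : ℝ × UnitSphere m,
      Summable fun q : ℕ × ℕ => kernelTerm (tau t s) q.1 q.2 z (star (liePoint p))) ∧
    ∀ f : (Fin m → ℂ) → Cl m, MemOL2 f →
      (∃ g, IsHuaRadonTransform (tau t s) j f g) ∧
      ∀ g, IsHuaRadonTransform (tau t s) j f g → ∀ z ∈ lieBall m,
        MeasureTheory.Integrable
          (fun p => kernelK (tau t s) j z (star (liePoint p)) * bdry f p) (lieMeasure m) ∧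
        g z = ∫ p, kernelK (tau t s) j z (star (liePoint p)) * bdry f p ∂lieMeasure m := by
  have hτ := isIso_tau ht hs hts
  refine ⟨fun z hz p => summable_kernelTerm hm hτ hz p, fun f hf => ?_⟩
  have hG := isHuaRadonTransform_hua hm hτ j hf
  refine ⟨⟨_, hG⟩, fun g hg z hz => ⟨integrable_kernelK_mul hm hτ j hz hf.memLp, ?_⟩⟩
  rw [hg.eqOn (by omega) hf hG hz, hua_eq_integral hm hτ j _ hz]
  refine integral_congr_ae ?_
  filter_upwards [hf.memLp.coeFn_toLp] with p hp
  exact congrArg _ hp
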